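/- **Setting.** Let $\mu>0$ and let $S$ be a scattering function: a meromorphic function on $\mathbb{C}$, not identically zero, bounded on the strip $0\le\operatorname{Im}\zeta\le\pi$, with $S(\zeta)^{-1}=S(-\zeta)=\overline{S(\bar\zeta)}=S(\zeta+i\pi)$. Let $\omega:[0,\infty)\to[0,\infty)$ be monotonically increasing with $\omega(p+q)\le\omega(p)+\omega(q)$ (in particular, any analytic indicatrix such as $\beta\log(1+p)$, $\beta>0$, or $p^\alpha$, $0<\alpha<1$). Let $\mathcal{H}=\bigoplus_{n\ge0}\mathcal{H}_n$, where $\mathcal{H}_n\subset L^2(\mathbb{R}^n)$ consists of the $\psi$ with $\psi(\dots,\theta_j,\theta_{j+1},\dots)=S(\theta_{j+1}-\theta_j)\,\psi(\dots,\theta_{j+1},\theta_j,\dots)$ a.e. Put $p(\theta)=\mu(\cosh\theta,\sinh\theta)$, with Minkowski product $p\cdot x=p^0x^0-p^1x^1$. On $\mathcal{H}_n$ let $(U(x)\psi)(\boldsymbol\theta)=e^{i\sum_k p(\theta_k)\cdot x}\psi(\boldsymbol\theta)$, $(U(j)\psi)(\theta_1,\dots,\theta_n)=\overline{\psi(\theta_n,\dots,\theta_1)}$,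 and let $H/\mu$ act as multiplication by $\sum_k\cosh\theta_k$. Let $\mathcal{H}^{\omega,\mathrm f}$ be the space of vectors $\psi$ of finite particle number with $\|e^{\omega(H/\mu)}\psi\|<\infty$. Let $z^\dagger(g)\psi=\sqrt{n+1}\,P_{n+1}(g\otimes\psi)$ for $\psi\in\mathcal{H}_n$, with $P_{n+1}$ the orthogonal projection of $L^2(\mathbb{R}^{n+1})$ onto $\mathcal{H}_{n+1}$, let $z(g)=z^\dagger(\bar g)^*$, and, on vectors of finite particle number, $$\phi(f)=z^\dagger(f^+)+z(f^-),\qquad f^\pm(\theta)=\frac1{2\pi}\int d^2x\,f(x)e^{\pm ip(\theta)\cdot x}.$$ For open $\mathcal{O}\subset\mathbb{R}^2$ let $\mathcal{D}^\omega(\mathcal{O})$ be the space of $f\in C_c^\infty(\mathcal{O})$ for which $\theta\mapsto e^{\omega(\cosh\theta)}f^\pm(\theta)$ are bounded and square integrable, and $\mathcal{D}^\omega_{\mathbb R}(\mathcal{O})$ the set of its real-valued elements. Let $\mathcal{W}=\{x^1>|x^0|\}$, $\mathcal{W}'=-\mathcal{W}$, $\mathcal{W}_x=\mathcal{W}+x$,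 $\mathcal{W}'_x=\mathcal{W}'+x$, $\mathcal{O}_{x,y}=\mathcal{W}_x\cap\mathcal{W}'_y$. Set $\mathcal{A}(\mathcal{W})=\{e^{i\phi(f)^-}: f\in\mathcal{D}^\omega_{\mathbb R}(\mathcal{W}')\}'$, $\mathcal{A}(\mathcal{W}_x)=U(x)\mathcal{A}(\mathcal{W})U(x)^*$, $\mathcal{A}(\mathcal{W}'_y)=U(j)\mathcal{A}(\mathcal{W}_{-y})U(j)$, $\mathcal{A}(\mathcal{O}_{x,y})=\mathcal{A}(\mathcal{W}_x)\cap\mathcal{A}(\mathcal{W}'_y)$. Let $\mathcal{Q}^\omega$ be the space of quadratic forms $A$ on $\mathcal{H}^{\omega,\mathrm f}\times\mathcal{H}^{\omega,\mathrm f}$ such that for each $n$ the forms $P^{\mathrm f}_nAe^{-\omega(H/\mu)}P^{\mathrm f}_n$ and $P^{\mathrm f}_ne^{-\omega(H/\mu)}AP^{\mathrm f}_n$ are bounded, where $P^{\mathrm f}_n$ projects onto at most $n$ particles. $A\in\mathcal{Q}^\omega$ is *$\omega$-local* in $\mathcal{W}_x$ iff $[A,\phi(f)]=0$ in matrix elements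 on $\mathcal{H}^{\omega,\mathrm f}$ for all $f\in\mathcal{D}^\omega(\mathcal{W}_x')$; in $\mathcal{W}'_y$ iff $U(j)A^*U(j)$ is $\omega$-local in $\mathcal{W}_{-y}$; in $\mathcal{O}_{x,y}$ iff it is $\omega$-local in both $\mathcal{W}_x$ and $\mathcal{W}_y'$. It is *$\omega$-closable* iff there is a closed operator $A^-$ (its $\omega$-closure) with core $\mathcal{H}^{\omega,\mathrm f}$ and $\mathcal{H}^{\omega,\mathrm f}\subset\operatorname{dom}(A^-)^*$ that coincides with $A$ as a quadratic form on $\mathcal{H}^{\omega,\mathrm f}\times\mathcal{H}^{\omega,\mathrm f}$. A closed, densely defined operator $T$ is *affiliated* with a von Neumann algebra $M$ iff $BT\subset TB$ for all $B\in M'$. **Proposition.** Let $\mathcal{R}$ be one of the regions $\mathcal{W}_x$, $\mathcal{W}'_y$, $\mathcal{O}_{x,y}$ with $x,y\in\mathbb{R}^2$. (a) Let $A$ be a bounded operator on $\mathcal{H}$. Then $A\in\mathcal{Q}^\omega$ (as a quadratic form), and $A$ is $\omega$-local in $\mathcal{R}$ if and only if $A\in\mathcal{A}(\mathcal{R})$.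 (b) Let $A\in\mathcal{Q}^\omega$ be $\omega$-closable. If $A^-$ is affiliated with $\mathcal{A}(\mathcal{R})$, then $A$ is $\omega$-local in $\mathcal{R}$. Suppose moreover that for all $g\in\mathcal{D}^\omega_{\mathbb R}(\mathbb{R}^2)$, $$\exp(i\phi(g)^-)\,\mathcal{H}^{\omega,\mathrm f}\subset\operatorname{dom}A^-\quad\text{if }\mathcal{R}=\mathcal{W}_x,$$ $$U(j)\exp(i\phi(g)^-)U(j)\,\mathcal{H}^{\omega,\mathrm f}\subset\operatorname{dom}A^-\quad\text{if }\mathcal{R}=\mathcal{W}'_y,$$ and both inclusions if $\mathcal{R}=\mathcal{O}_{x,y}$. Then $A$ is $\omega$-local in $\mathcal{R}$ if and only if $A^-$ is affiliated with $\mathcal{A}(\mathcal{R})$. (c) If $S=-1$, then for every $\omega$-closable $A\in\mathcal{Q}^\omega$, $A$ is $\omega$-local in $\mathcal{R}$ if and only if $A^-$ is affiliated with $\mathcal{A}(\mathcal{R})$. -/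

import Mathlib

open MeasureTheory Complex Filter Topology
open scoped InnerProductSpace

noncomputable section

namespace IntegrableQFT

/-! ## Scattering function, indicatrix -/

/-- A scattering function `S`: a meromorphic function on `ℂ`, bounded on the strip `0 ≤ Im ζ ≤ π`,
with `S(ζ)⁻¹ = S(-ζ) = conj (S (conj ζ)) = S(ζ + iπ)`.  A meromorphic function is represented by its
normal form (it has its analytic value wherever there is one and the value `0` at its poles); with
this representative and the convention `0⁻¹ = 0`, the symmetry relations hold literally
at all points, including zeros and poles. -/
structure ScatteringFunction where
  toFun : ℂ → ℂ
  meromorphic : MeromorphicNFOn toFun Set.univ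
  ne_zero : toFun ≠ 0
  bounded : ∃ C : ℝ, ∀ ζ : ℂ, 0 ≤ ζ.im → ζ.im ≤ Real.pi → ‖toFun ζ‖ ≤ C
  inv_eq : ∀ ζ, (toFun ζ)⁻¹ = toFun (-ζ)
  conj_eq : ∀ ζ, (starRingEnd ℂ) (toFun ((starRingEnd ℂ) ζ)) = toFun (-ζ)
  crossing : ∀ ζ, toFun (ζ + Real.pi * I) = toFun (-ζ)

/-- The conditions on the high-energy weight `ω : [0,∞) → [0,∞)` (monotone and subadditive). -/
structure IsIndicatrix (ω : ℝ → ℝ) : Prop where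
  nonneg : ∀ p, 0 ≤ p → 0 ≤ ω p
  mono : MonotoneOn ω (Set.Ici 0)
  subadd : ∀ p q, 0 ≤ p → 0 ≤ q → ω (p + q) ≤ ω p + ω q

/-! ## The `S`-symmetric Fock space -/

/-- `L²(ℝⁿ)`. -/
abbrev L2 (n : ℕ) : Type := Lp ℂ 2 (volume : Measure (Fin n → ℝ))

/-- Permuting coordinates preserves Lebesgue measure. -/
theorem measurePreserving_comp {n : ℕ} (e : Equiv.Perm (Fin n)) :
    MeasurePreserving (fun θ : Fin n → ℝ => θ ∘ e) volume volume := by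
  have h := volume_measurePreserving_piCongrLeft (fun _ : Fin n => ℝ) e.symm
  convert h using 1
  funext θ k
  have := MeasurableEquiv.piCongrLeft_apply_apply (β := fun _ : Fin n => ℝ) e.symm θ (e k)
  simpa using this.symm

/-- `ψ` is `S`-symmetric: exchanging the neighbouring variables `θ_j`, `θ_{j+1}` gives
`ψ(…,θ_j,θ_{j+1},…) = S(θ_{j+1} - θ_j) ψ(…,θ_{j+1},θ_j,…)` for almost all `θ`. -/
def IsSSymmetric (S : ScatteringFunction) {n : ℕ} (ψ : (Fin n → ℝ) → ℂ) : Prop :=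
  ∀ i j : Fin n, (j : ℕ) = i + 1 →
    ψ =ᵐ[volume] fun θ => S.toFun ((θ j - θ i : ℝ) : ℂ) * ψ (θ ∘ Equiv.swap i j)

theorem IsSSymmetric.congr {S : ScatteringFunction} {n : ℕ} {ψ φ : (Fin n → ℝ) → ℂ}
    (h : IsSSymmetric S ψ) (e : φ =ᵐ[volume] ψ) : IsSSymmetric S φ := by
  intro i j hij
  have e2 := (measurePreserving_comp (Equiv.swap i j)).quasiMeasurePreserving.ae_eq_comp e
  filter_upwards [h i j hij, e, e2] with θ h1 h2 h3
  simp only [Function.comp_apply] at h3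
  rw [h2, h1, h3]

/-- The `n`-particle space: the `S`-symmetric part of `L²(ℝⁿ)`. -/
def particleSpace (S : ScatteringFunction) (n : ℕ) : Submodule ℂ (L2 n) where
  carrier := {ψ | IsSSymmetric S ψ}
  zero_mem' := by
    have h : IsSSymmetric S (fun _ : Fin n → ℝ => (0 : ℂ)) := by
      intro i j _
      filter_upwards with θ
      simp
    exact h.congr (Lp.coeFn_zero _ _ _)
  add_mem' := by
    intro a b ha hb
    have h : IsSSymmetric S (fun θ : Fin n → ℝ => a θ + b θ) := by
      intro i j hij
      filter_upwards [ha i j hij, hb i j hij] with θ h1 h2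
      rw [mul_add, ← h1, ← h2]
    exact h.congr (Lp.coeFn_add a b)
  smul_mem' := by
    intro c a ha
    have h : IsSSymmetric S (fun θ : Fin n → ℝ => c • a θ) := by
      intro i j hij
      filter_upwards [ha i j hij] with θ h1
      rw [mul_smul_comm, ← h1]
    exact h.congr (Lp.coeFn_smul c a)

theorem isClosed_particleSpace (S : ScatteringFunction) (n : ℕ) :
    IsClosed (particleSpace S n : Set (L2 n)) := by
  refine IsSeqClosed.isClosed ?_
  intro u ψ hu hlim i j hij
  obtain ⟨ns, hns, hae⟩ := (tendstoInMeasure_of_tendsto_Lp hlim).exists_seq_tendsto_ae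
  have h1 : ∀ᵐ θ : Fin n → ℝ, ∀ k, u (ns k) θ
      = S.toFun ((θ j - θ i : ℝ) : ℂ) * u (ns k) (θ ∘ Equiv.swap i j) :=
    ae_all_iff.2 fun k => hu (ns k) i j hij
  have h2 := (measurePreserving_comp (Equiv.swap i j)).quasiMeasurePreserving.ae hae
  filter_upwards [h1, hae, h2] with θ k1 k2 k3
  refine tendsto_nhds_unique k2 ?_
  simp only [k1]
  exact k3.const_mul _

instance (S : ScatteringFunction) (n : ℕ) : CompleteSpace (particleSpace S n) :=
  (isClosed_particleSpace S n).completeSpace_coe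

/-- The Hilbert space `ℋ = ⨁ₙ ℋₙ` (Hilbert sum) of the model. -/
abbrev FockSpace (S : ScatteringFunction) : Type := lp (fun n => particleSpace S n) 2

/-- The wave function of the `n`-particle component of `ψ`. -/
def waveFun {S : ScatteringFunction} (ψ : FockSpace S) (n : ℕ) : (Fin n → ℝ) → ℂ :=
  ((ψ n : particleSpace S n) : L2 n)

/-! ## Translations and the space-time reflection -/

/-- Space-time `ℝ²`; the first component is the time coordinate. -/
abbrev Spacetime : Type := ℝ × ℝ

/-- Minkowski product of the momentum `p(θ) = m (cosh θ, sinh θ)` with `x`. -/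
def momentumDot (m : ℝ) (θ : ℝ) (x : Spacetime) : ℝ :=
  m * (Real.cosh θ * x.1 - Real.sinh θ * x.2)

/-- A norm-preserving (anti-)linear map on each `n`-particle space acts on the Fock space. -/
def fockMap {S : ScatteringFunction} {σ : ℂ →+* ℂ}
    (L : ∀ n, particleSpace S n →ₛₗᵢ[σ] particleSpace S n) : FockSpace S →ₛₗᵢ[σ] FockSpace S where
  toFun ψ := ⟨fun n => L n (ψ n), by
    have h : Memℓp (fun n => ψ n) 2 := lp.memℓp ψ
    have h' : Memℓp (fun n => L n (ψ n)) 2 := by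
      rw [memℓp_gen_iff (by norm_num)] at h ⊢
      simpa only [LinearIsometry.norm_map] using h
    exact h'⟩
  map_add' ψ χ := by
    ext1; funext n
    exact map_add (L n) (ψ n) (χ n)
  map_smul' c ψ := by
    ext1; funext n
    exact LinearMap.map_smulₛₗ (L n).toLinearMap c (ψ n)
  norm_map' ψ := by
    rw [lp.norm_eq_tsum_rpow (by norm_num), lp.norm_eq_tsum_rpow (by norm_num)]
    congr 1
    refine tsum_congr fun n => ?_
    congr 1
    exact (L n).norm_map (ψ n)

/-- The isometry of the `n`-particle space given by a pointwise recipe `F` on wave functions. -/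
def pointwiseIsometry {S : ScatteringFunction} {σ : ℂ →+* ℂ} {n : ℕ}
    (F : ((Fin n → ℝ) → ℂ) → (Fin n → ℝ) → ℂ)
    (hmem : ∀ ψ : L2 n, MemLp (F ψ) 2 volume)
    (hadd : ∀ ψ χ : L2 n, F (ψ + χ : L2 n) =ᵐ[volume] fun θ => F ψ θ + F χ θ)
    (hsmul : ∀ (c : ℂ) (ψ : L2 n), F (c • ψ : L2 n) =ᵐ[volume] fun θ => σ c * F ψ θ)
    (hnorm : ∀ ψ : L2 n, eLpNorm (F ψ) 2 volume = eLpNorm ψ 2 volume)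
    (hsym : ∀ ψ : L2 n, IsSSymmetric S ψ → IsSSymmetric S (F ψ)) :
    particleSpace S n →ₛₗᵢ[σ] particleSpace S n where
  toFun ψ := ⟨(hmem ψ).toLp _, (hsym ψ ψ.2).congr (MemLp.coeFn_toLp _)⟩
  map_add' ψ χ := by
    apply Subtype.ext
    change (hmem (ψ + χ : L2 n)).toLp _ = (hmem ψ).toLp _ + (hmem χ).toLp _
    rw [← MemLp.toLp_add]
    exact MemLp.toLp_congr _ _ (hadd ψ χ)
  map_smul' c ψ := by
    apply Subtype.ext
    change (hmem (c • ψ : L2 n)).toLp _ = σ c • (hmem ψ).toLp _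
    rw [← MemLp.toLp_const_smul]
    exact MemLp.toLp_congr _ _ (hsmul c ψ)
  norm_map' ψ := by
    change ‖(hmem ψ).toLp _‖ = ‖(ψ : L2 n)‖
    rw [Lp.norm_toLp, Lp.norm_def, hnorm]

/-- The phase `exp(i p(θ)·x)`, `p(θ) = ∑ p(θ_k)`. -/
def phase (m : ℝ) (x : Spacetime) {n : ℕ} (θ : Fin n → ℝ) : ℂ :=
  exp (I * ((∑ k, momentumDot m (θ k) x : ℝ) : ℂ))

theorem norm_phase (m : ℝ) (x : Spacetime) {n : ℕ} (θ : Fin n → ℝ) : ‖phase m x θ‖ = 1 := by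
  rw [phase, mul_comm]
  exact norm_exp_ofReal_mul_I _

theorem continuous_phase (m : ℝ) (x : Spacetime) (n : ℕ) :
    Continuous (phase m x : (Fin n → ℝ) → ℂ) := by
  unfold phase momentumDot
  have := Real.continuous_cosh
  have := Real.continuous_sinh
  fun_prop

theorem memLp_phase_mul (m : ℝ) (x : Spacetime) {n : ℕ} (ψ : L2 n) :
    MemLp (fun θ => phase m x θ * ψ θ) 2 volume := by
  refine (Lp.memLp ψ).of_le
    ((continuous_phase m x n).aestronglyMeasurable.mul (Lp.aestronglyMeasurable ψ)) ?_
  filter_upwards with θ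
  simp [norm_phase]

/-- The action of the translation by `x` on `n`-particle vectors: `ψ ↦ exp(i p·x) ψ`. -/
def translationN (S : ScatteringFunction) (m : ℝ) (x : Spacetime) (n : ℕ) :
    particleSpace S n →ₗᵢ[ℂ] particleSpace S n :=
  pointwiseIsometry (fun ψ θ => phase m x θ * ψ θ) (memLp_phase_mul m x)
    (fun ψ χ => by
      filter_upwards [Lp.coeFn_add ψ χ] with θ h
      rw [h, Pi.add_apply, mul_add])
    (fun c ψ => by
      filter_upwards [Lp.coeFn_smul c ψ] with θ h
      rw [h, Pi.smul_apply, smul_eq_mul, RingHom.id_apply]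
      ring)
    (fun ψ => by
      refine eLpNorm_congr_norm_ae ?_
      filter_upwards with θ
      simp [norm_phase])
    (fun ψ hψ => by
      intro i j hij
      filter_upwards [hψ i j hij] with θ h
      have hp : phase m x (θ ∘ Equiv.swap i j) = phase m x θ := by
        unfold phase
        simp only [Function.comp_apply]
        rw [Equiv.sum_comp (Equiv.swap i j) fun k => momentumDot m (θ k) x]
      rw [hp, h]
      ring)

/-- The translation unitary `U(x)`. -/
def translation (S : ScatteringFunction) (m : ℝ) (x : Spacetime) :
    FockSpace S →L[ℂ] FockSpace S :=
  (fockMap (translationN S m x)).toContinuousLinearMap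

theorem memLp_reflect {n : ℕ} (ψ : L2 n) :
    MemLp (fun θ : Fin n → ℝ => (starRingEnd ℂ) (ψ (θ ∘ Fin.revPerm))) 2 volume :=
  ((Lp.memLp ψ).comp_measurePreserving (measurePreserving_comp Fin.revPerm)).star

/-- The action of the reflection on `n`-particle vectors:
`(U(j)ψ)(θ₁,…,θₙ) = conj (ψ(θₙ,…,θ₁))`. -/
def reflectionN (S : ScatteringFunction) (n : ℕ) :
    particleSpace S n →ₗᵢ⋆[ℂ] particleSpace S n :=
  pointwiseIsometry (fun ψ θ => (starRingEnd ℂ) (ψ (θ ∘ Fin.revPerm))) memLp_reflect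
    (fun ψ χ => by
      filter_upwards [(measurePreserving_comp (n := n) Fin.revPerm).quasiMeasurePreserving.ae
        (Lp.coeFn_add ψ χ)] with θ h
      rw [h, Pi.add_apply, map_add])
    (fun c ψ => by
      filter_upwards [(measurePreserving_comp (n := n) Fin.revPerm).quasiMeasurePreserving.ae
        (Lp.coeFn_smul c ψ)] with θ h
      rw [h, Pi.smul_apply, smul_eq_mul, map_mul])
    (fun ψ => by
      rw [← eLpNorm_comp_measurePreserving (Lp.aestronglyMeasurable ψ)
        (measurePreserving_comp (n := n) Fin.revPerm)]
      refine eLpNorm_congr_norm_ae ?_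
      filter_upwards with θ
      simp)
    (fun ψ hψ => by
      intro i j hij
      have hs := hψ (Fin.rev j) (Fin.rev i) (by
        rw [Fin.val_rev, Fin.val_rev]
        have := j.2
        omega)
      have hs' := (measurePreserving_comp (n := n) Fin.revPerm).quasiMeasurePreserving.ae hs
      filter_upwards [hs'] with θ h
      rw [h]
      simp only [Function.comp_apply, Fin.revPerm_apply, Fin.rev_rev, map_mul]
      have e1 : (θ ∘ Fin.revPerm) ∘ Equiv.swap (Fin.rev j) (Fin.rev i)
          = (θ ∘ Equiv.swap i j) ∘ Fin.revPerm := by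
        funext k
        simp only [Function.comp_apply, Fin.revPerm_apply]
        congr 1
        simp only [Equiv.swap_apply_def, Fin.rev_eq_iff]
        split_ifs <;> simp_all
      have e2 := S.conj_eq ((θ i - θ j : ℝ) : ℂ)
      rw [conj_ofReal] at e2
      rw [e1, e2]
      congr 2
      push_cast
      ring)

/-- The antiunitary space-time reflection `U(j)`. -/
def reflection (S : ScatteringFunction) : FockSpace S →L⋆[ℂ] FockSpace S :=
  (fockMap (reflectionN S)).toContinuousLinearMap

/-! ## Creation and annihilation operators, the wedge-local field -/

theorem measurePreserving_head_tail (n : ℕ) :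
    MeasurePreserving (fun θ : Fin (n + 1) → ℝ => (θ 0, Fin.tail θ)) volume
      (volume.prod volume) :=
  volume_preserving_piFinSuccAbove (fun _ : Fin (n + 1) => ℝ) 0

theorem quasiMeasurePreserving_tail (n : ℕ) :
    Measure.QuasiMeasurePreserving (fun θ : Fin (n + 1) → ℝ => Fin.tail θ) volume volume :=
  Measure.quasiMeasurePreserving_snd.comp (measurePreserving_head_tail n).quasiMeasurePreserving

theorem memLp_prod (n : ℕ) (g : Lp ℂ 2 (volume : Measure ℝ)) (ψ : L2 n) :
    MemLp (fun z : ℝ × (Fin n → ℝ) => g z.1 * ψ z.2) 2 (volume.prod volume) := by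
  have hm : AEStronglyMeasurable (fun z : ℝ × (Fin n → ℝ) => g z.1 * ψ z.2)
      (volume.prod volume) :=
    ((Lp.aestronglyMeasurable g).comp_quasiMeasurePreserving
      Measure.quasiMeasurePreserving_fst).mul
      ((Lp.aestronglyMeasurable ψ).comp_quasiMeasurePreserving
        Measure.quasiMeasurePreserving_snd)
  rw [memLp_two_iff_integrable_sq_norm hm]
  have hg := (memLp_two_iff_integrable_sq_norm (Lp.aestronglyMeasurable g)).1 (Lp.memLp g)
  have hψ := (memLp_two_iff_integrable_sq_norm (Lp.aestronglyMeasurable ψ)).1 (Lp.memLp ψ)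
  simpa only [norm_mul, mul_pow] using hg.mul_prod hψ

theorem memLp_tensor (n : ℕ) (g : Lp ℂ 2 (volume : Measure ℝ)) (ψ : L2 n) :
    MemLp (fun θ : Fin (n + 1) → ℝ => g (θ 0) * ψ (Fin.tail θ)) 2 volume :=
  (memLp_prod n g ψ).comp_measurePreserving (measurePreserving_head_tail n)

/-- The (unsymmetrized) tensor product `ψ ↦ g ⊗ ψ`,
`(g ⊗ ψ)(θ₀,…,θₙ) = g(θ₀) ψ(θ₁,…,θₙ)`. -/
def tensorLeft (g : Lp ℂ 2 (volume : Measure ℝ)) (n : ℕ) : L2 n →L[ℂ] L2 (n + 1) :=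
  LinearMap.mkContinuous
    { toFun := fun ψ => (memLp_tensor n g ψ).toLp _
      map_add' := fun ψ χ => by
        rw [← MemLp.toLp_add]
        refine MemLp.toLp_congr _ _ ?_
        filter_upwards [(quasiMeasurePreserving_tail n).ae (Lp.coeFn_add ψ χ)] with θ h
        rw [h, Pi.add_apply, mul_add, Pi.add_apply]
      map_smul' := fun c ψ => by
        rw [RingHom.id_apply, ← MemLp.toLp_const_smul]
        refine MemLp.toLp_congr _ _ ?_
        filter_upwards [(quasiMeasurePreserving_tail n).ae (Lp.coeFn_smul c ψ)] with θ h
        rw [h, Pi.smul_apply, Pi.smul_apply, smul_eq_mul, smul_eq_mul]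
        ring }
    ‖g‖ (fun ψ => by
      change ‖(memLp_tensor n g ψ).toLp _‖ ≤ _
      have key : ‖(memLp_tensor n g ψ).toLp _‖ ^ 2 = (‖g‖ * ‖ψ‖) ^ 2 := by
        rw [mul_pow]
        have e : ∀ {α : Type} [MeasureSpace α] (u : Lp ℂ 2 (volume : Measure α)),
            ‖u‖ ^ 2 = ∫ a, ‖u a‖ ^ 2 := by
          intro α _ u
          have h := inner_self_eq_norm_sq_to_K (𝕜 := ℂ) u
          rw [L2.inner_def] at h
          simp only [inner_self_eq_norm_sq_to_K] at h
          have h2 : ((‖u‖ ^ 2 : ℝ) : ℂ) = ((∫ a, ‖u a‖ ^ 2 : ℝ) : ℂ) := by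
            have h3 := integral_ofReal (𝕜 := ℂ) (μ := (volume : Measure α))
              (f := fun a => ‖u a‖ ^ 2)
            push_cast at h3 ⊢
            exact (h3.symm.trans h).symm
          exact_mod_cast h2
        rw [e, e, e, ← integral_prod_mul]
        have h1 : ∫ θ : Fin (n + 1) → ℝ, ‖((memLp_tensor n g ψ).toLp _ : L2 (n + 1)) θ‖ ^ 2
            = ∫ θ : Fin (n + 1) → ℝ, ‖g (θ 0)‖ ^ 2 * ‖ψ (Fin.tail θ)‖ ^ 2 := by
          refine integral_congr_ae ?_
          filter_upwards [(memLp_tensor n g ψ).coeFn_toLp] with θ h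
          rw [h, norm_mul, mul_pow]
        rw [h1]
        exact (measurePreserving_head_tail n).integral_comp
          (MeasurableEquiv.piFinSuccAbove (fun _ : Fin (n + 1) => ℝ) 0).measurableEmbedding
          (fun z : ℝ × (Fin n → ℝ) => ‖g z.1‖ ^ 2 * ‖ψ z.2‖ ^ 2)
      exact le_of_eq ((pow_left_inj₀ (norm_nonneg _) (by positivity) two_ne_zero).1 key))

open Classical in
/-- The element of `L²(ℝ)` given by a square integrable function (only used for such functions). -/
def toL2 (g : ℝ → ℂ) : Lp ℂ 2 (volume : Measure ℝ) :=
  if h : MemLp g 2 volume then h.toLp g else 0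

/-- Creation operator `z†(g) : ℋₙ → ℋₙ₊₁`, `z†(g)ψ = √(n+1) P (g ⊗ ψ)` with `P` the orthogonal
projection onto the `S`-symmetric functions. -/
def creationN (S : ScatteringFunction) (g : ℝ → ℂ) (n : ℕ) :
    particleSpace S n →L[ℂ] particleSpace S (n + 1) :=
  ((Real.sqrt (n + 1) : ℝ) : ℂ) •
    ((particleSpace S (n + 1)).orthogonalProjectionOnto ∘L tensorLeft (toL2 g) n ∘L
      (particleSpace S n).subtypeL)

/-- Annihilation operator `z(g) : ℋₙ₊₁ → ℋₙ` (linear in `g`), the adjoint of `z†(conj g)`;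
`(z(g)ψ)(θ₁,…,θₙ) = √(n+1) ∫ g(θ₀) ψ(θ₀,…,θₙ) dθ₀`. -/
def annihilationN (S : ScatteringFunction) (g : ℝ → ℂ) (n : ℕ) :
    particleSpace S (n + 1) →L[ℂ] particleSpace S n :=
  ContinuousLinearMap.adjoint (creationN S (fun θ => (starRingEnd ℂ) (g θ)) n)

/-- `ψ` has at most `N` particles. -/
def AtMost {S : ScatteringFunction} (N : ℕ) (ψ : FockSpace S) : Prop := ∀ n, N < n → ψ n = 0

/-- The vectors of finite particle number. -/
def finiteParticle (S : ScatteringFunction) : Submodule ℂ (FockSpace S) where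
  carrier := {ψ | ∃ N, AtMost N ψ}
  zero_mem' := ⟨0, fun _ _ => rfl⟩
  add_mem' := by
    rintro a b ⟨M, hM⟩ ⟨N, hN⟩
    refine ⟨max M N, fun n hn => ?_⟩
    change a n + b n = 0
    rw [hM n (lt_of_le_of_lt (le_max_left _ _) hn), hN n (lt_of_le_of_lt (le_max_right _ _) hn),
      add_zero]
  smul_mem' := by
    rintro c a ⟨M, hM⟩
    refine ⟨M, fun n hn => ?_⟩
    change c • a n = 0
    rw [hM n hn, smul_zero]

/-- A finite family of components defines a vector. -/
theorem memlp_of_finite {S : ScatteringFunction} (u : ∀ n, particleSpace S n)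
    (h : ∃ N : ℕ, ∀ n, N < n → u n = 0) : Memℓp u 2 := by
  obtain ⟨N, hN⟩ := h
  refine (memℓp_zero ?_).of_exponent_ge zero_le
  refine (Set.finite_Iic N).subset fun n hn => ?_
  by_contra hc
  exact hn (hN n (not_le.1 hc))

/-- The components of `φ = z†(g) + z(h)` applied to a vector. -/
def fieldComponent (S : ScatteringFunction) (g h : ℝ → ℂ) (ψ : FockSpace S) :
    ∀ n, particleSpace S n
  | 0 => annihilationN S h 0 (ψ 1)
  | n + 1 => creationN S g n (ψ n) + annihilationN S h (n + 1) (ψ (n + 2))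

theorem fieldComponent_finite (S : ScatteringFunction) (g h : ℝ → ℂ) (ψ : FockSpace S)
    (hψ : ψ ∈ finiteParticle S) : ∃ N : ℕ, ∀ n, N < n → fieldComponent S g h ψ n = 0 := by
  obtain ⟨N, hN⟩ := hψ
  refine ⟨N + 1, fun n hn => ?_⟩
  obtain _ | n := n
  · omega
  · change creationN S g n (ψ n) + annihilationN S h (n + 1) (ψ (n + 2)) = 0
    rw [hN n (by omega), hN (n + 2) (by omega), map_zero, map_zero, add_zero]

/-- The operator `z†(g) + z(h)` on the vectors of finite particle number. -/
def creationAnnihilation (S : ScatteringFunction) (g h : ℝ → ℂ) :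
    FockSpace S →ₗ.[ℂ] FockSpace S where
  domain := finiteParticle S
  toFun :=
    { toFun := fun ψ => ⟨fieldComponent S g h ψ,
        memlp_of_finite _ (fieldComponent_finite S g h ψ ψ.2)⟩
      map_add' := fun ψ χ => by
        ext1; funext n
        change fieldComponent S g h _ n = fieldComponent S g h _ n + fieldComponent S g h _ n
        obtain _ | n := n
        · exact map_add (annihilationN S h 0) ((ψ : FockSpace S) 1) ((χ : FockSpace S) 1)
        · have h1 := map_add (creationN S g n) ((ψ : FockSpace S) n) ((χ : FockSpace S) n)
          have h2 := map_add (annihilationN S h (n + 1)) ((ψ : FockSpace S) (n + 2))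
            ((χ : FockSpace S) (n + 2))
          exact (congrArg₂ (· + ·) h1 h2).trans (add_add_add_comm _ _ _ _)
      map_smul' := fun c ψ => by
        ext1; funext n
        change fieldComponent S g h _ n = c • fieldComponent S g h _ n
        obtain _ | n := n
        · exact map_smul (annihilationN S h 0) c ((ψ : FockSpace S) 1)
        · have h1 := map_smul (creationN S g n) c ((ψ : FockSpace S) n)
          have h2 := map_smul (annihilationN S h (n + 1)) c ((ψ : FockSpace S) (n + 2))
          exact (congrArg₂ (· + ·) h1 h2).trans (smul_add c _ _).symm }

/-- `f⁺(θ) = (2π)⁻¹ ∫ f(x) exp(i p(θ)·x) d²x`. -/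
def fourierPlus (m : ℝ) (f : Spacetime → ℂ) (θ : ℝ) : ℂ :=
  (1 / (2 * Real.pi) : ℝ) * ∫ x : Spacetime, f x * exp (I * (momentumDot m θ x : ℝ))

/-- `f⁻(θ) = (2π)⁻¹ ∫ f(x) exp(-i p(θ)·x) d²x`. -/
def fourierMinus (m : ℝ) (f : Spacetime → ℂ) (θ : ℝ) : ℂ :=
  (1 / (2 * Real.pi) : ℝ) * ∫ x : Spacetime, f x * exp (-I * (momentumDot m θ x : ℝ))

/-- The field `φ(f) = z†(f⁺) + z(f⁻)` on the vectors of finite particle number. -/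
def field (S : ScatteringFunction) (m : ℝ) (f : Spacetime → ℂ) : FockSpace S →ₗ.[ℂ] FockSpace S :=
  creationAnnihilation S (fourierPlus m f) (fourierMinus m f)

/-- The test function space `𝒟^ω(O)`: smooth functions with compact support in `O` such that
`exp(ω(cosh θ)) f^±(θ)` is bounded and square integrable in `θ`. -/
def IsTestFunction (m : ℝ) (ω : ℝ → ℝ) (O : Set Spacetime) (f : Spacetime → ℂ) : Prop :=
  ContDiff ℝ ((⊤ : ℕ∞) : WithTop ℕ∞) f ∧ HasCompactSupport f ∧ tsupport f ⊆ O ∧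
  ∀ F ∈ ({fourierPlus m f, fourierMinus m f} : Set (ℝ → ℂ)),
    (∃ C : ℝ, ∀ θ, ‖(Real.exp (ω (Real.cosh θ)) : ℂ) * F θ‖ ≤ C) ∧
    MemLp (fun θ => (Real.exp (ω (Real.cosh θ)) : ℂ) * F θ) 2 volume

/-- The real-valued elements of `𝒟^ω(O)`. -/
def IsRealTestFunction (m : ℝ) (ω : ℝ → ℝ) (O : Set Spacetime) (f : Spacetime → ℂ) : Prop :=
  IsTestFunction m ω O f ∧ ∀ x, (f x).im = 0

/-! ## Weighted vectors and quadratic forms -/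

/-- The wave function of `exp(ω(H/m))ψ` at `n` particles; `H/m` acts as multiplication with
`E(θ) = ∑ cosh θ_k`. -/
def weighted {S : ScatteringFunction} (ω : ℝ → ℝ) (ψ : FockSpace S) (n : ℕ) (θ : Fin n → ℝ) : ℂ :=
  (Real.exp (ω (∑ k, Real.cosh (θ k))) : ℂ) * waveFun ψ n θ

/-- The space `ℋ^{ω,f}` of vectors of finite particle number with `‖exp(ω(H/m))ψ‖ < ∞`. -/
def Hωf (S : ScatteringFunction) (ω : ℝ → ℝ) : Submodule ℂ (FockSpace S) where
  carrier := {ψ | ψ ∈ finiteParticle S ∧ ∀ n, MemLp (weighted ω ψ n) 2 volume}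
  zero_mem' := by
    refine ⟨(finiteParticle S).zero_mem, fun n => ?_⟩
    refine (MemLp.zero (ε := ℂ) (p := 2)).ae_eq ?_
    filter_upwards [Lp.coeFn_zero ℂ 2 (volume : Measure (Fin n → ℝ))] with θ h
    have h' : waveFun (0 : FockSpace S) n θ = 0 := h
    simp [weighted, h']
  add_mem' := by
    rintro a b ⟨ha, ha'⟩ ⟨hb, hb'⟩
    refine ⟨(finiteParticle S).add_mem ha hb, fun n => ?_⟩
    refine ((ha' n).add (hb' n)).ae_eq ?_
    filter_upwards [Lp.coeFn_add ((a n : particleSpace S n) : L2 n)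
      ((b n : particleSpace S n) : L2 n)] with θ h
    have h' : waveFun (a + b) n θ = waveFun a n θ + waveFun b n θ := h
    simp only [weighted, Pi.add_apply, h', mul_add]
  smul_mem' := by
    rintro c a ⟨ha, ha'⟩
    refine ⟨(finiteParticle S).smul_mem c ha, fun n => ?_⟩
    refine ((ha' n).const_smul c).ae_eq ?_
    filter_upwards [Lp.coeFn_smul c ((a n : particleSpace S n) : L2 n)] with θ h
    have h' : waveFun (c • a) n θ = c * waveFun a n θ := h
    simp only [weighted, Pi.smul_apply, smul_eq_mul, h']
    ring

/-- The norm `‖exp(ω(H/m))ψ‖`, for `ψ ∈ ℋ^{ω,f}`. -/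
def omegaNorm {S : ScatteringFunction} (ω : ℝ → ℝ) (ψ : FockSpace S) : ℝ :=
  Real.sqrt (∑' n, ∫ θ, ‖weighted ω ψ n θ‖ ^ 2)

/-- Quadratic (sesquilinear) forms on `ℋ^{ω,f} × ℋ^{ω,f}`, antilinear in the first argument;
`A ψ χ` is written `⟨ψ, A χ⟩`. -/
abbrev QForm (S : ScatteringFunction) (ω : ℝ → ℝ) : Type :=
  Hωf S ω →ₗ⋆[ℂ] Hωf S ω →ₗ[ℂ] ℂ

/-- The space `𝒬^ω`: for each `N`, the norms of `P_N A exp(-ω(H/m)) P_N` and of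
`P_N exp(-ω(H/m)) A P_N` are finite, where `P_N` projects onto at most `N` particles. -/
def IsQOmega {S : ScatteringFunction} {ω : ℝ → ℝ} (A : QForm S ω) : Prop :=
  ∀ N : ℕ, ∃ C : ℝ, ∀ ψ χ : Hωf S ω, AtMost N (ψ : FockSpace S) → AtMost N (χ : FockSpace S) →
    ‖A ψ χ‖ ≤ C * (‖(ψ : FockSpace S)‖ * omegaNorm ω (χ : FockSpace S)) ∧
    ‖A ψ χ‖ ≤ C * (omegaNorm ω (ψ : FockSpace S) * ‖(χ : FockSpace S)‖)

/-- A bounded operator as a quadratic form. -/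
def ofBounded {S : ScatteringFunction} (ω : ℝ → ℝ) (A : FockSpace S →L[ℂ] FockSpace S) :
    QForm S ω :=
  LinearMap.mk₂'ₛₗ (starRingEnd ℂ) (RingHom.id ℂ)
    (fun ψ χ : Hωf S ω => ⟪(ψ : FockSpace S), A (χ : FockSpace S)⟫_ℂ)
    (fun ψ₁ ψ₂ χ => by rw [Submodule.coe_add, inner_add_left])
    (fun c ψ χ => by rw [Submodule.coe_smul, inner_smul_left, smul_eq_mul])
    (fun ψ χ₁ χ₂ => by rw [Submodule.coe_add, map_add, inner_add_right])
    (fun c ψ χ => by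
      rw [Submodule.coe_smul, map_smul, inner_smul_right, RingHom.id_apply, smul_eq_mul])

/-- The reflection leaves `ℋ^{ω,f}` invariant. -/
theorem reflection_mem {S : ScatteringFunction} {ω : ℝ → ℝ} {ψ : FockSpace S}
    (hψ : ψ ∈ Hωf S ω) : reflection S ψ ∈ Hωf S ω := by
  obtain ⟨⟨N, hN⟩, h⟩ := hψ
  refine ⟨⟨N, fun n hn => ?_⟩, fun n => ?_⟩
  · change reflectionN S n (ψ n) = 0
    rw [hN n hn, map_zero]
  · have h1 := ((h n).comp_measurePreserving (measurePreserving_comp (n := n) Fin.revPerm)).star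
    refine h1.ae_eq ?_
    filter_upwards [(memLp_reflect ((ψ n : particleSpace S n) : L2 n)).coeFn_toLp] with θ hθ
    have h' : waveFun (reflection S ψ) n θ
        = (starRingEnd ℂ) (waveFun ψ n (θ ∘ Fin.revPerm)) := hθ
    have hs : ∑ k, Real.cosh ((θ ∘ Fin.revPerm) k) = ∑ k, Real.cosh (θ k) :=
      Equiv.sum_comp Fin.revPerm fun k => Real.cosh (θ k)
    simp only [weighted, h', Pi.star_apply, Function.comp_apply, star_mul'] at hs ⊢
    rw [hs]
    congr 1
    exact conj_ofReal _

/-- `U(j)` as a map of `ℋ^{ω,f}` to itself. -/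
def reflectionω (S : ScatteringFunction) (ω : ℝ → ℝ) : Hωf S ω →ₗ⋆[ℂ] Hωf S ω where
  toFun ψ := ⟨reflection S ψ, reflection_mem ψ.2⟩
  map_add' ψ χ := Subtype.ext (map_add (reflection S) (ψ : FockSpace S) χ)
  map_smul' c ψ := Subtype.ext ((reflection S).map_smulₛₗ c (ψ : FockSpace S))

/-- The adjoint form: `⟨ψ, A* χ⟩ = conj ⟨χ, A ψ⟩`. -/
def QForm.adj {S : ScatteringFunction} {ω : ℝ → ℝ} (A : QForm S ω) : QForm S ω :=
  LinearMap.mk₂'ₛₗ (starRingEnd ℂ) (RingHom.id ℂ) (fun ψ χ => (starRingEnd ℂ) (A χ ψ))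
    (fun ψ₁ ψ₂ χ => by simp) (fun c ψ χ => by simp) (fun ψ χ₁ χ₂ => by simp)
    (fun c ψ χ => by simp)

/-- The form `U(j) A U(j)`; as `U(j)` is an antiunitary involution,
`⟨ψ, U(j) A U(j) χ⟩ = conj ⟨U(j)ψ, A U(j)χ⟩`. -/
def QForm.reflect {S : ScatteringFunction} {ω : ℝ → ℝ} (A : QForm S ω) : QForm S ω :=
  LinearMap.mk₂'ₛₗ (starRingEnd ℂ) (RingHom.id ℂ)
    (fun ψ χ => (starRingEnd ℂ) (A (reflectionω S ω ψ) (reflectionω S ω χ)))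
    (fun ψ₁ ψ₂ χ => by simp) (fun c ψ χ => by simp) (fun ψ χ₁ χ₂ => by simp)
    (fun c ψ χ => by simp)

/-! ## Regions, `ω`-locality -/

/-- The right wedge `W_x = W + x`, `W = {x¹ > |x⁰|}`. -/
def rightWedge (x : Spacetime) : Set Spacetime := {y | |y.1 - x.1| < y.2 - x.2}

/-- The left wedge `W'_x = W' + x`, `W' = {x¹ < -|x⁰|}`. -/
def leftWedge (x : Spacetime) : Set Spacetime := {y | |y.1 - x.1| < x.2 - y.2}

/-- The regions considered: `W_x`, `W'_y`, and `O_{x,y} = W_x ∩ W'_y`. -/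
inductive Region
  | right (x : Spacetime)
  | left (y : Spacetime)
  | doubleCone (x y : Spacetime)

/-- `ω`-locality in `W_x`: `[A, φ(f)] = 0` for all `f ∈ 𝒟^ω(W'_x)`, in matrix elements, i.e.
`⟨φ(f)* ψ, A χ⟩ = ⟨ψ, A φ(f) χ⟩` for `ψ, χ ∈ ℋ^{ω,f}`; here `ψ' = φ(f)* ψ` and `χ' = φ(f) χ`
(both automatically lie in `ℋ^{ω,f}` again). -/
def IsLocalRight {S : ScatteringFunction} {ω : ℝ → ℝ} (m : ℝ) (x : Spacetime) (A : QForm S ω) :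
    Prop :=
  ∀ f, IsTestFunction m ω (leftWedge x) f → ∀ ψ ψ' χ χ' : Hωf S ω,
    ((ψ : FockSpace S), (ψ' : FockSpace S)) ∈ (field S m f).adjoint.graph →
    ((χ : FockSpace S), (χ' : FockSpace S)) ∈ (field S m f).graph →
    A ψ' χ = A ψ χ'

/-- `A` is `ω`-local in `W'_y` iff `U(j) A* U(j)` is `ω`-local in `W_{-y}`. -/
def IsLocalLeft {S : ScatteringFunction} {ω : ℝ → ℝ} (m : ℝ) (y : Spacetime) (A : QForm S ω) :
    Prop :=
  IsLocalRight m (-y) A.adj.reflect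

/-- `ω`-locality of a quadratic form in a region. -/
def IsOmegaLocal {S : ScatteringFunction} {ω : ℝ → ℝ} (m : ℝ) (A : QForm S ω) : Region → Prop
  | .right x => IsLocalRight m x A
  | .left y => IsLocalLeft m y A
  | .doubleCone x y => IsLocalRight m x A ∧ IsLocalLeft m y A

/-! ## The local algebras -/

/-- `B = exp(iT)` for a self-adjoint operator `T`: `B = V(1)` for the strongly continuous
one-parameter group `V(t) = exp(itT)` of unitaries with generator `T`. -/
def IsExpI {H : Type*} [NormedAddCommGroup H] [InnerProductSpace ℂ H] [CompleteSpace H]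
    (T : H →ₗ.[ℂ] H) (B : H →L[ℂ] H) : Prop :=
  ∃ V : ℝ → H →L[ℂ] H, V 0 = 1 ∧ (∀ s t, V (s + t) = V s * V t) ∧
    (∀ t, V t ∈ unitary (H →L[ℂ] H)) ∧ (∀ ψ, Continuous fun t => V t ψ) ∧
    (∀ ψ η : H, (ψ, η) ∈ T.graph ↔ HasDerivAt (fun t => V t ψ) (I • η) 0) ∧ V 1 = B

/-- The algebra `𝒜(W) = {exp(iφ(f)⁻) : f ∈ 𝒟^ω_ℝ(W')}'` of the right wedge. -/
def wedgeAlgebra (S : ScatteringFunction) (m : ℝ) (ω : ℝ → ℝ) :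
    Set (FockSpace S →L[ℂ] FockSpace S) :=
  Set.centralizer {B | ∃ f, IsRealTestFunction m ω (leftWedge 0) f ∧
    IsExpI (field S m f).closure B}

/-- `𝒜(W_x) = U(x) 𝒜(W) U(x)*`. -/
def rightWedgeAlgebra (S : ScatteringFunction) (m : ℝ) (ω : ℝ → ℝ) (x : Spacetime) :
    Set (FockSpace S →L[ℂ] FockSpace S) :=
  (fun B => translation S m x ∘L B ∘L ContinuousLinearMap.adjoint (translation S m x)) ''
    wedgeAlgebra S m ω

/-- `𝒜(W'_y) = U(j) 𝒜(W_{-y}) U(j)`. -/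
def leftWedgeAlgebra (S : ScatteringFunction) (m : ℝ) (ω : ℝ → ℝ) (y : Spacetime) :
    Set (FockSpace S →L[ℂ] FockSpace S) :=
  (fun B => (reflection S).comp (B.comp (reflection S))) '' rightWedgeAlgebra S m ω (-y)

/-- The local von Neumann algebra of a region, `𝒜(O_{x,y}) = 𝒜(W_x) ∩ 𝒜(W'_y)`. -/
def localAlgebra (S : ScatteringFunction) (m : ℝ) (ω : ℝ → ℝ) :
    Region → Set (FockSpace S →L[ℂ] FockSpace S)
  | .right x => rightWedgeAlgebra S m ω x
  | .left y => leftWedgeAlgebra S m ω y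
  | .doubleCone x y => rightWedgeAlgebra S m ω x ∩ leftWedgeAlgebra S m ω y

/-! ## Closability and affiliation -/

/-- `T` is the `ω`-closure `A⁻` of the form `A`: a closed operator with core `ℋ^{ω,f}`, whose
adjoint is defined on `ℋ^{ω,f}`, and which agrees with `A` as a form. -/
structure IsOmegaClosure {S : ScatteringFunction} {ω : ℝ → ℝ} (A : QForm S ω)
    (T : FockSpace S →ₗ.[ℂ] FockSpace S) : Prop where
  closed : T.IsClosed
  core : T.HasCore (Hωf S ω)
  le_adjoint : Hωf S ω ≤ T.adjoint.domain
  eq_form : ∀ (ψ χ : Hωf S ω) (η : FockSpace S), ((χ : FockSpace S), η) ∈ T.graph →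
    ⟪(ψ : FockSpace S), η⟫_ℂ = A ψ χ

/-- The closed, densely defined operator `T` is affiliated with the von Neumann algebra `M`:
`B T ⊆ T B` for all `B` in the commutant of `M`. -/
def IsAffiliated {H : Type*} [NormedAddCommGroup H] [InnerProductSpace ℂ H] [CompleteSpace H]
    (T : H →ₗ.[ℂ] H) (M : Set (H →L[ℂ] H)) : Prop :=
  T.IsClosed ∧ Dense (T.domain : Set H) ∧
    ∀ B ∈ M.centralizer, ∀ ψ η : H, (ψ, η) ∈ T.graph → (B ψ, B η) ∈ T.graph

/-- `exp(iφ(g)⁻) ℋ^{ω,f} ⊆ dom T` for all `g ∈ 𝒟^ω_ℝ(ℝ²)`. -/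
def WeylDomain {S : ScatteringFunction} (m : ℝ) (ω : ℝ → ℝ)
    (T : FockSpace S →ₗ.[ℂ] FockSpace S) : Prop :=
  ∀ g, IsRealTestFunction m ω Set.univ g → ∀ B, IsExpI (field S m g).closure B →
    ∀ χ ∈ Hωf S ω, B χ ∈ T.domain

/-- The same condition for the reflected field `φ'`, whose exponentials are the operators
`U(j) exp(iφ(g)⁻) U(j)`: for all `g ∈ 𝒟^ω_ℝ(ℝ²)`, `U(j) exp(iφ(g)⁻) U(j) ℋ^{ω,f} ⊆ dom T`. -/
def WeylDomainReflected {S : ScatteringFunction} (m : ℝ) (ω : ℝ → ℝ)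
    (T : FockSpace S →ₗ.[ℂ] FockSpace S) : Prop :=
  ∀ g, IsRealTestFunction m ω Set.univ g → ∀ B, IsExpI (field S m g).closure B →
    ∀ χ ∈ Hωf S ω, reflection S (B (reflection S χ)) ∈ T.domain

/-- The domain condition belonging to a region: for right wedges it refers to the field `φ`, for
left wedges to the reflected field, for double cones to both. -/
def WeylDomainCondition {S : ScatteringFunction} (m : ℝ) (ω : ℝ → ℝ)
    (T : FockSpace S →ₗ.[ℂ] FockSpace S) : Region → Prop
  | .right _ => WeylDomain m ω T
  | .left _ => WeylDomainReflected m ω T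
  | .doubleCone _ _ => WeylDomain m ω T ∧ WeylDomainReflected m ω T

end IntegrableQFT

end

/-! For each region there is a family 𝓕 of fields (`regionFamily`), restricted to D = ℋ^{ω,f}, such
that 𝒜(R) is the commutant of E = {exp(iΦ) : Φ ∈ 𝓕} (`localAlgebra_eq`), and ω-locality of A means
A(Φψ, χ) = A(ψ, Φχ) for all Φ ∈ 𝓕 (`isOmegaLocal_iff`). For a double cone 𝓕 is the union of the two
wedge families, since the commutant of a union is the intersection of the commutants. The
proposition then becomes a statement about a Hilbert space, a dense subspace D, and a set 𝓕 of
symmetric endomorphisms of D that is stable under real multiples and for which every vector of D is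
entire.

From affiliation to locality (`form_comm_of_isAffiliated`): with T = A⁻ and V(t) = exp(itΦ) ∈ E,
affiliation gives T V(t)χ = V(t) Tχ. Hence ⟨T*ψ, V(t)χ⟩ = ⟨V(-t)ψ, Tχ⟩, and the derivative at t = 0
is the commutation relation.

From locality to affiliation (`isAffiliated_of_form_comm`): for B = exp(iΦ) and χ ∈ D with Bχ ∈ dom
T, expand ⟨T*ψ, Bχ⟩ in the exponential series and move every power of Φ to the other side by
locality. The sum is ⟨B*ψ, Tχ⟩, so TBχ = BTχ. As D is a core, the graph of T is invariant under B ⊕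
B for all B ∈ E. The set E contains adjoints, so the projection onto the graph commutes with B ⊕ B,
its matrix entries lie in E', and the graph is invariant under C ⊕ C for all C ∈ E''
(`invariant_of_mem_bicommutant`). This is affiliation with E'.

The domain condition of (b) provides Bχ ∈ dom T. In (a) it is trivial because T is everywhere
defined, and affiliation of a bounded operator with E' is membership in E' by E''' = E'. In (c) the
canonical anticommutation relations make Φ² a scalar (`IsFieldEnd.sq_eq`), so exp(iΦ)χ lies in the
span of χ and Φχ, hence in D.

What the model has to supply: D is dense; φ(f) maps D to itself, by subadditivity of ω for creation
and monotonicity for annihilation; the bound ‖Φᵏψ‖ ≤ cᵏ ∏ √(N+j+1) · const, which makes vectors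
entire; and the fact that D is a core for φ(f)⁻ (`graph_closure_eq`), so that exp(iφ(f)⁻) is given
on D by its series. Translations and the reflection carry fields to fields, which identifies the
algebras of all wedges. -/

noncomputable section

namespace IntegrableQFT

/-! ### Exponential series of a symmetric operator on entire vectors -/

section EntireSymmetric

variable {H : Type*} [NormedAddCommGroup H] [InnerProductSpace ℂ H] {D : Submodule ℂ H}

/-- A symmetric endomorphism of `D` all of whose vectors are entire vectors. -/
structure IsEntireSymmetric (Φ : Module.End ℂ D) : Prop where
  symm : ∀ ψ χ : D, ⟪(Φ ψ : H), (χ : H)⟫_ℂ = ⟪(ψ : H), (Φ χ : H)⟫_ℂ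
  summable : ∀ (t : ℝ) (ψ : D),
    Summable fun k : ℕ => |t| ^ k / (k.factorial : ℝ) * ‖((Φ ^ k) ψ : H)‖

/-- The terms of the exponential series of `itΦ` at `ψ`. -/
def expTerm (Φ : Module.End ℂ D) (t : ℝ) (ψ : D) (k : ℕ) : H :=
  ((I * t) ^ k / (k.factorial : ℂ)) • ((Φ ^ k) ψ : H)

/-- `B` is given on `D` by the exponential series of `iΦ`. -/
def IsExp (Φ : Module.End ℂ D) (B : H →L[ℂ] H) : Prop :=
  ∀ ψ : D, HasSum (expTerm Φ 1 ψ) (B (ψ : H))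

theorem norm_expTerm (Φ : Module.End ℂ D) (t : ℝ) (ψ : D) (k : ℕ) :
    ‖expTerm Φ t ψ k‖ = |t| ^ k / (k.factorial : ℝ) * ‖((Φ ^ k) ψ : H)‖ := by
  simp [expTerm, norm_smul]

theorem expTerm_smul (Φ : Module.End ℂ D) (s t : ℝ) (ψ : D) :
    expTerm ((s : ℂ) • Φ) t ψ = expTerm Φ (s * t) ψ := by
  funext k
  simp only [expTerm, smul_pow, LinearMap.smul_apply, Submodule.coe_smul, smul_smul]
  congr 1
  push_cast
  ring

namespace IsEntireSymmetric

variable {Φ : Module.End ℂ D}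

theorem symm_pow (h : IsEntireSymmetric Φ) (k : ℕ) (ψ χ : D) :
    ⟪((Φ ^ k) ψ : H), (χ : H)⟫_ℂ = ⟪(ψ : H), ((Φ ^ k) χ : H)⟫_ℂ := by
  induction k generalizing ψ χ with
  | zero => simp
  | succ k ih =>
    have e1 : (Φ ^ (k + 1)) ψ = (Φ ^ k) (Φ ψ) := by rw [pow_succ]; rfl
    have e2 : (Φ ^ (k + 1)) χ = Φ ((Φ ^ k) χ) := by rw [pow_succ']; rfl
    rw [e1, ih, h.symm, e2]

theorem summable_norm (h : IsEntireSymmetric Φ) (t : ℝ) (ψ : D) :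
    Summable fun k => ‖expTerm Φ t ψ k‖ := by
  simpa only [norm_expTerm] using h.summable t ψ

/-- By symmetry all terms of total degree n are multiples of the same number ⟨ψ, Φⁿχ⟩. The
coefficients add up to (i(t-s))ⁿ/n! by the binomial theorem; the sign of s comes from the antilinear
slot. -/
theorem sum_antidiagonal (h : IsEntireSymmetric Φ) (s t : ℝ) (ψ χ : D) (n : ℕ) :
    ∑ kl ∈ Finset.HasAntidiagonal.antidiagonal n, ⟪expTerm Φ s ψ kl.1, expTerm Φ t χ kl.2⟫_ℂ
      = ⟪(ψ : H), expTerm Φ (t - s) χ n⟫_ℂ := by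
  have e : ∀ kl ∈ Finset.HasAntidiagonal.antidiagonal n, ⟪expTerm Φ s ψ kl.1, expTerm Φ t χ kl.2⟫_ℂ
      = (((n.choose kl.1 : ℂ) * ((-(I * s)) ^ kl.1 * (I * t) ^ kl.2)) / (n.factorial : ℂ))
        * ⟪(ψ : H), ((Φ ^ n) χ : H)⟫_ℂ := by
    rintro ⟨k, l⟩ hkl
    rw [Finset.HasAntidiagonal.mem_antidiagonal] at hkl
    subst hkl
    have e2 : (Φ ^ (k + l)) χ = (Φ ^ k) ((Φ ^ l) χ) := by rw [pow_add]; rfl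
    simp only [expTerm, inner_smul_left, inner_smul_right, h.symm_pow, e2]
    have h1 : ((k + l).factorial : ℂ) ≠ 0 := by exact_mod_cast (k + l).factorial_ne_zero
    have h2 : (k.factorial : ℂ) ≠ 0 := by exact_mod_cast k.factorial_ne_zero
    have h3 : (l.factorial : ℂ) ≠ 0 := by exact_mod_cast l.factorial_ne_zero
    have h4 : ((k + l).choose k : ℂ) * k.factorial * l.factorial = (k + l).factorial := by
      have := Nat.choose_mul_factorial_mul_factorial (Nat.le_add_right k l)
      rw [Nat.add_sub_cancel_left] at this
      exact_mod_cast this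
    simp only [map_div₀, map_pow, map_mul, conj_I, conj_ofReal, map_natCast]
    rw [← h4]
    have h5 : ((k + l).choose k : ℂ) ≠ 0 := by
      exact_mod_cast (Nat.choose_pos (Nat.le_add_right k l)).ne'
    field_simp
  rw [Finset.sum_congr rfl e, ← Finset.sum_mul, ← Finset.sum_div]
  rw [expTerm, inner_smul_right]
  congr 2
  have := (Commute.all (-(I * (s : ℂ))) (I * t)).add_pow' n
  simp only [nsmul_eq_mul] at this
  rw [← this]
  push_cast
  ring

variable [CompleteSpace H]

theorem summable_expTerm (h : IsEntireSymmetric Φ) (t : ℝ) (ψ : D) :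
    Summable (expTerm Φ t ψ) := (h.summable_norm t ψ).of_norm

/-- The exponential series of `itΦ`. -/
def expSum (h : IsEntireSymmetric Φ) (t : ℝ) : D →ₗ[ℂ] H where
  toFun ψ := ∑' k, expTerm Φ t ψ k
  map_add' ψ χ := by
    rw [← (h.summable_expTerm t ψ).tsum_add (h.summable_expTerm t χ)]
    congr 1; funext k
    simp [expTerm]
  map_smul' c ψ := by
    rw [RingHom.id_apply, ← (h.summable_expTerm t ψ).tsum_const_smul]
    congr 1; funext k
    simp only [expTerm, map_smul, Submodule.coe_smul]
    rw [smul_comm]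

theorem hasSum_expSum (h : IsEntireSymmetric Φ) (t : ℝ) (ψ : D) :
    HasSum (expTerm Φ t ψ) (h.expSum t ψ) := (h.summable_expTerm t ψ).hasSum

/-- Cauchy product of two absolutely convergent series. This identity is the source of isometry (s =
t), of the adjoint V(t)* = V(-t), and of the group law. -/
theorem inner_expSum (h : IsEntireSymmetric Φ) (s t : ℝ) (ψ χ : D) :
    ⟪h.expSum s ψ, h.expSum t χ⟫_ℂ = ⟪(ψ : H), h.expSum (t - s) χ⟫_ℂ := by
  have hs := h.hasSum_expSum s ψ
  have ht := h.hasSum_expSum t χ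
  have hsum : Summable fun p : ℕ × ℕ => ⟪expTerm Φ s ψ p.1, expTerm Φ t χ p.2⟫_ℂ := by
    refine Summable.of_norm_bounded ((h.summable_norm s ψ).mul_of_nonneg (h.summable_norm t χ)
      (fun _ => norm_nonneg _) (fun _ => norm_nonneg _)) fun p => norm_inner_le_norm _ _
  have h1 : ∀ k, HasSum (fun l => ⟪expTerm Φ s ψ k, expTerm Φ t χ l⟫_ℂ)
      ⟪expTerm Φ s ψ k, h.expSum t χ⟫_ℂ := fun k => ht.mapL (innerSL ℂ (expTerm Φ s ψ k))
  have h2 : HasSum (fun k => ⟪expTerm Φ s ψ k, h.expSum t χ⟫_ℂ)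
      ⟪h.expSum s ψ, h.expSum t χ⟫_ℂ := by
    have := (hs.mapL (innerSL ℂ (h.expSum t χ))).star
    simpa [innerSL_apply_apply] using this
  have h3 := hsum.hasSum.prod_fiberwise h1
  have h4 : HasSum (fun n => ⟪(ψ : H), expTerm Φ (t - s) χ n⟫_ℂ)
      ⟪(ψ : H), h.expSum (t - s) χ⟫_ℂ :=
    (h.hasSum_expSum (t - s) χ).mapL (innerSL ℂ (ψ : H))
  rw [h2.unique h3, ← h4.tsum_eq, ← Finset.HasAntidiagonal.sigmaAntidiagonalEquivProd.tsum_eq]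
  have hs' := (Finset.HasAntidiagonal.sigmaAntidiagonalEquivProd.summable_iff).2 hsum
  refine (hs'.tsum_sigma' (fun n => (hasSum_fintype _).summable)).trans ?_
  refine tsum_congr fun n => ?_
  rw [← h.sum_antidiagonal s t, tsum_fintype]
  exact Finset.sum_coe_sort (Finset.HasAntidiagonal.antidiagonal n)
    fun kl => ⟪expTerm Φ s ψ kl.1, expTerm Φ t χ kl.2⟫_ℂ

end IsEntireSymmetric

end EntireSymmetric

/-! ### The unitary group generated by the closure, and its uniqueness -/

section UnitaryGroup

variable {H : Type*} [NormedAddCommGroup H] [InnerProductSpace ℂ H]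
  {D : Submodule ℂ H} {Φ : Module.End ℂ D}

/-- The graph of `Φ` in `H × H`. -/
def endGraph (Φ : Module.End ℂ D) : Submodule ℂ (H × H) :=
  LinearMap.range (D.subtype.prod (D.subtype ∘ₗ Φ))

theorem mem_endGraph (Φ : Module.End ℂ D) (p : H × H) :
    p ∈ endGraph Φ ↔ ∃ ψ : D, p = ((ψ : H), (Φ ψ : H)) := by
  simp only [endGraph, LinearMap.mem_range]
  exact ⟨fun ⟨ψ, hψ⟩ => ⟨ψ, hψ.symm⟩, fun ⟨ψ, hψ⟩ => ⟨ψ, hψ.symm⟩⟩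

variable [CompleteSpace H]

namespace IsEntireSymmetric

theorem expSum_zero (h : IsEntireSymmetric Φ) (ψ : D) : h.expSum 0 ψ = ψ := by
  refine (h.hasSum_expSum 0 ψ).unique ?_
  convert hasSum_single 0 ?_ using 1
  · simp [expTerm]
  · intro k hk
    simp [expTerm, hk]

theorem norm_expSum (h : IsEntireSymmetric Φ) (t : ℝ) (ψ : D) : ‖h.expSum t ψ‖ = ‖ψ‖ := by
  have := h.inner_expSum t t ψ ψ
  rw [sub_self, h.expSum_zero, inner_self_eq_norm_sq_to_K, inner_self_eq_norm_sq_to_K] at this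
  have h2 : ‖h.expSum t ψ‖ ^ 2 = ‖(ψ : H)‖ ^ 2 := by exact_mod_cast this
  exact (pow_left_inj₀ (norm_nonneg _) (norm_nonneg _) two_ne_zero).1 h2

/-- The unitary group generated by the closure of `Φ`. -/
def unitaryGroup (h : IsEntireSymmetric Φ) (t : ℝ) : H →L[ℂ] H :=
  (LinearIsometry.mk (h.expSum t) (h.norm_expSum t)).toContinuousLinearMap.extend D.subtypeL

theorem unitaryGroup_apply (h : IsEntireSymmetric Φ) (hD : Dense (D : Set H)) (t : ℝ) (ψ : D) :
    h.unitaryGroup t ψ = h.expSum t ψ :=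
  ContinuousLinearMap.extend_eq _ hD.denseRange_val
    isUniformEmbedding_subtype_val.isUniformInducing ψ

theorem hasSum_unitaryGroup (h : IsEntireSymmetric Φ) (hD : Dense (D : Set H)) (t : ℝ) (ψ : D) :
    HasSum (expTerm Φ t ψ) (h.unitaryGroup t ψ) := by
  rw [h.unitaryGroup_apply hD]; exact h.hasSum_expSum t ψ

theorem inner_unitaryGroup (h : IsEntireSymmetric Φ) (hD : Dense (D : Set H)) (s t : ℝ)
    (ψ χ : H) :
    ⟪h.unitaryGroup s ψ, h.unitaryGroup t χ⟫_ℂ = ⟪ψ, h.unitaryGroup (t - s) χ⟫_ℂ := by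
  refine hD.denseRange_val.induction_on₂ (p := fun ψ χ : H =>
    ⟪h.unitaryGroup s ψ, h.unitaryGroup t χ⟫_ℂ = ⟪ψ, h.unitaryGroup (t - s) χ⟫_ℂ)
    (isClosed_eq (by fun_prop) (by fun_prop)) (fun ψ χ => ?_) ψ χ
  rw [h.unitaryGroup_apply hD, h.unitaryGroup_apply hD, h.unitaryGroup_apply hD, h.inner_expSum]

theorem unitaryGroup_zero (h : IsEntireSymmetric Φ) (hD : Dense (D : Set H)) :
    h.unitaryGroup 0 = 1 := by
  refine ContinuousLinearMap.ext fun ψ => ?_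
  refine hD.denseRange_val.induction_on (p := fun ψ : H => h.unitaryGroup 0 ψ = ψ) ψ
    (isClosed_eq (by fun_prop) (by fun_prop)) fun ψ => ?_
  rw [h.unitaryGroup_apply hD, h.expSum_zero]

theorem adjoint_unitaryGroup (h : IsEntireSymmetric Φ) (hD : Dense (D : Set H)) (t : ℝ) :
    ContinuousLinearMap.adjoint (h.unitaryGroup t) = h.unitaryGroup (-t) := by
  refine ContinuousLinearMap.ext fun ψ => ext_inner_left ℂ fun χ => ?_
  have := h.inner_unitaryGroup hD t 0 χ ψ
  rw [h.unitaryGroup_zero hD, zero_sub] at this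
  rw [ContinuousLinearMap.adjoint_inner_right, ← this]
  rfl

theorem unitaryGroup_add (h : IsEntireSymmetric Φ) (hD : Dense (D : Set H)) (s t : ℝ) :
    h.unitaryGroup (s + t) = h.unitaryGroup s * h.unitaryGroup t := by
  refine ContinuousLinearMap.ext fun ψ => ext_inner_left ℂ fun χ => ?_
  have := h.inner_unitaryGroup hD (-s) t χ ψ
  rw [sub_neg_eq_add, add_comm t s] at this
  rw [← this, ← ContinuousLinearMap.adjoint_inner_right, h.adjoint_unitaryGroup hD, neg_neg]
  rfl

theorem unitaryGroup_mem_unitary (h : IsEntireSymmetric Φ) (hD : Dense (D : Set H)) (t : ℝ) :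
    h.unitaryGroup t ∈ unitary (H →L[ℂ] H) := by
  rw [Unitary.mem_iff, ContinuousLinearMap.star_eq_adjoint, h.adjoint_unitaryGroup hD,
    ← h.unitaryGroup_add hD, ← h.unitaryGroup_add hD, neg_add_cancel, add_neg_cancel,
    h.unitaryGroup_zero hD]
  exact ⟨rfl, rfl⟩

theorem norm_unitaryGroup (h : IsEntireSymmetric Φ) (hD : Dense (D : Set H)) (t : ℝ) (ψ : H) :
    ‖h.unitaryGroup t ψ‖ = ‖ψ‖ := by
  have := h.inner_unitaryGroup hD t t ψ ψ
  rw [sub_self, h.unitaryGroup_zero hD, one_apply_eq_self, inner_self_eq_norm_sq_to_K,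
    inner_self_eq_norm_sq_to_K] at this
  have h2 : ‖h.unitaryGroup t ψ‖ ^ 2 = ‖ψ‖ ^ 2 := by exact_mod_cast this
  exact (pow_left_inj₀ (norm_nonneg _) (norm_nonneg _) two_ne_zero).1 h2

/-- Second-order Taylor remainder: for |t| ≤ 1 the tail from degree 2 on is at most t² times the
tail at t = 1. -/
theorem norm_expSum_sub_le (h : IsEntireSymmetric Φ) {t : ℝ} (ht : |t| ≤ 1) (ψ : D) :
    ‖h.expSum t ψ - ψ - (t : ℂ) • I • (Φ ψ : H)‖ ≤ (∑' k, ‖expTerm Φ 1 ψ k‖) * t ^ 2 := by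
  have h0 := (hasSum_nat_add_iff' 2).2 (h.hasSum_expSum t ψ)
  have e : h.expSum t ψ - ∑ i ∈ Finset.range 2, expTerm Φ t ψ i
      = h.expSum t ψ - ψ - (t : ℂ) • I • (Φ ψ : H) := by
    simp only [Finset.sum_range_succ, Finset.sum_range_zero, expTerm]
    simp only [zero_add, pow_zero, pow_one, Nat.factorial_zero, Nat.factorial_one, Nat.cast_one,
      div_one, one_smul, Module.End.one_apply, smul_smul]
    rw [mul_comm I, sub_sub]
  rw [e] at h0
  have hs := (summable_nat_add_iff 2).2 (h.summable_norm 1 ψ)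
  have hle : ∀ k, ‖expTerm Φ t ψ (k + 2)‖ ≤ ‖expTerm Φ 1 ψ (k + 2)‖ * t ^ 2 := by
    intro k
    rw [norm_expTerm, norm_expTerm, abs_one, one_pow, pow_add, sq_abs]
    have : |t| ^ k ≤ 1 := pow_le_one₀ (abs_nonneg t) ht
    calc |t| ^ k * t ^ 2 / ((k + 2).factorial : ℝ) * ‖((Φ ^ (k + 2)) ψ : H)‖
        = |t| ^ k * (1 / ((k + 2).factorial : ℝ) * ‖((Φ ^ (k + 2)) ψ : H)‖ * t ^ 2) := by ring
      _ ≤ 1 * (1 / ((k + 2).factorial : ℝ) * ‖((Φ ^ (k + 2)) ψ : H)‖ * t ^ 2) := by gcongr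
      _ = _ := by ring
  refine (h0.norm_le_of_bounded (hs.mul_right (t ^ 2)).hasSum hle).trans ?_
  rw [tsum_mul_right]
  refine mul_le_mul_of_nonneg_right ?_ (sq_nonneg t)
  have := (h.summable_norm 1 ψ).sum_add_tsum_nat_add 2
  rw [← this]
  have h3 : 0 ≤ ∑ i ∈ Finset.range 2, ‖expTerm Φ 1 ψ i‖ :=
    Finset.sum_nonneg fun _ _ => norm_nonneg _
  linarith

theorem hasDerivAt_expSum_zero (h : IsEntireSymmetric Φ) (ψ : D) :
    HasDerivAt (fun t => h.expSum t ψ) (I • (Φ ψ : H)) 0 := by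
  rw [hasDerivAt_iff_isLittleO]
  have hO : (fun t : ℝ => h.expSum t ψ - h.expSum 0 ψ - (t - 0) • I • (Φ ψ : H))
      =O[𝓝 0] fun t : ℝ => (t - 0) ^ 2 := by
    refine Asymptotics.IsBigO.of_bound (∑' k, ‖expTerm Φ 1 ψ k‖) ?_
    have : ∀ᶠ t : ℝ in 𝓝 0, |t| < 1 := by
      have := Metric.ball_mem_nhds (0 : ℝ) one_pos
      filter_upwards [this] with t ht
      simpa using ht
    filter_upwards [this] with t ht
    have := h.norm_expSum_sub_le ht.le ψ
    rw [h.expSum_zero, sub_zero]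
    simpa using this
  refine hO.trans_isLittleO ?_
  simpa using Asymptotics.isLittleO_pow_sub_sub (0 : ℝ) one_lt_two

theorem hasDerivAt_unitaryGroup (h : IsEntireSymmetric Φ) (hD : Dense (D : Set H)) (t : ℝ)
    (ψ : D) : HasDerivAt (fun t => h.unitaryGroup t ψ) (h.unitaryGroup t (I • (Φ ψ : H))) t := by
  have h0 : HasDerivAt (fun t => h.unitaryGroup t ψ) (I • (Φ ψ : H)) (t - t) := by
    rw [sub_self]
    simp only [h.unitaryGroup_apply hD]
    exact h.hasDerivAt_expSum_zero ψ
  have h1 := ((h.unitaryGroup t).restrictScalars ℝ).hasFDerivAt.comp_hasDerivAt t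
    (h0.comp_sub_const t t)
  refine h1.congr_of_eventuallyEq (Eventually.of_forall fun s => ?_)
  change h.unitaryGroup s ψ = (h.unitaryGroup t * h.unitaryGroup (s - t)) ψ
  rw [← h.unitaryGroup_add hD, add_sub_cancel]

theorem continuous_unitaryGroup (h : IsEntireSymmetric Φ) (hD : Dense (D : Set H)) (ψ : H) :
    Continuous fun t => h.unitaryGroup t ψ := by
  refine continuous_of_uniform_approx_of_continuous fun u hu => ?_
  obtain ⟨ε, hε, hu⟩ := Metric.mem_uniformity_dist.1 hu
  obtain ⟨χ, hχ, hd⟩ := Metric.dense_iff.1 hD ψ ε hε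
  refine ⟨fun t => h.unitaryGroup t χ, continuous_iff_continuousAt.2 fun t =>
    (h.hasDerivAt_unitaryGroup hD t ⟨χ, hd⟩).continuousAt, fun t => hu ?_⟩
  rw [dist_eq_norm, ← map_sub, h.norm_unitaryGroup hD, ← dist_eq_norm, dist_comm]
  exact hχ

/-- The averages `∫₀ʰ V(s) ψ ds`. -/
def average (h : IsEntireSymmetric Φ) (hD : Dense (D : Set H)) (u : ℝ) : H →L[ℂ] H :=
  LinearMap.mkContinuous
    { toFun := fun ψ => ∫ s in (0 : ℝ)..u, h.unitaryGroup s ψ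
      map_add' := fun ψ χ => by
        simp only [map_add]
        exact intervalIntegral.integral_add
          ((h.continuous_unitaryGroup hD ψ).intervalIntegrable _ _)
          ((h.continuous_unitaryGroup hD χ).intervalIntegrable _ _)
      map_smul' := fun c ψ => by
        simp only [map_smul, RingHom.id_apply]
        exact intervalIntegral.integral_smul _ _ } |u - 0| fun ψ => by
      refine (intervalIntegral.norm_integral_le_of_norm_le_const (C := ‖ψ‖) fun s _ => ?_).trans
        (le_of_eq (mul_comm _ _))
      rw [h.norm_unitaryGroup hD]

theorem average_apply (h : IsEntireSymmetric Φ) (hD : Dense (D : Set H)) (u : ℝ) (ψ : H) :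
    h.average hD u ψ = ∫ s in (0 : ℝ)..u, h.unitaryGroup s ψ := rfl

/-- The fundamental theorem of calculus for V(s)ψ. In this integrated form both sides are bounded in
(ψ, Φψ), so the relation survives passage to the closure of the graph. -/
theorem average_deriv (h : IsEntireSymmetric Φ) (hD : Dense (D : Set H)) (u : ℝ) (ψ : D) :
    h.average hD u (I • (Φ ψ : H)) = h.unitaryGroup u ψ - ψ := by
  rw [average_apply, intervalIntegral.integral_eq_sub_of_hasDerivAt
    (fun t _ => h.hasDerivAt_unitaryGroup hD t ψ)
    ((h.continuous_unitaryGroup hD _).intervalIntegrable _ _), h.unitaryGroup_zero hD]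
  rfl

theorem hasDerivAt_average (h : IsEntireSymmetric Φ) (hD : Dense (D : Set H)) (ψ : H) :
    HasDerivAt (fun u => h.average hD u ψ) ψ 0 := by
  have := ((h.continuous_unitaryGroup hD ψ).integral_hasStrictDerivAt 0 0).hasDerivAt
  rw [h.unitaryGroup_zero hD] at this
  exact this

/-- The partial sums of the exponential series of ψ lie in D, and Φ maps them to the partial sums
for Φψ. Thus V(t) maps D into the domain of the closure and commutes with it there. -/
theorem unitaryGroup_mem_closure (h : IsEntireSymmetric Φ) (hD : Dense (D : Set H)) (t : ℝ)
    (ψ : D) : (h.unitaryGroup t ψ, h.unitaryGroup t (Φ ψ))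
      ∈ (endGraph Φ).topologicalClosure := by
  have h1 := (h.hasSum_unitaryGroup hD t ψ).prodMk (h.hasSum_unitaryGroup hD t (Φ ψ))
  refine (Submodule.isClosed_topologicalClosure _).mem_of_tendsto h1
    (Eventually.of_forall fun s => Submodule.sum_mem _ fun k _ =>
      Submodule.le_topologicalClosure _ ?_)
  rw [mem_endGraph]
  refine ⟨((I * t) ^ k / (k.factorial : ℂ)) • (Φ ^ k) ψ, ?_⟩
  have e : Φ ((Φ ^ k) ψ) = (Φ ^ k) (Φ ψ) := by
    change (Φ * Φ ^ k) ψ = (Φ ^ k * Φ) ψ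
    rw [← pow_succ', pow_succ]
  simp only [expTerm, map_smul, Submodule.coe_smul, e]

theorem average_mem_closure (h : IsEntireSymmetric Φ) (hD : Dense (D : Set H)) (u : ℝ)
    (ψ : H) : (h.average hD u ψ, (-I) • (h.unitaryGroup u ψ - ψ))
      ∈ (endGraph Φ).topologicalClosure := by
  refine hD.denseRange_val.induction_on (p := fun ψ : H =>
    (h.average hD u ψ, (-I) • (h.unitaryGroup u ψ - ψ)) ∈ (endGraph Φ).topologicalClosure) ψ
    ((Submodule.isClosed_topologicalClosure _).preimage (by fun_prop)) fun ψ => ?_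
  rw [← h.average_deriv hD, map_smul, smul_smul, neg_mul, I_mul_I, neg_neg, one_smul]
  have : CompleteSpace (endGraph Φ).topologicalClosure :=
    (Submodule.isClosed_topologicalClosure _).completeSpace_coe
  -- The pair of averages is the integral of a continuous curve inside a closed subspace, so it
  -- belongs to that subspace.
  let F : ℝ → (endGraph Φ).topologicalClosure := fun s => ⟨_, h.unitaryGroup_mem_closure hD s ψ⟩
  have hF : Continuous F := Continuous.subtype_mk
    ((h.continuous_unitaryGroup hD _).prodMk (h.continuous_unitaryGroup hD _)) _
  have hi := hF.intervalIntegrable (μ := volume) 0 u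
  have e1 := (((ContinuousLinearMap.fst ℂ H H).comp
    (endGraph Φ).topologicalClosure.subtypeL)).intervalIntegral_comp_comm hi
  have e2 := (((ContinuousLinearMap.snd ℂ H H).comp
    (endGraph Φ).topologicalClosure.subtypeL)).intervalIntegral_comp_comm hi
  have : (h.average hD u (ψ : H), h.average hD u (Φ ψ : H))
      = ((∫ s in (0 : ℝ)..u, F s : (endGraph Φ).topologicalClosure) : H × H) :=
    Prod.ext e1 e2
  rw [this]
  exact Subtype.prop _

/-- The generator of V is exactly the closure of Φ, which amounts to essential self-adjointness. On
the closed graph the integrated relation holds and can be differentiated at 0. Conversely, averaging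
maps every vector into the domain of the closure, and u → 0 recovers a vector at which V is
differentiable. -/
theorem mem_closure_iff_hasDerivAt (h : IsEntireSymmetric Φ) (hD : Dense (D : Set H))
    (ψ η : H) : (ψ, η) ∈ (endGraph Φ).topologicalClosure ↔
      HasDerivAt (fun t => h.unitaryGroup t ψ) (I • η) 0 := by
  constructor
  · intro hmem
    have key : ∀ u, ∀ p ∈ (endGraph Φ).topologicalClosure,
        h.average hD u (I • p.2) = h.unitaryGroup u p.1 - p.1 := by
      intro u p hp
      refine closure_minimal (s := (endGraph Φ : Set (H × H)))
        (t := {p | h.average hD u (I • p.2) = h.unitaryGroup u p.1 - p.1}) ?_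
        (isClosed_eq (by fun_prop) (by fun_prop)) hp
      intro p hp
      obtain ⟨χ, rfl⟩ := (mem_endGraph Φ p).1 hp
      exact h.average_deriv hD u χ
    have h1 := (h.hasDerivAt_average hD (I • η)).add_const ψ
    refine h1.congr_of_eventuallyEq (Eventually.of_forall fun u => ?_)
    change _ = h.average hD u (I • η) + ψ
    rw [key u _ hmem]
    simp
  · intro hd
    -- The difference quotients at 0 of the pair (average, -iV(u)ψ) lie in the closed graph and
    -- converge to (ψ, η).
    have h1 := (h.hasDerivAt_average hD ψ).prodMk (hd.const_smul (-I))
    rw [hasDerivAt_iff_tendsto_slope, smul_smul, neg_mul, I_mul_I, neg_neg, one_smul] at h1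
    refine (Submodule.isClosed_topologicalClosure _).mem_of_tendsto h1
      (Eventually.of_forall fun u => ?_)
    rw [slope_def_module, ← coe_smul]
    refine Submodule.smul_mem _ _ ?_
    convert h.average_mem_closure hD u ψ using 1
    simp [average_apply, h.unitaryGroup_zero hD, sub_eq_add_neg]

theorem isExpI_unitaryGroup (h : IsEntireSymmetric Φ) (hD : Dense (D : Set H)) {T : H →ₗ.[ℂ] H}
    (hT : T.graph = (endGraph Φ).topologicalClosure) : IsExpI T (h.unitaryGroup 1) :=
  ⟨h.unitaryGroup, h.unitaryGroup_zero hD, h.unitaryGroup_add hD, h.unitaryGroup_mem_unitary hD,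
    h.continuous_unitaryGroup hD, fun ψ η => by rw [hT, h.mem_closure_iff_hasDerivAt hD], rfl⟩

end IsEntireSymmetric

/-- Both groups preserve the domain of the common generator, and isometry forces Re⟨ψ, iTψ⟩ = 0.
Hence ‖V(t)ψ - W(t)ψ‖² has derivative 0 and vanishes at t = 0. -/
theorem IsExpI.unique {T : H →ₗ.[ℂ] H} (hT : Dense (T.domain : Set H)) {B C : H →L[ℂ] H}
    (hB : IsExpI T B) (hC : IsExpI T C) : B = C := by
  obtain ⟨V, V0, Vadd, Vu, Vc, Vg, rfl⟩ := hB
  obtain ⟨W, W0, Wadd, Wu, Wc, Wg, rfl⟩ := hC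
  have deriv : ∀ {V : ℝ → H →L[ℂ] H}, (∀ s t, V (s + t) = V s * V t) →
      (∀ ψ η : H, (ψ, η) ∈ T.graph ↔ HasDerivAt (fun t => V t ψ) (I • η) 0) →
      ∀ ψ η, (ψ, η) ∈ T.graph → ∀ t, (V t ψ, V t η) ∈ T.graph ∧
        HasDerivAt (fun t => V t ψ) (I • V t η) t := by
    intro V Vadd Vg ψ η hg t
    have h0 : HasDerivAt (fun s => V s (V t ψ)) (I • V t η) 0 := by
      have := ((V t).restrictScalars ℝ).hasFDerivAt.comp_hasDerivAt 0 ((Vg ψ η).1 hg)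
      rw [ContinuousLinearMap.coe_restrictScalars', map_smul] at this
      refine this.congr_of_eventuallyEq (Eventually.of_forall fun s => ?_)
      change (V s * V t) ψ = (V t * V s) ψ
      rw [← Vadd, add_comm, Vadd]
    refine ⟨(Vg _ _).2 h0, ?_⟩
    have h1 : HasDerivAt (fun s => V s (V t ψ)) (I • V t η) (t - t) := by rwa [sub_self]
    refine (h1.comp_sub_const t t).congr_of_eventuallyEq (Eventually.of_forall fun s => ?_)
    change V s ψ = (V (s - t) * V t) ψ
    rw [← Vadd, sub_add_cancel]
  have iso : ∀ t ψ, ‖V t ψ‖ = ‖ψ‖ := fun t ψ => by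
    have := (Vu t)
    rw [Unitary.mem_iff] at this
    have h2 : ⟪V t ψ, V t ψ⟫_ℂ = ⟪ψ, ψ⟫_ℂ := by
      rw [← ContinuousLinearMap.adjoint_inner_right]
      change ⟪ψ, (star (V t) * V t) ψ⟫_ℂ = _
      rw [this.1]; rfl
    rw [inner_self_eq_norm_sq_to_K, inner_self_eq_norm_sq_to_K] at h2
    have h2 : ‖V t ψ‖ ^ 2 = ‖ψ‖ ^ 2 := by exact_mod_cast h2
    exact (pow_left_inj₀ (norm_nonneg _) (norm_nonneg _) two_ne_zero).1 h2
  have re_zero : ∀ ψ η, (ψ, η) ∈ T.graph → RCLike.re ⟪ψ, I • η⟫_ℂ = 0 := by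
    intro ψ η hg
    have h1 := (Vg ψ η).1 hg
    have h2 := h1.inner ℂ h1
    have h3 : HasDerivAt (fun t => ⟪V t ψ, V t ψ⟫_ℂ) 0 0 := by
      have : (fun t => ⟪V t ψ, V t ψ⟫_ℂ) = fun _ => ⟪ψ, ψ⟫_ℂ := by
        funext t
        rw [inner_self_eq_norm_sq_to_K, inner_self_eq_norm_sq_to_K, iso]
      rw [this]; exact hasDerivAt_const _ _
    have h4 := h2.unique h3
    rw [V0, one_apply_eq_self] at h4
    have h5 := congrArg RCLike.re h4
    rw [map_add, inner_re_symm (I • η), map_zero] at h5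
    linarith
  have hdom : ∀ ψ η, (ψ, η) ∈ T.graph → V 1 ψ = W 1 ψ := by
    intro ψ η hg
    have hd : ∀ t, HasDerivAt (fun t => ⟪V t ψ - W t ψ, V t ψ - W t ψ⟫_ℂ) 0 t := by
      intro t
      obtain ⟨g1, d1⟩ := deriv Vadd Vg ψ η hg t
      obtain ⟨g2, d2⟩ := deriv Wadd Wg ψ η hg t
      have d : HasDerivAt (fun t => V t ψ - W t ψ) (I • (V t η - W t η)) t := by
        rw [smul_sub]; exact d1.sub d2
      have h2 := d.inner ℂ d
      have h3 : RCLike.re ⟪V t ψ - W t ψ, I • (V t η - W t η)⟫_ℂ = 0 :=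
        re_zero _ _ (T.graph.sub_mem g1 g2)
      have h4 : ⟪V t ψ - W t ψ, I • (V t η - W t η)⟫_ℂ
          + ⟪I • (V t η - W t η), V t ψ - W t ψ⟫_ℂ = 0 := by
        rw [← inner_conj_symm (I • (V t η - W t η)), RCLike.add_conj, h3]
        simp
      rw [h4] at h2
      exact h2
    have hc := is_const_of_deriv_eq_zero (fun t => (hd t).differentiableAt)
      (fun t => (hd t).deriv) 1 0
    simp only [V0, W0, sub_self, inner_zero_left, inner_self_eq_zero] at hc
    exact sub_eq_zero.1 hc
  refine ContinuousLinearMap.ext fun ψ => ?_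
  refine hT.denseRange_val.induction_on (p := fun ψ : H => V 1 ψ = W 1 ψ) ψ
    (isClosed_eq (by fun_prop) (by fun_prop)) fun ψ => ?_
  exact hdom _ _ (T.mem_graph ψ)

/-- Exchanges the exponential of a self-adjoint closure for a power series on D, the only form in
which exponentials are used afterwards. -/
theorem IsEntireSymmetric.isExpI_iff (h : IsEntireSymmetric Φ) (hD : Dense (D : Set H))
    {T : H →ₗ.[ℂ] H} (hT : T.graph = (endGraph Φ).topologicalClosure) (B : H →L[ℂ] H) :
    IsExpI T B ↔ IsExp Φ B := by
  have hV := h.isExpI_unitaryGroup hD hT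
  have hdom : Dense (T.domain : Set H) := hD.mono fun ψ hψ => by
    refine LinearPMap.mem_domain_of_mem_graph (y := (Φ ⟨ψ, hψ⟩ : H)) ?_
    rw [hT]
    exact Submodule.le_topologicalClosure _ ((mem_endGraph _ _).2 ⟨⟨ψ, hψ⟩, rfl⟩)
  constructor
  · intro hB ψ
    rw [hB.unique hdom hV]
    exact h.hasSum_unitaryGroup hD 1 ψ
  · intro hB
    have : B = h.unitaryGroup 1 := by
      refine ContinuousLinearMap.ext fun ψ => ?_
      refine hD.denseRange_val.induction_on (p := fun ψ : H => B ψ = h.unitaryGroup 1 ψ) ψ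
        (isClosed_eq (by fun_prop) (by fun_prop)) fun ψ => ?_
      exact (hB ψ).unique (h.hasSum_unitaryGroup hD 1 ψ)
    rw [this]; exact hV

end UnitaryGroup

/-! ### Commutation in matrix elements versus affiliation -/

section Affiliation

variable {H : Type*} [NormedAddCommGroup H] [InnerProductSpace ℂ H]

/-- `B ⊕ B` on the Hilbert space `H ⊕ H`. -/
def doubling (B : H →L[ℂ] H) : WithLp 2 (H × H) →L[ℂ] WithLp 2 (H × H) :=
  (WithLp.prodContinuousLinearEquiv 2 ℂ H H).symm.toContinuousLinearMap ∘L
    (B.prodMap B) ∘L (WithLp.prodContinuousLinearEquiv 2 ℂ H H).toContinuousLinearMap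

variable {D : Submodule ℂ H}

theorem form_comm_pow {A : D →ₗ⋆[ℂ] D →ₗ[ℂ] ℂ} {Φ : Module.End ℂ D}
    (h : ∀ ψ χ, A (Φ ψ) χ = A ψ (Φ χ)) (k : ℕ) (ψ χ : D) :
    A ((Φ ^ k) ψ) χ = A ψ ((Φ ^ k) χ) := by
  induction k generalizing ψ χ with
  | zero => simp
  | succ k ih =>
    have e1 : (Φ ^ (k + 1)) ψ = (Φ ^ k) (Φ ψ) := by rw [pow_succ]; rfl
    have e2 : (Φ ^ (k + 1)) χ = Φ ((Φ ^ k) χ) := by rw [pow_succ']; rfl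
    rw [e1, ih, h, e2]

variable [CompleteSpace H]

theorem inner_doubling (B : H →L[ℂ] H) (v w : WithLp 2 (H × H)) :
    ⟪v, doubling B w⟫_ℂ = ⟪doubling (star B) v, w⟫_ℂ := by
  simp only [WithLp.prod_inner_apply]
  change ⟪v.fst, B w.fst⟫_ℂ + ⟪v.snd, B w.snd⟫_ℂ
    = ⟪star B v.fst, w.fst⟫_ℂ + ⟪star B v.snd, w.snd⟫_ℂ
  rw [ContinuousLinearMap.star_eq_adjoint, ContinuousLinearMap.adjoint_inner_left,
    ContinuousLinearMap.adjoint_inner_left]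

/-- A closed subspace of `H × H` invariant under `B ⊕ B` for all `B` in a self-adjoint set is
invariant under `C ⊕ C` for all `C` in the bicommutant of the set. -/
theorem invariant_of_mem_bicommutant (G : Submodule ℂ (H × H)) (hG : IsClosed (G : Set (H × H)))
    (E : Set (H →L[ℂ] H)) (hstar : ∀ B ∈ E, star B ∈ E)
    (hE : ∀ B ∈ E, ∀ p ∈ G, (B p.1, B p.2) ∈ G) {C : H →L[ℂ] H}
    (hC : C ∈ E.centralizer.centralizer) (p : H × H) (hp : p ∈ G) : (C p.1, C p.2) ∈ G := by
  -- The product H × H carries the sup norm; an orthogonal projection onto the subspace needs the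
  -- Hilbert norm of H ⊕ H.
  let e := WithLp.prodContinuousLinearEquiv 2 ℂ H H
  let G' : Submodule ℂ (WithLp 2 (H × H)) := G.comap (e : WithLp 2 (H × H) →ₗ[ℂ] H × H)
  have hG' : IsClosed (G' : Set (WithLp 2 (H × H))) := hG.preimage e.continuous
  have : CompleteSpace G' := hG'.completeSpace_coe
  have hinv : ∀ B ∈ E, ∀ v ∈ G', doubling B v ∈ G' := fun B hB v hv => hE B hB _ hv
  -- As E is closed under adjoints, the orthogonal complement is invariant too, so the projection P
  -- onto the subspace commutes with B ⊕ B.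
  have hcomm : ∀ B ∈ E, ∀ v,
      G'.starProjection (doubling B v) = doubling B (G'.starProjection v) := by
    intro B hB v
    refine Submodule.eq_starProjection_of_mem_orthogonal
      (hinv B hB _ (Submodule.starProjection_apply_mem _ _)) ?_
    rw [← map_sub, Submodule.mem_orthogonal]
    intro u hu
    rw [inner_doubling]
    exact Submodule.inner_right_of_mem_orthogonal (hinv _ (hstar B hB) u hu)
      (Submodule.sub_starProjection_mem_orthogonal v)
  let ι₁ : H →L[ℂ] WithLp 2 (H × H) := e.symm.toContinuousLinearMap ∘L ContinuousLinearMap.inl ℂ H H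
  let ι₂ : H →L[ℂ] WithLp 2 (H × H) := e.symm.toContinuousLinearMap ∘L ContinuousLinearMap.inr ℂ H H
  let π₁ : WithLp 2 (H × H) →L[ℂ] H := ContinuousLinearMap.fst ℂ H H ∘L e.toContinuousLinearMap
  let π₂ : WithLp 2 (H × H) →L[ℂ] H := ContinuousLinearMap.snd ℂ H H ∘L e.toContinuousLinearMap
  have hι₁ : ∀ (B : H →L[ℂ] H) x, doubling B (ι₁ x) = ι₁ (B x) := fun B x => by
    apply e.injective
    change (B x, B 0) = (B x, 0)
    rw [map_zero]
  have hι₂ : ∀ (B : H →L[ℂ] H) x, doubling B (ι₂ x) = ι₂ (B x) := fun B x => by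
    apply e.injective
    change (B 0, B x) = (0, B x)
    rw [map_zero]
  have hdec : ∀ v : WithLp 2 (H × H), v = ι₁ (π₁ v) + ι₂ (π₂ v) := fun v => by
    apply e.injective
    change ((π₁ v, π₂ v) : H × H) = (π₁ v, 0) + (0, π₂ v)
    simp
  -- Each of the four entries π P ι of P as a 2 × 2 operator matrix commutes with E, so it commutes
  -- with C.
  have hblock : ∀ (π : WithLp 2 (H × H) →L[ℂ] H) (ι : H →L[ℂ] WithLp 2 (H × H)),
      (∀ (B : H →L[ℂ] H) v, π (doubling B v) = B (π v)) →
      (∀ (B : H →L[ℂ] H) x, doubling B (ι x) = ι (B x)) → ∀ x,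
      π (G'.starProjection (ι (C x))) = C (π (G'.starProjection (ι x))) := by
    intro π ι hπ hι x
    have hmem : π ∘L G'.starProjection ∘L ι ∈ E.centralizer := by
      intro B hB
      refine ContinuousLinearMap.ext fun x => ?_
      change B (π (G'.starProjection (ι x))) = π (G'.starProjection (ι (B x)))
      rw [← hπ, ← hcomm B hB, hι]
    exact DFunLike.congr_fun (hC _ hmem) x
  have hfinal : ∀ v, G'.starProjection (doubling C v) = doubling C (G'.starProjection v) := by
    intro v
    rw [hdec v]
    simp only [map_add, hι₁, hι₂]
    apply e.injective
    refine Prod.ext ?_ ?_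
    · exact congrArg₂ (· + ·) (hblock π₁ ι₁ (fun _ _ => rfl) hι₁ _)
        (hblock π₁ ι₂ (fun _ _ => rfl) hι₂ _)
    · exact congrArg₂ (· + ·) (hblock π₂ ι₁ (fun _ _ => rfl) hι₁ _)
        (hblock π₂ ι₂ (fun _ _ => rfl) hι₂ _)
  have hv : e.symm p ∈ G' := by
    change e (e.symm p) ∈ G
    rwa [e.apply_symm_apply]
  have h1 := hfinal (e.symm p)
  rw [Submodule.starProjection_eq_self_iff.2 hv] at h1
  have h2 : doubling C (e.symm p) ∈ G' := by
    rw [← h1]; exact Submodule.starProjection_apply_mem _ _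
  exact h2

/-- The unitaries `exp(iΦ)`, for `Φ` in a family of endomorphisms of `D`. -/
def expSet (𝓕 : Set (Module.End ℂ D)) : Set (H →L[ℂ] H) := {B | ∃ Φ ∈ 𝓕, IsExp Φ B}

theorem isExp_unitaryGroup {Φ : Module.End ℂ D} (h : IsEntireSymmetric Φ)
    (hD : Dense (D : Set H)) (t : ℝ) : IsExp ((t : ℂ) • Φ) (h.unitaryGroup t) := by
  intro ψ
  rw [expTerm_smul, mul_one]
  exact h.hasSum_unitaryGroup hD t ψ

theorem IsExp.eq_unitaryGroup {Φ : Module.End ℂ D} (h : IsEntireSymmetric Φ)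
    (hD : Dense (D : Set H)) {B : H →L[ℂ] H} (hB : IsExp Φ B) : B = h.unitaryGroup 1 := by
  refine ContinuousLinearMap.ext fun ψ => ?_
  refine hD.denseRange_val.induction_on (p := fun ψ : H => B ψ = h.unitaryGroup 1 ψ) ψ
    (isClosed_eq (by fun_prop) (by fun_prop)) fun ψ => ?_
  exact (hB ψ).unique (h.hasSum_unitaryGroup hD 1 ψ)

theorem star_mem_expSet (hD : Dense (D : Set H)) {𝓕 : Set (Module.End ℂ D)}
    (h𝓕 : ∀ Φ ∈ 𝓕, IsEntireSymmetric Φ) (hs : ∀ Φ ∈ 𝓕, ∀ t : ℝ, (t : ℂ) • Φ ∈ 𝓕)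
    {B : H →L[ℂ] H} (hB : B ∈ expSet 𝓕) : star B ∈ expSet 𝓕 := by
  obtain ⟨Φ, hΦ, hB⟩ := hB
  refine ⟨_, hs Φ hΦ (-1), ?_⟩
  rw [hB.eq_unitaryGroup (h𝓕 Φ hΦ) hD, ContinuousLinearMap.star_eq_adjoint,
    (h𝓕 Φ hΦ).adjoint_unitaryGroup hD]
  exact isExp_unitaryGroup _ hD _

theorem inner_adjoint_of_graph {T : H →ₗ.[ℂ] H} (hT : Dense (T.domain : Set H))
    {ψ : H} (hψ : ψ ∈ T.adjoint.domain) {χ η : H} (hχ : (χ, η) ∈ T.graph) :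
    ⟪T.adjoint ⟨ψ, hψ⟩, χ⟫_ℂ = ⟪ψ, η⟫_ℂ := by
  obtain ⟨x, rfl, rfl⟩ := (LinearPMap.mem_graph_iff _).1 hχ
  exact LinearPMap.adjoint_isFormalAdjoint hT ⟨ψ, hψ⟩ x

/-- A closed operator affiliated with the commutant of the unitaries `exp(iΦ)` commutes with the
operators `Φ` in matrix elements. -/
theorem form_comm_of_isAffiliated (hD : Dense (D : Set H)) {𝓕 : Set (Module.End ℂ D)}
    (h𝓕 : ∀ Φ ∈ 𝓕, IsEntireSymmetric Φ) (hs : ∀ Φ ∈ 𝓕, ∀ t : ℝ, (t : ℂ) • Φ ∈ 𝓕)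
    {T : H →ₗ.[ℂ] H} {A : D →ₗ⋆[ℂ] D →ₗ[ℂ] ℂ} (hle : D ≤ T.domain)
    (hadj : D ≤ T.adjoint.domain)
    (hA : ∀ (ψ χ : D) (η : H), ((χ : H), η) ∈ T.graph → ⟪(ψ : H), η⟫_ℂ = A ψ χ)
    (hT : IsAffiliated T (expSet 𝓕).centralizer) {Φ : Module.End ℂ D} (hΦ : Φ ∈ 𝓕) (ψ χ : D) :
    A (Φ ψ) χ = A ψ (Φ χ) := by
  obtain ⟨-, hdense, haff⟩ := hT
  have h := h𝓕 Φ hΦ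
  have g : ∀ χ : D, ((χ : H), T ⟨χ, hle χ.2⟩) ∈ T.graph := fun χ => T.mem_graph ⟨χ, hle χ.2⟩
  set η := T ⟨χ, hle χ.2⟩
  set ψ' := T.adjoint ⟨ψ, hadj ψ.2⟩ with hψ'
  -- V(t) = exp(i(tΦ)) belongs to E, hence to E'', for every real t because 𝓕 is stable under
  -- scaling. So (V(t)χ, V(t)η) is in the graph of T.
  have e : (fun t => ⟪ψ', h.unitaryGroup t χ⟫_ℂ) = fun t => ⟪h.unitaryGroup (-t) ψ, η⟫_ℂ := by
    funext t
    have hg := haff (h.unitaryGroup t) (Set.subset_centralizer_centralizer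
      ⟨_, hs Φ hΦ t, isExp_unitaryGroup h hD t⟩) _ _ (g χ)
    rw [hψ', inner_adjoint_of_graph hdense _ hg, ← h.adjoint_unitaryGroup hD,
      ContinuousLinearMap.adjoint_inner_left]
  have d1 := (hasDerivAt_const (0 : ℝ) ψ').inner ℂ (h.hasDerivAt_unitaryGroup hD 0 χ)
  have d2 : HasDerivAt (fun t => h.unitaryGroup (-t) ψ) (-(I • (Φ ψ : H))) 0 := by
    have h3 : HasDerivAt (fun t => h.unitaryGroup t ψ) (I • (Φ ψ : H)) (-0) := by
      have := h.hasDerivAt_unitaryGroup hD 0 ψ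
      rwa [h.unitaryGroup_zero hD, one_apply_eq_self, ← neg_zero] at this
    have h4 := h3.scomp (0 : ℝ) (hasDerivAt_neg (0 : ℝ))
    rw [neg_one_smul] at h4
    exact h4
  have d3 := d2.inner ℂ (hasDerivAt_const (0 : ℝ) η)
  rw [h.unitaryGroup_zero hD] at d1
  rw [e] at d1
  have e2 := d1.unique d3
  simp only [one_apply_eq_self, inner_zero_left, inner_zero_right, add_zero, zero_add,
    inner_neg_left, inner_smul_left, inner_smul_right, conj_I, neg_mul, neg_neg] at e2
  rw [hψ', inner_adjoint_of_graph hdense _ (g (Φ χ)), hA _ _ _ (g (Φ χ)), hA _ _ _ (g χ)] at e2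
  exact (mul_left_cancel₀ I_ne_zero e2).symm

/-- A closed operator that commutes with the operators `Φ` in matrix elements is affiliated with
the commutant of the unitaries `exp(iΦ)`, if these map the common core into its domain. -/
theorem isAffiliated_of_form_comm (hD : Dense (D : Set H)) {𝓕 : Set (Module.End ℂ D)}
    (h𝓕 : ∀ Φ ∈ 𝓕, IsEntireSymmetric Φ) (hs : ∀ Φ ∈ 𝓕, ∀ t : ℝ, (t : ℂ) • Φ ∈ 𝓕)
    {T : H →ₗ.[ℂ] H} {A : D →ₗ⋆[ℂ] D →ₗ[ℂ] ℂ} (hc : T.IsClosed) (hcore : T.HasCore D)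
    (hadj : D ≤ T.adjoint.domain)
    (hA : ∀ (ψ χ : D) (η : H), ((χ : H), η) ∈ T.graph → ⟪(ψ : H), η⟫_ℂ = A ψ χ)
    (hdom : ∀ B ∈ expSet 𝓕, ∀ χ : D, B χ ∈ T.domain)
    (hcomm : ∀ Φ ∈ 𝓕, ∀ ψ χ, A (Φ ψ) χ = A ψ (Φ χ)) :
    IsAffiliated T (expSet 𝓕).centralizer := by
  have hdense : Dense (T.domain : Set H) := hD.mono hcore.le_domain
  refine ⟨hc, hdense, fun C hC ψ η hg => ?_⟩
  refine invariant_of_mem_bicommutant T.graph hc (expSet 𝓕)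
    (fun B hB => star_mem_expSet hD h𝓕 hs hB) ?_ hC (ψ, η) hg
  -- The core property: it is enough to check invariance of the graph over vectors of D.
  have hgraph : T.graph = (T.domRestrict D).graph.topologicalClosure := by
    have : (T.domRestrict D).IsClosable :=
      hc.isClosable.leIsClosable LinearPMap.domRestrict_le
    rw [this.graph_closure_eq_closure_graph, hcore.closure_eq]
  have g : ∀ χ : D, ((χ : H), T ⟨χ, hcore.le_domain χ.2⟩) ∈ T.graph :=
    fun χ => T.mem_graph ⟨χ, hcore.le_domain χ.2⟩
  intro B hB p hp
  rw [hgraph] at hp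
  refine closure_minimal (s := ((T.domRestrict D).graph : Set (H × H)))
    (t := {p | (B p.1, B p.2) ∈ T.graph}) ?_
    (hc.preimage (f := fun p : H × H => (B p.1, B p.2)) (by fun_prop)) hp
  rintro ⟨x, y⟩ hxy
  have hx : x ∈ D := (LinearPMap.mem_domain_of_mem_graph hxy).1
  have hxy' : (x, y) ∈ T.graph := LinearPMap.le_graph_of_le LinearPMap.domRestrict_le hxy
  change (B x, B y) ∈ T.graph
  set χ : D := ⟨x, hx⟩
  obtain ⟨ζ, hζ⟩ : ∃ ζ, (B χ, ζ) ∈ T.graph := ⟨_, T.mem_graph ⟨B χ, hdom B hB χ⟩⟩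
  obtain ⟨Φ, hΦ, hB⟩ := hB
  have h := h𝓕 Φ hΦ
  obtain rfl := hB.eq_unitaryGroup h hD
  suffices ζ = h.unitaryGroup 1 y by rw [← this]; exact hζ
  refine hD.eq_of_inner_right ℂ fun ψ hψ => ?_
  set ψ : D := ⟨ψ, hψ⟩
  change ⟪(ψ : H), ζ⟫_ℂ = ⟪(ψ : H), h.unitaryGroup 1 y⟫_ℂ
  -- The vector y = Tχ need not lie in D, so the series for B cannot be applied to it. B is moved to
  -- ψ instead, where its adjoint exp(-iΦ) has a series.
  rw [← inner_adjoint_of_graph hdense (hadj ψ.2) hζ]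
  have s1 := (h.hasSum_unitaryGroup hD 1 χ).mapL (innerSL ℂ (T.adjoint ⟨ψ, hadj ψ.2⟩))
  have s2 := ((h.hasSum_unitaryGroup hD (-1) ψ).mapL (innerSL ℂ y)).star
  refine s1.unique ?_
  have e : ⟪(ψ : H), h.unitaryGroup 1 y⟫_ℂ = star ⟪y, h.unitaryGroup (-1) ψ⟫_ℂ := by
    rw [← h.adjoint_unitaryGroup hD, ContinuousLinearMap.adjoint_inner_right]
    exact (inner_conj_symm _ _).symm
  rw [e]
  convert s2 using 1
  swap
  · rfl
  funext k
  -- Both sides are values of the form A, and locality moves Φᵏ across; the two series agree term by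
  -- term.
  have e2 : ⟪T.adjoint ⟨ψ, hadj ψ.2⟩, ((Φ ^ k) χ : H)⟫_ℂ = ⟪((Φ ^ k) ψ : H), y⟫_ℂ := by
    rw [inner_adjoint_of_graph hdense _ (g _), hA _ _ _ (g _), hA _ χ _ hxy',
      form_comm_pow (hcomm Φ hΦ)]
  have e3 : star ⟪y, expTerm Φ (-1) ψ k⟫_ℂ = ⟪expTerm Φ (-1) ψ k, y⟫_ℂ := inner_conj_symm _ _
  change ⟪T.adjoint ⟨ψ, hadj ψ.2⟩, expTerm Φ 1 χ k⟫_ℂ = star ⟪y, expTerm Φ (-1) ψ k⟫_ℂ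
  rw [e3, expTerm, expTerm, inner_smul_left, inner_smul_right, e2]
  congr 1
  simp

end Affiliation

instance innerParticleSpace (S : ScatteringFunction) (n : ℕ) : Inner ℂ (particleSpace S n) :=
  InnerProductSpace.toInner

/-! ### Multiplication operators on L²(ℝⁿ) -/

section Multipliers

/-- A measurable function on `ℝⁿ` of modulus at most one. -/
structure Multiplier (n : ℕ) where
  toFun : (Fin n → ℝ) → ℂ
  measurable : Measurable toFun
  norm_le : ∀ θ, ‖toFun θ‖ ≤ 1

theorem Multiplier.memLp {n : ℕ} (F : Multiplier n) (ψ : L2 n) :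
    MemLp (fun θ => F.toFun θ * ψ θ) 2 volume := by
  refine (Lp.memLp ψ).of_le (F.measurable.aestronglyMeasurable.mul (Lp.aestronglyMeasurable ψ)) ?_
  filter_upwards with θ
  rw [norm_mul]
  exact mul_le_of_le_one_left (norm_nonneg _) (F.norm_le θ)

/-- The multiplication operator with `F` on `L²(ℝⁿ)`. -/
def mulOp {n : ℕ} (F : Multiplier n) : L2 n →L[ℂ] L2 n :=
  LinearMap.mkContinuous
    { toFun := fun ψ => (F.memLp ψ).toLp _
      map_add' := fun ψ χ => by
        rw [← MemLp.toLp_add]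
        refine MemLp.toLp_congr _ _ ?_
        filter_upwards [Lp.coeFn_add ψ χ] with θ h
        rw [h, Pi.add_apply, mul_add, Pi.add_apply]
      map_smul' := fun c ψ => by
        rw [RingHom.id_apply, ← MemLp.toLp_const_smul]
        refine MemLp.toLp_congr _ _ ?_
        filter_upwards [Lp.coeFn_smul c ψ] with θ h
        rw [h, Pi.smul_apply, Pi.smul_apply, smul_eq_mul, smul_eq_mul]
        ring } 1 fun ψ => by
      rw [one_mul]
      refine Lp.norm_le_norm_of_ae_le ?_
      filter_upwards [(F.memLp ψ).coeFn_toLp] with θ h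
      change ‖((F.memLp ψ).toLp _ : L2 n) θ‖ ≤ _
      rw [h, norm_mul]
      exact mul_le_of_le_one_left (norm_nonneg _) (F.norm_le θ)

theorem coeFn_mulOp {n : ℕ} (F : Multiplier n) (ψ : L2 n) :
    mulOp F ψ =ᵐ[volume] fun θ => F.toFun θ * ψ θ := (F.memLp ψ).coeFn_toLp

/-- The complex conjugate multiplier. -/
def Multiplier.conj {n : ℕ} (F : Multiplier n) : Multiplier n where
  toFun θ := (starRingEnd ℂ) (F.toFun θ)
  measurable := continuous_conj.measurable.comp F.measurable
  norm_le θ := by rw [RCLike.norm_conj]; exact F.norm_le θ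

theorem adjoint_mulOp {n : ℕ} (F : Multiplier n) :
    ContinuousLinearMap.adjoint (mulOp F) = mulOp F.conj := by
  symm
  rw [ContinuousLinearMap.eq_adjoint_iff]
  intro ψ χ
  rw [L2.inner_def, L2.inner_def]
  refine integral_congr_ae ?_
  filter_upwards [coeFn_mulOp F χ, coeFn_mulOp F.conj ψ] with θ h1 h2
  rw [h1, h2]
  simp only [RCLike.inner_apply, Multiplier.conj, map_mul, conj_conj]
  ring

theorem mulOp_mem {S : ScatteringFunction} {n : ℕ} (F : Multiplier n)
    (hF : ∀ θ (e : Equiv.Perm (Fin n)), F.toFun (θ ∘ e) = F.toFun θ) {ψ : L2 n}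
    (hψ : ψ ∈ particleSpace S n) : mulOp F ψ ∈ particleSpace S n := by
  have : IsSSymmetric S (fun θ => F.toFun θ * ψ θ) := by
    intro i j hij
    filter_upwards [hψ i j hij] with θ h
    rw [h, hF]
    ring
  exact this.congr (coeFn_mulOp F ψ)

/-- Multiplication with a symmetric function commutes with the projection onto the `S`-symmetric
functions. -/
theorem starProjection_mulOp (S : ScatteringFunction) {n : ℕ} (F : Multiplier n)
    (hF : ∀ θ (e : Equiv.Perm (Fin n)), F.toFun (θ ∘ e) = F.toFun θ) (ψ : L2 n) :
    (particleSpace S n).starProjection (mulOp F ψ)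
      = mulOp F ((particleSpace S n).starProjection ψ) := by
  refine Submodule.eq_starProjection_of_mem_orthogonal
    (mulOp_mem F hF (Submodule.starProjection_apply_mem _ _)) ?_
  rw [← map_sub, Submodule.mem_orthogonal]
  intro u hu
  rw [← ContinuousLinearMap.adjoint_inner_left, adjoint_mulOp]
  refine Submodule.inner_right_of_mem_orthogonal (mulOp_mem F.conj (fun θ e => ?_) hu)
    (Submodule.sub_starProjection_mem_orthogonal ψ)
  simp only [Multiplier.conj, hF]

/-- The multiplier `F(θ₁,…,θₙ)` as a function of `θ₀,…,θₙ`. -/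
def Multiplier.tail {n : ℕ} (F : Multiplier n) : Multiplier (n + 1) where
  toFun θ := F.toFun (Fin.tail θ)
  measurable := F.measurable.comp (by unfold Fin.tail; fun_prop)
  norm_le θ := F.norm_le _

theorem quasiMeasurePreserving_head (n : ℕ) :
    Measure.QuasiMeasurePreserving (fun θ : Fin (n + 1) → ℝ => θ 0) volume volume :=
  Measure.quasiMeasurePreserving_fst.comp (measurePreserving_head_tail n).quasiMeasurePreserving

theorem coeFn_tensorLeft (g : Lp ℂ 2 (volume : Measure ℝ)) (n : ℕ) (ψ : L2 n) :
    tensorLeft g n ψ =ᵐ[volume] fun θ => g (θ 0) * ψ (Fin.tail θ) :=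
  (memLp_tensor n g ψ).coeFn_toLp

theorem norm_tensorLeft_le (g : Lp ℂ 2 (volume : Measure ℝ)) (n : ℕ) :
    ‖tensorLeft g n‖ ≤ ‖g‖ := LinearMap.mkContinuous_norm_le _ (norm_nonneg _) _

theorem mulOp_tail_tensorLeft {n : ℕ} (F : Multiplier n) (g : Lp ℂ 2 (volume : Measure ℝ))
    (ψ : L2 n) : mulOp F.tail (tensorLeft g n ψ) = tensorLeft g n (mulOp F ψ) := by
  refine Lp.ext ?_
  filter_upwards [coeFn_mulOp F.tail (tensorLeft g n ψ), coeFn_tensorLeft g n ψ,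
    coeFn_tensorLeft g n (mulOp F ψ),
    (quasiMeasurePreserving_tail n).ae (coeFn_mulOp F ψ)] with θ h1 h2 h3 h4
  rw [h1, h2, h3, h4]
  simp only [Multiplier.tail]
  ring

/-- The adjoint of `mulOp_tail_tensorLeft` for the conjugate multiplier: integrating out θ₀ commutes
with functions of the other variables. -/
theorem adjoint_tensorLeft_mulOp_tail {n : ℕ} (F : Multiplier n)
    (g : Lp ℂ 2 (volume : Measure ℝ)) (ψ : L2 (n + 1)) :
    ContinuousLinearMap.adjoint (tensorLeft g n) (mulOp F.tail ψ)
      = mulOp F (ContinuousLinearMap.adjoint (tensorLeft g n) ψ) := by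
  have e1 : F.conj.conj = F := by
    cases F; simp [Multiplier.conj]
  refine ext_inner_left ℂ fun χ => ?_
  rw [ContinuousLinearMap.adjoint_inner_right, ← e1, ← adjoint_mulOp F.conj,
    ContinuousLinearMap.adjoint_inner_right, ContinuousLinearMap.adjoint_inner_right]
  change ⟪tensorLeft g n χ, mulOp F.conj.tail.conj ψ⟫_ℂ = _
  rw [← adjoint_mulOp F.conj.tail, ContinuousLinearMap.adjoint_inner_right,
    mulOp_tail_tensorLeft]

theorem mulOp_mulOp {n : ℕ} {F G K : Multiplier n} (h : ∀ θ, K.toFun θ = F.toFun θ * G.toFun θ)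
    (ψ : L2 n) : mulOp F (mulOp G ψ) = mulOp K ψ := by
  refine Lp.ext ?_
  filter_upwards [coeFn_mulOp F (mulOp G ψ), coeFn_mulOp G ψ, coeFn_mulOp K ψ] with θ h1 h2 h3
  rw [h1, h2, h3, h, mul_assoc]

end Multipliers

/-! ### Formulas, norms and linearity of creation and annihilation operators -/

section CreationAnnihilation

variable (S : ScatteringFunction)

theorem coe_creationN (g : ℝ → ℂ) (n : ℕ) (ψ : particleSpace S n) :
    ((creationN S g n ψ : particleSpace S (n + 1)) : L2 (n + 1))
      = ((Real.sqrt (n + 1) : ℝ) : ℂ) •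
        (particleSpace S (n + 1)).starProjection (tensorLeft (toL2 g) n ψ) := rfl

/-- The adjoint of √(n+1) P (ḡ ⊗ ·) restricted to the symmetric functions. The projection is
harmless for weights and norms; `coe_annihilationN_of_fermi` removes it for S = -1, where an exact
formula is needed. -/
theorem coe_annihilationN (g : ℝ → ℂ) (n : ℕ) (ψ : particleSpace S (n + 1)) :
    ((annihilationN S g n ψ : particleSpace S n) : L2 n)
      = ((Real.sqrt (n + 1) : ℝ) : ℂ) • (particleSpace S n).starProjection
        (ContinuousLinearMap.adjoint (tensorLeft (toL2 fun θ => (starRingEnd ℂ) (g θ)) n) ψ) := by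
  have : annihilationN S g n ψ = ((Real.sqrt (n + 1) : ℝ) : ℂ) •
      (particleSpace S n).orthogonalProjectionOnto
        (ContinuousLinearMap.adjoint (tensorLeft (toL2 fun θ => (starRingEnd ℂ) (g θ)) n) ψ) := by
    refine ext_inner_left ℂ fun χ => ?_
    rw [annihilationN, ContinuousLinearMap.adjoint_inner_right]
    change ⟪((Real.sqrt (n + 1) : ℝ) : ℂ) • (particleSpace S (n + 1)).starProjection
        (tensorLeft (toL2 fun θ => (starRingEnd ℂ) (g θ)) n χ), (ψ : L2 (n + 1))⟫_ℂ
      = ⟪(χ : L2 n), ((Real.sqrt (n + 1) : ℝ) : ℂ) • (particleSpace S n).starProjection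
        (ContinuousLinearMap.adjoint (tensorLeft (toL2 fun θ => (starRingEnd ℂ) (g θ)) n) ψ)⟫_ℂ
    rw [inner_smul_left, inner_smul_right, conj_ofReal,
      Submodule.inner_starProjection_left_eq_right,
      Submodule.starProjection_eq_self_iff.2 ψ.2, ← Submodule.inner_starProjection_left_eq_right,
      Submodule.starProjection_eq_self_iff.2 χ.2, ContinuousLinearMap.adjoint_inner_right]
  rw [this]
  rfl

theorem norm_creationN_le (g : ℝ → ℂ) (n : ℕ) :
    ‖creationN S g n‖ ≤ Real.sqrt (n + 1) * ‖toL2 g‖ := by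
  refine ContinuousLinearMap.opNorm_le_bound _ (by positivity) fun ψ => ?_
  change ‖((creationN S g n ψ : particleSpace S (n + 1)) : L2 (n + 1))‖ ≤ _
  rw [coe_creationN, norm_smul, mul_assoc, norm_real, Real.norm_of_nonneg (Real.sqrt_nonneg _)]
  gcongr
  refine (Submodule.norm_starProjection_apply_le _ _).trans ?_
  exact ((tensorLeft (toL2 g) n).le_opNorm _).trans
    (mul_le_mul_of_nonneg_right (norm_tensorLeft_le _ _) (norm_nonneg _))

theorem norm_annihilationN_le (g : ℝ → ℂ) (n : ℕ) :
    ‖annihilationN S g n‖ ≤ Real.sqrt (n + 1) * ‖toL2 fun θ => (starRingEnd ℂ) (g θ)‖ := by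
  rw [annihilationN, LinearIsometryEquiv.norm_map]
  exact norm_creationN_le S _ n

theorem coeFn_toL2 {g : ℝ → ℂ} (hg : MemLp g 2 volume) : toL2 g =ᵐ[volume] g := by
  rw [toL2, dif_pos hg]; exact hg.coeFn_toLp

theorem toL2_add {g h : ℝ → ℂ} (hg : MemLp g 2 volume) (hh : MemLp h 2 volume) :
    toL2 (g + h) = toL2 g + toL2 h := by
  rw [toL2, toL2, toL2, dif_pos hg, dif_pos hh, dif_pos (hg.add hh)]; rfl

theorem toL2_smul {g : ℝ → ℂ} (hg : MemLp g 2 volume) (c : ℂ) :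
    toL2 (c • g) = c • toL2 g := by
  rw [toL2, toL2, dif_pos hg, dif_pos (hg.const_smul c)]; rfl

theorem tensorLeft_add (g h : Lp ℂ 2 (volume : Measure ℝ)) (n : ℕ) :
    tensorLeft (g + h) n = tensorLeft g n + tensorLeft h n := by
  refine ContinuousLinearMap.ext fun ψ => Lp.ext ?_
  rw [add_apply]
  filter_upwards [coeFn_tensorLeft (g + h) n ψ, coeFn_tensorLeft g n ψ, coeFn_tensorLeft h n ψ,
    Lp.coeFn_add (tensorLeft g n ψ) (tensorLeft h n ψ),
    (quasiMeasurePreserving_head n).ae (Lp.coeFn_add g h)] with θ h1 h2 h3 h4 h5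
  rw [h1, h4, Pi.add_apply, h2, h3, h5, Pi.add_apply, add_mul]

theorem tensorLeft_smul (c : ℂ) (g : Lp ℂ 2 (volume : Measure ℝ)) (n : ℕ) :
    tensorLeft (c • g) n = c • tensorLeft g n := by
  refine ContinuousLinearMap.ext fun ψ => Lp.ext ?_
  rw [smul_apply]
  filter_upwards [coeFn_tensorLeft (c • g) n ψ, coeFn_tensorLeft g n ψ,
    Lp.coeFn_smul c (tensorLeft g n ψ),
    (quasiMeasurePreserving_head n).ae (Lp.coeFn_smul c g)] with θ h1 h2 h4 h5
  rw [h1, h4, Pi.smul_apply, h2, h5, Pi.smul_apply, smul_mul_assoc]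

theorem creationN_add {g h : ℝ → ℂ} (hg : MemLp g 2 volume) (hh : MemLp h 2 volume) (n : ℕ) :
    creationN S (g + h) n = creationN S g n + creationN S h n := by
  rw [creationN, creationN, creationN, toL2_add hg hh, tensorLeft_add, ContinuousLinearMap.add_comp,
    ContinuousLinearMap.comp_add, smul_add]

theorem creationN_smul {g : ℝ → ℂ} (hg : MemLp g 2 volume) (c : ℂ) (n : ℕ) :
    creationN S (c • g) n = c • creationN S g n := by
  rw [creationN, creationN, toL2_smul hg, tensorLeft_smul, ContinuousLinearMap.smul_comp,
    ContinuousLinearMap.comp_smul, smul_comm]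

theorem annihilationN_add {g h : ℝ → ℂ} (hg : MemLp g 2 volume) (hh : MemLp h 2 volume) (n : ℕ) :
    annihilationN S (g + h) n = annihilationN S g n + annihilationN S h n := by
  have e : (fun θ => (starRingEnd ℂ) ((g + h) θ))
      = (fun θ => (starRingEnd ℂ) (g θ)) + fun θ => (starRingEnd ℂ) (h θ) := by
    funext θ; simp
  have hg' : MemLp (fun θ => (starRingEnd ℂ) (g θ)) 2 volume := hg.star
  have hh' : MemLp (fun θ => (starRingEnd ℂ) (h θ)) 2 volume := hh.star
  rw [annihilationN, e, creationN_add S hg' hh', map_add]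
  rfl

theorem annihilationN_smul {g : ℝ → ℂ} (hg : MemLp g 2 volume) (c : ℂ) (n : ℕ) :
    annihilationN S (c • g) n = c • annihilationN S g n := by
  have e : (fun θ => (starRingEnd ℂ) ((c • g) θ))
      = (starRingEnd ℂ) c • fun θ => (starRingEnd ℂ) (g θ) := by
    funext θ; simp
  have hg' : MemLp (fun θ => (starRingEnd ℂ) (g θ)) 2 volume := hg.star
  rw [annihilationN, e, creationN_smul S hg', LinearIsometryEquiv.map_smulₛₗ, conj_conj]
  rfl

end CreationAnnihilation

/-! ### Particle number bounds and symmetry of the field -/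

section Bounds

variable {S : ScatteringFunction}

theorem AtMost.mono {ψ : FockSpace S} {M N : ℕ} (h : AtMost M ψ) (hMN : M ≤ N) : AtMost N ψ :=
  fun n hn => h n (lt_of_le_of_lt hMN hn)

/-- The `ℓ¹`-norm of the first components of a vector. -/
def sumNorm (N : ℕ) (ψ : FockSpace S) : ℝ := ∑ n ∈ Finset.range (N + 1), ‖ψ n‖

theorem sumNorm_nonneg (N : ℕ) (ψ : FockSpace S) : 0 ≤ sumNorm N ψ :=
  Finset.sum_nonneg fun _ _ => norm_nonneg _

theorem AtMost.eq_sum {ψ : FockSpace S} {N : ℕ} (h : AtMost N ψ) :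
    ψ = ∑ n ∈ Finset.range (N + 1), lp.single 2 n (ψ n) := by
  have h1 := lp.hasSum_single (p := 2) (by norm_num) ψ
  refine h1.unique (hasSum_sum_of_ne_finset_zero fun n hn => ?_)
  rw [h n (by simpa using hn)]
  exact map_zero (lp.singleAddMonoidHom (E := fun n => particleSpace S n) 2 n)

theorem AtMost.norm_le {ψ : FockSpace S} {N : ℕ} (h : AtMost N ψ) : ‖ψ‖ ≤ sumNorm N ψ := by
  conv_lhs => rw [h.eq_sum]
  refine (norm_sum_le _ _).trans (Finset.sum_le_sum fun n _ => ?_)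
  rw [lp.norm_single (by norm_num)]

theorem AtMost.fieldComponent {ψ : FockSpace S} {N : ℕ} (hN : AtMost N ψ) (g h : ℝ → ℂ) (n : ℕ)
    (hn : N + 1 < n) : fieldComponent S g h ψ n = 0 := by
  obtain _ | n := n
  · omega
  · change creationN S g n (ψ n) + annihilationN S h (n + 1) (ψ (n + 2)) = 0
    rw [hN n (by omega), hN (n + 2) (by omega), map_zero, map_zero, add_zero]

/-- On at most N particles each of z†(g), z(h) costs a factor √(N+1). The ℓ¹-sum of component norms
is used because the creation and annihilation contributions to one component then simply add up; the
bound can be iterated. -/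
theorem sum_norm_fieldComponent_le {ψ : FockSpace S} {N : ℕ} (hN : AtMost N ψ) (g h : ℝ → ℂ) :
    ∑ n ∈ Finset.range (N + 2), ‖fieldComponent S g h ψ n‖
      ≤ (‖toL2 g‖ + ‖toL2 fun θ => (starRingEnd ℂ) (h θ)‖) * Real.sqrt (N + 1) * sumNorm N ψ := by
  set a := ‖toL2 g‖
  set b := ‖toL2 fun θ => (starRingEnd ℂ) (h θ)‖
  have ha : 0 ≤ a := norm_nonneg _
  have hb : 0 ≤ b := norm_nonneg _
  have hann : ∀ n, ‖annihilationN S h n (ψ (n + 1))‖ ≤ Real.sqrt (N + 1) * b * ‖ψ (n + 1)‖ := by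
    intro n
    by_cases hn : n ≤ N
    · refine ((annihilationN S h n).le_opNorm _).trans ?_
      gcongr
      refine (norm_annihilationN_le S h n).trans ?_
      gcongr
    · rw [hN (n + 1) (by omega)]
      simp
  have hcr : ∀ n : ℕ, n ≤ N → ‖creationN S g n (ψ n)‖ ≤ Real.sqrt (N + 1) * a * ‖ψ n‖ := by
    intro n hn
    refine ((creationN S g n).le_opNorm _).trans ?_
    gcongr
    refine (norm_creationN_le S g n).trans ?_
    gcongr
  have e1 : ∑ n ∈ Finset.range (N + 2), ‖ψ (n + 1)‖ ≤ sumNorm N ψ := by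
    have h1 : ∑ n ∈ Finset.range (N + 3), ‖ψ n‖ = sumNorm N ψ := by
      rw [Finset.sum_range_succ, Finset.sum_range_succ, hN (N + 1) (by omega),
        hN (N + 2) (by omega), norm_zero, norm_zero, add_zero, add_zero]
      rfl
    rw [← h1, Finset.sum_range_succ' (fun n => ‖ψ n‖) (N + 2)]
    exact le_add_of_nonneg_right (norm_nonneg (ψ 0))
  calc ∑ n ∈ Finset.range (N + 2), ‖fieldComponent S g h ψ n‖
      = ∑ n ∈ Finset.range (N + 1), ‖creationN S g n (ψ n) + annihilationN S h (n + 1) (ψ (n + 2))‖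
        + ‖annihilationN S h 0 (ψ 1)‖ :=
        Finset.sum_range_succ' (fun n => ‖fieldComponent S g h ψ n‖) _
    _ ≤ ∑ n ∈ Finset.range (N + 1), (Real.sqrt (N + 1) * a * ‖ψ n‖
          + Real.sqrt (N + 1) * b * ‖ψ (n + 2)‖) + Real.sqrt (N + 1) * b * ‖ψ 1‖ := by
        refine add_le_add (Finset.sum_le_sum fun n hn => ?_) (hann 0)
        refine (norm_add_le _ _).trans (add_le_add (hcr n ?_) (hann (n + 1)))
        have := Finset.mem_range.1 hn
        omega
    _ = Real.sqrt (N + 1) * a * sumNorm N ψ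
          + Real.sqrt (N + 1) * b * ∑ n ∈ Finset.range (N + 2), ‖ψ (n + 1)‖ := by
        rw [Finset.sum_range_succ' (fun n => ‖ψ (n + 1)‖), Finset.sum_add_distrib,
          ← Finset.mul_sum, ← Finset.mul_sum, sumNorm]
        ring
    _ ≤ Real.sqrt (N + 1) * a * sumNorm N ψ + Real.sqrt (N + 1) * b * sumNorm N ψ := by
        gcongr
    _ = _ := by ring

theorem inner_eq_sum {ψ χ : FockSpace S} {N : ℕ} (hχ : AtMost N χ) :
    ⟪ψ, χ⟫_ℂ = ∑ n ∈ Finset.range (N + 1), ⟪ψ n, χ n⟫_ℂ := by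
  rw [lp.inner_eq_tsum, tsum_eq_sum]
  intro n hn
  rw [hχ n (by simpa using hn), inner_zero_right]

/-- The operators `z†(g) + z(ḡ)` are symmetric. -/
theorem inner_fieldComponent {g h : ℝ → ℂ} (hgh : ∀ θ, h θ = (starRingEnd ℂ) (g θ))
    {ψ χ ψ' χ' : FockSpace S} {N : ℕ} (hψ : AtMost N ψ) (hχ : AtMost N χ)
    (hψ' : ∀ n, ψ' n = fieldComponent S g h ψ n) (hχ' : ∀ n, χ' n = fieldComponent S g h χ n) :
    ⟪ψ', χ⟫_ℂ = ⟪ψ, χ'⟫_ℂ := by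
  have hadj : ∀ n, annihilationN S h n = ContinuousLinearMap.adjoint (creationN S g n) := by
    intro n
    rw [annihilationN]
    congr 2
    funext θ
    rw [hgh, conj_conj]
  have key : ∀ {ψ χ ψ' : FockSpace S}, AtMost N ψ → AtMost N χ →
      (∀ n, ψ' n = fieldComponent S g h ψ n) → ⟪ψ', χ⟫_ℂ
      = ∑ n ∈ Finset.range (N + 1), ⟪creationN S g n (ψ n), χ (n + 1)⟫_ℂ
        + ∑ n ∈ Finset.range (N + 1), ⟪ψ (n + 1), creationN S g n (χ n)⟫_ℂ := by
    intro ψ χ ψ' hψ hχ hψ'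
    rw [inner_eq_sum (hχ.mono (Nat.le_succ N)), Finset.sum_range_succ',
      Finset.sum_range_succ' (fun n => ⟪ψ (n + 1), creationN S g n (χ n)⟫_ℂ)]
    -- A vanishing top term is added, so that the creation and annihilation sums have the same
    -- range.
    rw [show (∑ n ∈ Finset.range N, ⟪ψ (n + 1 + 1), creationN S g (n + 1) (χ (n + 1))⟫_ℂ)
      = ∑ n ∈ Finset.range (N + 1), ⟪ψ (n + 1 + 1), creationN S g (n + 1) (χ (n + 1))⟫_ℂ by
        rw [Finset.sum_range_succ, hψ (N + 1 + 1) (by omega), inner_zero_left, add_zero]]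
    rw [← add_assoc, ← Finset.sum_add_distrib]
    congr 1
    · refine Finset.sum_congr rfl fun n _ => ?_
      rw [hψ' (n + 1)]
      change ⟪creationN S g n (ψ n) + annihilationN S h (n + 1) (ψ (n + 2)), χ (n + 1)⟫_ℂ = _
      rw [inner_add_left, hadj, ContinuousLinearMap.adjoint_inner_left]
    · rw [hψ' 0]
      change ⟪annihilationN S h 0 (ψ 1), χ 0⟫_ℂ = _
      rw [hadj, ContinuousLinearMap.adjoint_inner_left]
  rw [key hψ hχ hψ', ← inner_conj_symm, key hχ hψ hχ', map_add, map_sum, map_sum, add_comm]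
  congr 1 <;> exact Finset.sum_congr rfl fun n _ => (inner_conj_symm _ _).symm

end Bounds

/-! ### The weight exp(ω(E)) under tensoring and contraction -/

section Weights

variable {ω : ℝ → ℝ}

/-- Nothing is known about ω on negative numbers; p ↦ ω(max p 0) is monotone on all of ℝ and
therefore Borel. -/
theorem IsIndicatrix.measurable_comp (hω : IsIndicatrix ω) {α : Type*} [MeasurableSpace α]
    {f : α → ℝ} (hf : Measurable f) (h0 : ∀ x, 0 ≤ f x) : Measurable fun x => ω (f x) := by
  have hm : Monotone fun p => ω (max p 0) := fun p q hpq =>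
    hω.mono (Set.mem_Ici.2 (le_max_right _ _)) (Set.mem_Ici.2 (le_max_right _ _))
      (max_le_max_right _ hpq)
  have := hm.measurable.comp hf
  have e : (fun p => ω (max p 0)) ∘ f = fun x => ω (f x) := by
    funext x
    simp [h0 x]
  rwa [e] at this

/-- The energy `∑ cosh θ_k`. -/
def energy {n : ℕ} (θ : Fin n → ℝ) : ℝ := ∑ k, Real.cosh (θ k)

theorem energy_nonneg {n : ℕ} (θ : Fin n → ℝ) : 0 ≤ energy θ :=
  Finset.sum_nonneg fun _ _ => (Real.cosh_pos _).le

theorem measurable_energy (n : ℕ) : Measurable (energy : (Fin n → ℝ) → ℝ) := by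
  unfold energy
  have := Real.continuous_cosh
  fun_prop

theorem energy_succ {n : ℕ} (θ : Fin (n + 1) → ℝ) :
    energy θ = Real.cosh (θ 0) + energy (Fin.tail θ) := Fin.sum_univ_succ _

theorem energy_comp {n : ℕ} (θ : Fin n → ℝ) (e : Equiv.Perm (Fin n)) : energy (θ ∘ e) = energy θ :=
  Equiv.sum_comp e fun k => Real.cosh (θ k)

theorem measurable_tail (n : ℕ) : Measurable (Fin.tail : (Fin (n + 1) → ℝ) → Fin n → ℝ) := by
  unfold Fin.tail; fun_prop

/-- The multiplier `exp u` for a measurable function `u ≤ 0`. -/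
def expMultiplier {n : ℕ} (u : (Fin n → ℝ) → ℝ) (hu : Measurable u) (h : ∀ θ, u θ ≤ 0) :
    Multiplier n where
  toFun θ := (Real.exp (u θ) : ℂ)
  measurable := measurable_ofReal.comp (Real.measurable_exp.comp hu)
  norm_le θ := by
    rw [norm_real, Real.norm_of_nonneg (Real.exp_pos _).le]
    exact Real.exp_le_one_iff.2 (h θ)

/-- The multiplier `exp(-ω(E))`. -/
def weight (hω : IsIndicatrix ω) (n : ℕ) : Multiplier n :=
  expMultiplier (fun θ => -ω (energy θ))
    (hω.measurable_comp (measurable_energy n) energy_nonneg).neg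
    fun θ => neg_nonpos.2 (hω.nonneg _ (energy_nonneg θ))

theorem weight_comp (hω : IsIndicatrix ω) {n : ℕ} (θ : Fin n → ℝ) (e : Equiv.Perm (Fin n)) :
    (weight hω n).toFun (θ ∘ e) = (weight hω n).toFun θ := by
  simp only [weight, expMultiplier, energy_comp]

/-- `exp(ω(E)) ψ` is square integrable. -/
def HasWeight (ω : ℝ → ℝ) {n : ℕ} (ψ : L2 n) : Prop :=
  MemLp (fun θ => (Real.exp (ω (energy θ)) : ℂ) * ψ θ) 2 volume

/-- The domain of the unbounded operator exp(ω(E)) is the range of the bounded one exp(-ω(E)).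
Invariance of the domain thus becomes a factorization identity between bounded operators. -/
theorem hasWeight_iff (hω : IsIndicatrix ω) {n : ℕ} (ψ : L2 n) :
    HasWeight ω ψ ↔ ∃ ξ : L2 n, ψ = mulOp (weight hω n) ξ := by
  constructor
  · intro h
    refine ⟨h.toLp _, Lp.ext ?_⟩
    filter_upwards [coeFn_mulOp (weight hω n) (h.toLp _), h.coeFn_toLp] with θ h1 h2
    rw [h1, h2, ← mul_assoc]
    simp only [weight, expMultiplier]
    rw [← ofReal_mul, ← Real.exp_add, neg_add_cancel, Real.exp_zero, ofReal_one, one_mul]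
  · rintro ⟨ξ, rfl⟩
    refine (Lp.memLp ξ).ae_eq ?_
    filter_upwards [coeFn_mulOp (weight hω n) ξ] with θ h1
    rw [h1, ← mul_assoc]
    simp only [weight, expMultiplier]
    rw [← ofReal_mul, ← Real.exp_add, add_neg_cancel, Real.exp_zero, ofReal_one, one_mul]

theorem HasWeight.starProjection (hω : IsIndicatrix ω) (S : ScatteringFunction) {n : ℕ} {ψ : L2 n}
    (h : HasWeight ω ψ) : HasWeight ω ((particleSpace S n).starProjection ψ) := by
  rw [hasWeight_iff hω] at h ⊢
  obtain ⟨ξ, rfl⟩ := h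
  exact ⟨_, starProjection_mulOp S _ (weight_comp hω) ξ⟩

theorem HasWeight.add (hω : IsIndicatrix ω) {n : ℕ} {ψ χ : L2 n} (h : HasWeight ω ψ)
    (h' : HasWeight ω χ) : HasWeight ω (ψ + χ) := by
  rw [hasWeight_iff hω] at h h' ⊢
  obtain ⟨ξ, rfl⟩ := h
  obtain ⟨η, rfl⟩ := h'
  exact ⟨ξ + η, (map_add _ _ _).symm⟩

theorem HasWeight.smul (hω : IsIndicatrix ω) {n : ℕ} {ψ : L2 n} (h : HasWeight ω ψ) (c : ℂ) :
    HasWeight ω (c • ψ) := by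
  rw [hasWeight_iff hω] at h ⊢
  obtain ⟨ξ, rfl⟩ := h
  exact ⟨c • ξ, (map_smul _ _ _).symm⟩

/-- `exp(ω(cosh θ)) g(θ)` is square integrable. -/
def WeightedL2 (ω : ℝ → ℝ) (g : ℝ → ℂ) : Prop :=
  MemLp (fun θ => (Real.exp (ω (Real.cosh θ)) : ℂ) * g θ) 2 volume

theorem WeightedL2.memLp (hω : IsIndicatrix ω) {g : ℝ → ℂ} (hg : WeightedL2 ω g) :
    MemLp g 2 volume := by
  have hm : Measurable fun θ : ℝ => (Real.exp (-ω (Real.cosh θ)) : ℂ) :=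
    measurable_ofReal.comp (Real.measurable_exp.comp
      (hω.measurable_comp Real.measurable_cosh fun θ => (Real.cosh_pos θ).le).neg)
  have e : g = fun θ => (Real.exp (-ω (Real.cosh θ)) : ℂ)
      * ((Real.exp (ω (Real.cosh θ)) : ℂ) * g θ) := by
    funext θ
    rw [← mul_assoc, ← ofReal_mul, ← Real.exp_add, neg_add_cancel, Real.exp_zero, ofReal_one,
      one_mul]
  rw [e]
  refine hg.of_le (hm.aestronglyMeasurable.mul hg.1) (Eventually.of_forall fun θ => ?_)
  rw [norm_mul]
  refine mul_le_of_le_one_left (norm_nonneg _) ?_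
  rw [norm_real, Real.norm_of_nonneg (Real.exp_pos _).le]
  exact Real.exp_le_one_iff.2 (neg_nonpos.2 (hω.nonneg _ (Real.cosh_pos _).le))

theorem WeightedL2.conj {g : ℝ → ℂ} (hg : WeightedL2 ω g) :
    WeightedL2 ω fun θ => (starRingEnd ℂ) (g θ) := by
  refine (MemLp.star hg).ae_eq (Eventually.of_forall fun θ => ?_)
  change (starRingEnd ℂ) _ = _
  rw [map_mul, conj_ofReal]

/-- Subadditivity: with E = cosh θ₀ + E', the quotient exp(ω(E) - ω(cosh θ₀) - ω(E')) is at most 1.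
It is a bounded multiplier, and the weight of g absorbs exp(ω(cosh θ₀)). -/
theorem HasWeight.tensorLeft (hω : IsIndicatrix ω) {g : ℝ → ℂ} (hg : WeightedL2 ω g) {n : ℕ}
    {ψ : L2 n} (h : HasWeight ω ψ) :
    HasWeight ω (IntegrableQFT.tensorLeft (toL2 g) n ψ) := by
  rw [hasWeight_iff hω] at h ⊢
  obtain ⟨ξ, rfl⟩ := h
  have hm : Measurable fun θ : Fin (n + 1) → ℝ =>
      ω (energy θ) - ω (Real.cosh (θ 0)) - ω (energy (Fin.tail θ)) :=
    ((hω.measurable_comp (measurable_energy _) energy_nonneg).sub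
      (hω.measurable_comp (Real.measurable_cosh.comp (measurable_pi_apply 0))
        fun _ => (Real.cosh_pos _).le)).sub
      (hω.measurable_comp ((measurable_energy n).comp (measurable_tail n))
        fun _ => energy_nonneg _)
  let R : Multiplier (n + 1) := expMultiplier _ hm fun θ => by
    have := hω.subadd _ _ (Real.cosh_pos (θ 0)).le (energy_nonneg (Fin.tail θ))
    rw [energy_succ]
    linarith
  let G : ℝ → ℂ := fun θ => (Real.exp (ω (Real.cosh θ)) : ℂ) * g θ
  have hG : MemLp G 2 volume := hg
  refine ⟨mulOp R (IntegrableQFT.tensorLeft (toL2 G) n ξ), Lp.ext ?_⟩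
  filter_upwards [coeFn_tensorLeft (toL2 g) n (mulOp (weight hω n) ξ),
    (quasiMeasurePreserving_tail n).ae (coeFn_mulOp (weight hω n) ξ),
    (quasiMeasurePreserving_head n).ae (coeFn_toL2 (hg.memLp hω)),
    (quasiMeasurePreserving_head n).ae (coeFn_toL2 hG),
    coeFn_mulOp (weight hω (n + 1)) (mulOp R (IntegrableQFT.tensorLeft (toL2 G) n ξ)),
    coeFn_mulOp R (IntegrableQFT.tensorLeft (toL2 G) n ξ),
    coeFn_tensorLeft (toL2 G) n ξ] with θ h1 h2 h3 h4 h5 h6 h7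
  rw [h1, h2, h3, h5, h6, h7, h4]
  simp only [G, R, weight, expMultiplier]
  have e : (Real.exp (-ω (energy (Fin.tail θ))) : ℂ) = (Real.exp (-ω (energy θ)) : ℂ)
      * (Real.exp (ω (energy θ) - ω (Real.cosh (θ 0)) - ω (energy (Fin.tail θ))) : ℂ)
      * (Real.exp (ω (Real.cosh (θ 0))) : ℂ) := by
    rw [← ofReal_mul, ← Real.exp_add, ← ofReal_mul, ← Real.exp_add]
    congr 2
    ring
  rw [e]
  ring

/-- Monotonicity: removing a particle lowers the energy, so exp(ω(E') - ω(E)) ≤ 1 and no decay of k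
is required. -/
theorem HasWeight.adjoint_tensorLeft (hω : IsIndicatrix ω) (k : Lp ℂ 2 (volume : Measure ℝ))
    {n : ℕ} {ψ : L2 (n + 1)} (h : HasWeight ω ψ) :
    HasWeight ω (ContinuousLinearMap.adjoint (IntegrableQFT.tensorLeft k n) ψ) := by
  rw [hasWeight_iff hω] at h ⊢
  obtain ⟨ξ, rfl⟩ := h
  have hm : Measurable fun θ : Fin (n + 1) → ℝ => ω (energy (Fin.tail θ)) - ω (energy θ) :=
    (hω.measurable_comp ((measurable_energy n).comp (measurable_tail n))
        fun _ => energy_nonneg _).sub (hω.measurable_comp (measurable_energy _) energy_nonneg)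
  let R : Multiplier (n + 1) := expMultiplier _ hm fun θ => by
    have := hω.mono (energy_nonneg (Fin.tail θ)) (energy_nonneg θ) (by
      rw [energy_succ]; linarith [Real.cosh_pos (θ 0)])
    linarith
  refine ⟨ContinuousLinearMap.adjoint (IntegrableQFT.tensorLeft k n) (mulOp R ξ), ?_⟩
  rw [← adjoint_tensorLeft_mulOp_tail, mulOp_mulOp (K := weight hω (n + 1))]
  intro θ
  simp only [R, weight, expMultiplier, Multiplier.tail]
  rw [← ofReal_mul, ← Real.exp_add]
  congr 2
  ring

end Weights

/-! ### Invariance and density of ℋ^{ω,f} -/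

section Domain

variable {S : ScatteringFunction} {ω : ℝ → ℝ}

theorem mem_Hωf_iff (ψ : FockSpace S) :
    ψ ∈ Hωf S ω ↔ ψ ∈ finiteParticle S ∧ ∀ n, HasWeight ω ((ψ n : particleSpace S n) : L2 n) :=
  Iff.rfl

/-- `z†(g) + z(h)` leaves `ℋ^{ω,f}` invariant. -/
theorem exists_fieldComponent (hω : IsIndicatrix ω) {g h : ℝ → ℂ} (hg : WeightedL2 ω g)
    {ψ : FockSpace S} (hψ : ψ ∈ Hωf S ω) :
    ∃ ψ' ∈ Hωf S ω, ∀ n, ψ' n = fieldComponent S g h ψ n := by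
  rw [mem_Hωf_iff] at hψ
  have hf := fieldComponent_finite S g h ψ hψ.1
  let ψ' : FockSpace S := ⟨fieldComponent S g h ψ, memlp_of_finite _ hf⟩
  have hann : ∀ n, HasWeight ω ((annihilationN S h n (ψ (n + 1)) : particleSpace S n) : L2 n) := by
    intro n
    rw [coe_annihilationN]
    exact (((hψ.2 (n + 1)).adjoint_tensorLeft hω _).starProjection hω S).smul hω _
  have hcr : ∀ n, HasWeight ω
      ((creationN S g n (ψ n) : particleSpace S (n + 1)) : L2 (n + 1)) := by
    intro n
    rw [coe_creationN]
    exact (((hψ.2 n).tensorLeft hω hg).starProjection hω S).smul hω _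
  refine ⟨ψ', ⟨hf, fun n => ?_⟩, fun n => rfl⟩
  obtain _ | n := n
  · exact hann 0
  · exact (hcr n).add hω (hann (n + 1))

theorem L2_norm_sq {n : ℕ} (u : L2 n) : ‖u‖ ^ 2 = ∫ θ, ‖u θ‖ ^ 2 := by
  have h := inner_self_eq_norm_sq_to_K (𝕜 := ℂ) u
  rw [L2.inner_def] at h
  simp only [inner_self_eq_norm_sq_to_K] at h
  have h2 : ((‖u‖ ^ 2 : ℝ) : ℂ) = ((∫ a, ‖u a‖ ^ 2 : ℝ) : ℂ) := by
    have h3 := integral_ofReal (𝕜 := ℂ) (μ := (volume : Measure (Fin n → ℝ)))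
      (f := fun a => ‖u a‖ ^ 2)
    push_cast at h3 ⊢
    exact (h3.symm.trans h).symm
  exact_mod_cast h2

open Classical in
/-- The energy cutoff `E ≤ K`. -/
def cutoff (n : ℕ) (K : ℕ) : Multiplier n where
  toFun θ := if energy θ ≤ K then 1 else 0
  measurable := Measurable.ite (measurableSet_le (measurable_energy n) measurable_const)
    measurable_const measurable_const
  norm_le θ := by split_ifs <;> simp

theorem hasWeight_cutoff (hω : IsIndicatrix ω) {n : ℕ} (K : ℕ) (ψ : L2 n) :
    HasWeight ω (mulOp (cutoff n K) ψ) := by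
  have hm : Measurable fun θ : Fin n → ℝ => (Real.exp (ω (energy θ)) : ℂ) :=
    measurable_ofReal.comp (Real.measurable_exp.comp
      (hω.measurable_comp (measurable_energy n) energy_nonneg))
  refine (Lp.memLp ψ).of_le_mul (c := Real.exp (ω K))
    (hm.aestronglyMeasurable.mul (Lp.aestronglyMeasurable _)) ?_
  filter_upwards [coeFn_mulOp (cutoff n K) ψ] with θ h
  rw [h, norm_mul, norm_mul, norm_real, Real.norm_of_nonneg (Real.exp_pos _).le, ← mul_assoc]
  gcongr
  simp only [cutoff]
  split_ifs with hE
  · rw [norm_one, mul_one]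
    exact Real.exp_le_exp.2 (hω.mono (energy_nonneg θ) (Set.mem_Ici.2 (Nat.cast_nonneg K)) hE)
  · rw [norm_zero, mul_zero]
    exact (Real.exp_pos _).le

theorem tendsto_cutoff {n : ℕ} (ψ : L2 n) :
    Tendsto (fun K => mulOp (cutoff n K) ψ) atTop (𝓝 ψ) := by
  rw [tendsto_iff_norm_sub_tendsto_zero]
  have h1 : Tendsto (fun K : ℕ => ∫ θ, ‖(mulOp (cutoff n K) ψ - ψ : L2 n) θ‖ ^ 2) atTop
      (𝓝 (∫ _ : Fin n → ℝ, (0 : ℝ))) := by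
    have hae : ∀ K : ℕ, ∀ᵐ θ : Fin n → ℝ, (mulOp (cutoff n K) ψ - ψ : L2 n) θ
        = ((cutoff n K).toFun θ - 1) * ψ θ := by
      intro K
      filter_upwards [Lp.coeFn_sub (mulOp (cutoff n K) ψ) ψ, coeFn_mulOp (cutoff n K) ψ]
        with θ h1 h2
      rw [h1, Pi.sub_apply, h2, sub_mul, one_mul]
    refine tendsto_integral_of_dominated_convergence (fun θ => ‖ψ θ‖ ^ 2)
      (fun K => (Lp.aestronglyMeasurable _).norm.pow 2)
      ((memLp_two_iff_integrable_sq_norm (Lp.aestronglyMeasurable ψ)).1 (Lp.memLp ψ)) ?_ ?_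
    · intro K
      filter_upwards [hae K] with θ h
      rw [h, Real.norm_of_nonneg (sq_nonneg _), norm_mul, mul_pow]
      refine mul_le_of_le_one_left (sq_nonneg _) ?_
      simp only [cutoff]
      split_ifs <;> simp
    · filter_upwards [ae_all_iff.2 hae] with θ h
      refine tendsto_const_nhds.congr' ?_
      filter_upwards [eventually_ge_atTop ⌈energy θ⌉₊] with K hK
      have : energy θ ≤ K := (Nat.le_ceil _).trans (by exact_mod_cast hK)
      rw [h]
      simp [cutoff, this]
  simp only [← L2_norm_sq, integral_zero] at h1
  have h2 := h1.sqrt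
  simpa [Real.sqrt_sq] using h2

/-- Vectors of finite particle number are approximated by vectors in `ℋ^{ω,f}`, component by
component. -/
theorem exists_approx (hω : IsIndicatrix ω) (ψ : FockSpace S) (N : ℕ) {ε : ℝ} (hε : 0 < ε) :
    ∃ χ ∈ Hωf S ω, AtMost N χ ∧ sumNorm N (ψ - χ) < ε := by
  have h1 : ∀ n, ∃ χ : particleSpace S n, HasWeight ω (χ : L2 n) ∧
      ‖ψ n - χ‖ < ε / (N + 1) := by
    intro n
    -- Each component is cut off at high energy. The cutoff is a permutation-invariant multiplier,
    -- so it preserves S-symmetry; the tolerance ε is shared equally among the N + 1 components.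
    have h2 := Metric.tendsto_atTop.1 (tendsto_cutoff ((ψ n : particleSpace S n) : L2 n))
      (ε / (N + 1)) (by positivity)
    obtain ⟨K, hK⟩ := h2
    refine ⟨⟨_, mulOp_mem (cutoff n K) (fun θ e => ?_) (ψ n).2⟩, hasWeight_cutoff hω K _, ?_⟩
    · simp only [cutoff, energy_comp]
    · have := hK K le_rfl
      rwa [dist_comm, dist_eq_norm] at this
  choose χ hχ hd using h1
  let u : ∀ n, particleSpace S n := fun n => if n ≤ N then χ n else 0
  have hu : ∃ M : ℕ, ∀ n, M < n → u n = 0 := ⟨N, fun n hn => if_neg (not_le.2 hn)⟩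
  let χ' : FockSpace S := ⟨u, memlp_of_finite u hu⟩
  refine ⟨χ', ⟨hu, fun n => ?_⟩, fun n hn => if_neg (not_le.2 hn), ?_⟩
  · change HasWeight ω ((u n : particleSpace S n) : L2 n)
    simp only [u]
    split_ifs
    · exact hχ n
    · rw [hasWeight_iff hω]
      exact ⟨0, (map_zero _).symm⟩
  · have : sumNorm N (ψ - χ') < ∑ _n ∈ Finset.range (N + 1), ε / (N + 1) := by
      refine Finset.sum_lt_sum_of_nonempty ⟨0, by simp⟩ fun n hn => ?_
      have e : (ψ - χ') n = ψ n - χ n := by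
        change ψ n - u n = _
        simp only [u]
        rw [if_pos (Nat.lt_succ_iff.1 (Finset.mem_range.1 hn))]
      rw [e]
      exact hd n
    refine this.trans_eq ?_
    rw [Finset.sum_const, Finset.card_range, nsmul_eq_mul]
    push_cast
    field_simp

theorem dense_Hωf (hω : IsIndicatrix ω) : Dense (Hωf S ω : Set (FockSpace S)) := by
  have h1 : Dense (finiteParticle S : Set (FockSpace S)) := by
    intro ψ
    refine mem_closure_of_tendsto (lp.hasSum_single (p := 2) (by norm_num) ψ)
      (Eventually.of_forall fun s => ?_)
    refine Submodule.sum_mem _ fun n _ => ⟨n, fun k hk => ?_⟩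
    exact lp.single_apply_ne _ _ _ hk.ne'
  refine dense_closure.1 (h1.mono fun ψ hψ => ?_)
  obtain ⟨N, hN⟩ := hψ
  rw [Metric.mem_closure_iff]
  intro ε hε
  obtain ⟨χ, hχ, hχN, hd⟩ := exists_approx hω ψ N hε
  refine ⟨χ, hχ, ?_⟩
  rw [dist_eq_norm]
  refine lt_of_le_of_lt (AtMost.norm_le fun n hn => ?_) hd
  change ψ n - χ n = 0
  rw [hN n hn, hχN n hn, sub_zero]

end Domain

/-! ### The field as an entire symmetric operator with core ℋ^{ω,f} -/

section FieldEnd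

variable {S : ScatteringFunction} {ω : ℝ → ℝ}

theorem mem_graph_creationAnnihilation {g h : ℝ → ℂ} {ψ ψ' : FockSpace S} :
    (ψ, ψ') ∈ (creationAnnihilation S g h).graph ↔
      ψ ∈ finiteParticle S ∧ ∀ n, ψ' n = fieldComponent S g h ψ n := by
  rw [LinearPMap.mem_graph_iff]
  constructor
  · rintro ⟨y, hy, rfl⟩
    obtain rfl : (y : FockSpace S) = ψ := hy
    exact ⟨y.2, fun n => rfl⟩
  · rintro ⟨hψ, h⟩
    refine ⟨⟨ψ, hψ⟩, rfl, ?_⟩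
    ext1
    funext n
    exact (h n).symm

/-- `Φ` is the restriction of `z†(g) + z(h)` to `ℋ^{ω,f}`. -/
def IsFieldEnd (g h : ℝ → ℂ) (Φ : Module.End ℂ (Hωf S ω)) : Prop :=
  ∀ (ψ : Hωf S ω) (n : ℕ), (Φ ψ : FockSpace S) n = fieldComponent S g h (ψ : FockSpace S) n

theorem isFieldEnd_iff {g h : ℝ → ℂ} {Φ : Module.End ℂ (Hωf S ω)} : IsFieldEnd g h Φ ↔
    ∀ ψ : Hωf S ω, ((ψ : FockSpace S), (Φ ψ : FockSpace S)) ∈ (creationAnnihilation S g h).graph :=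
  ⟨fun hΦ ψ => mem_graph_creationAnnihilation.2 ⟨ψ.2.1, hΦ ψ⟩,
    fun hΦ ψ => (mem_graph_creationAnnihilation.1 (hΦ ψ)).2⟩

theorem exists_isFieldEnd (hω : IsIndicatrix ω) {g : ℝ → ℂ} (hg : WeightedL2 ω g) (h : ℝ → ℂ) :
    ∃ Φ : Module.End ℂ (Hωf S ω), IsFieldEnd g h Φ := by
  have hmem : ∀ ψ : Hωf S ω, creationAnnihilation S g h ⟨ψ, ψ.2.1⟩ ∈ Hωf S ω := by
    intro ψ
    obtain ⟨ψ', hψ', e⟩ := exists_fieldComponent (h := h) hω hg ψ.2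
    have : creationAnnihilation S g h ⟨ψ, ψ.2.1⟩ = ψ' := by
      ext1; funext n; exact (e n).symm
    rwa [this]
  refine ⟨((creationAnnihilation S g h).toFun ∘ₗ
    Submodule.inclusion (show Hωf S ω ≤ finiteParticle S from fun _ hψ => hψ.1)).codRestrict _ hmem,
    fun ψ n => rfl⟩

theorem AtMost.isFieldEnd {g h : ℝ → ℂ} {Φ : Module.End ℂ (Hωf S ω)} (hΦ : IsFieldEnd g h Φ)
    {ψ : Hωf S ω} {N : ℕ} (hN : AtMost N (ψ : FockSpace S)) :
    AtMost (N + 1) (Φ ψ : FockSpace S) := fun n hn => by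
  rw [hΦ, hN.fieldComponent g h n hn]

/-- The j-th application acts on at most N + j particles, costs √(N+j+1), and raises the maximal
particle number by one. -/
theorem pow_bound {g h : ℝ → ℂ} {Φ : Module.End ℂ (Hωf S ω)} (hΦ : IsFieldEnd g h Φ)
    {ψ : Hωf S ω} {N : ℕ} (hN : AtMost N (ψ : FockSpace S)) (k : ℕ) :
    AtMost (N + k) ((Φ ^ k) ψ : FockSpace S) ∧
    sumNorm (N + k) ((Φ ^ k) ψ : FockSpace S)
      ≤ (‖toL2 g‖ + ‖toL2 fun θ => (starRingEnd ℂ) (h θ)‖) ^ k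
        * (∏ j ∈ Finset.range k, Real.sqrt (N + j + 1)) * sumNorm N (ψ : FockSpace S) := by
  induction k with
  | zero => simp [hN]
  | succ k ih =>
    obtain ⟨ih1, ih2⟩ := ih
    have e : (Φ ^ (k + 1)) ψ = Φ ((Φ ^ k) ψ) := by rw [pow_succ']; rfl
    rw [e]
    refine ⟨ih1.isFieldEnd hΦ, ?_⟩
    have h1 : sumNorm (N + (k + 1)) (Φ ((Φ ^ k) ψ) : FockSpace S)
        = ∑ n ∈ Finset.range (N + k + 2), ‖fieldComponent S g h ((Φ ^ k) ψ : FockSpace S) n‖ :=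
      Finset.sum_congr rfl fun n _ => by rw [hΦ]
    rw [h1]
    refine (sum_norm_fieldComponent_le ih1 g h).trans ?_
    rw [Finset.prod_range_succ, pow_succ]
    push_cast
    set c := ‖toL2 g‖ + ‖toL2 fun θ => (starRingEnd ℂ) (h θ)‖
    have hc : 0 ≤ c := by positivity
    calc c * Real.sqrt (N + k + 1) * sumNorm (N + k) ((Φ ^ k) ψ : FockSpace S)
        ≤ c * Real.sqrt (N + k + 1) * (c ^ k * (∏ j ∈ Finset.range k, Real.sqrt (N + j + 1))
          * sumNorm N (ψ : FockSpace S)) := by gcongr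
      _ = _ := by ring

theorem summable_prod_sqrt (N : ℕ) (c : ℝ) : Summable fun k : ℕ =>
    |c| ^ k / (k.factorial : ℝ) * ∏ j ∈ Finset.range k, Real.sqrt (N + j + 1) := by
  have hpos : ∀ k : ℕ, 0 < ∏ j ∈ Finset.range k, Real.sqrt ((N : ℝ) + j + 1) := fun k =>
    Finset.prod_pos fun j _ => Real.sqrt_pos.2 (by positivity)
  -- The ratio test divides by the terms, so |c| is first enlarged to |c| + 1 to keep them positive.
  -- The ratio is (|c|+1)√(N+k+1)/(k+1), which is O(1/√(k+1)).
  have h1 : Summable fun k : ℕ =>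
      (|c| + 1) ^ k / (k.factorial : ℝ) * ∏ j ∈ Finset.range k, Real.sqrt (N + j + 1) := by
    refine summable_of_ratio_test_tendsto_lt_one (l := 0) one_pos
      (Eventually.of_forall fun k => ?_) ?_
    · have := hpos k
      positivity
    · have hlim : Tendsto (fun k : ℕ => (|c| + 1) * Real.sqrt (N + 1) * (1 / Real.sqrt (k + 1)))
          atTop (𝓝 0) := by
        rw [← mul_zero ((|c| + 1) * Real.sqrt (N + 1))]
        refine Tendsto.const_mul _ ?_
        refine Tendsto.comp (g := fun x : ℝ => 1 / x) (tendsto_const_nhds.div_atTop tendsto_id) ?_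
        exact Real.tendsto_sqrt_atTop.comp
          (tendsto_atTop_add_const_right _ _ tendsto_natCast_atTop_atTop)
      refine squeeze_zero (fun k => by positivity) (fun k => ?_) hlim
      have hk := hpos k
      rw [Real.norm_of_nonneg (by have := hpos (k + 1); positivity),
        Real.norm_of_nonneg (by positivity), Finset.prod_range_succ, Nat.factorial_succ, pow_succ]
      push_cast
      have hs : Real.sqrt ((N : ℝ) + k + 1) ≤ Real.sqrt (N + 1) * Real.sqrt (k + 1) := by
        rw [← Real.sqrt_mul (by positivity)]
        refine Real.sqrt_le_sqrt ?_
        nlinarith [(Nat.cast_nonneg N : (0 : ℝ) ≤ N), (Nat.cast_nonneg k : (0 : ℝ) ≤ k),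
          mul_nonneg (Nat.cast_nonneg N : (0 : ℝ) ≤ N) (Nat.cast_nonneg k : (0 : ℝ) ≤ k)]
      have hk1 : ((k : ℝ) + 1) = Real.sqrt (k + 1) * Real.sqrt (k + 1) :=
        (Real.mul_self_sqrt (by positivity)).symm
      have hf : (0 : ℝ) < k.factorial := by exact_mod_cast k.factorial_pos
      have hsq : 0 < Real.sqrt ((k : ℝ) + 1) := Real.sqrt_pos.2 (by positivity)
      have e : (|c| + 1) ^ k * (|c| + 1) / ((k + 1) * k.factorial) *
          ((∏ j ∈ Finset.range k, Real.sqrt ((N : ℝ) + j + 1)) * Real.sqrt (N + k + 1)) /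
          ((|c| + 1) ^ k / k.factorial * ∏ j ∈ Finset.range k, Real.sqrt ((N : ℝ) + j + 1))
          = (|c| + 1) * Real.sqrt (N + k + 1) / (k + 1) := by
        field_simp
      rw [e]
      calc (|c| + 1) * Real.sqrt (N + k + 1) / (k + 1)
          ≤ (|c| + 1) * (Real.sqrt (N + 1) * Real.sqrt (k + 1)) / (k + 1) := by gcongr
        _ = (|c| + 1) * (Real.sqrt (N + 1) * Real.sqrt (k + 1))
              / (Real.sqrt (k + 1) * Real.sqrt (k + 1)) := by rw [← hk1]
        _ = _ := by field_simp
  refine Summable.of_nonneg_of_le (fun k => ?_) (fun k => ?_) h1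
  · have := hpos k
    positivity
  · have := hpos k
    gcongr
    linarith

theorem IsFieldEnd.isEntireSymmetric {g h : ℝ → ℂ} (hgh : ∀ θ, h θ = (starRingEnd ℂ) (g θ))
    {Φ : Module.End ℂ (Hωf S ω)} (hΦ : IsFieldEnd g h Φ) : IsEntireSymmetric Φ where
  symm ψ χ := by
    obtain ⟨M, hM⟩ := ψ.2.1
    obtain ⟨N, hN⟩ := χ.2.1
    exact inner_fieldComponent hgh (hM.mono (le_max_left M N)) (hN.mono (le_max_right M N))
      (hΦ ψ) (hΦ χ)
  summable t ψ := by
    obtain ⟨N, hN⟩ := ψ.2.1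
    set c := ‖toL2 g‖ + ‖toL2 fun θ => (starRingEnd ℂ) (h θ)‖
    have hc : 0 ≤ c := by positivity
    refine Summable.of_nonneg_of_le (fun k => by positivity) (fun k => ?_)
      ((summable_prod_sqrt N (t * c)).mul_right (sumNorm N (ψ : FockSpace S)))
    obtain ⟨h1, h2⟩ := pow_bound hΦ hN k
    calc |t| ^ k / (k.factorial : ℝ) * ‖((Φ ^ k) ψ : FockSpace S)‖
        ≤ |t| ^ k / (k.factorial : ℝ) * (c ^ k
        * (∏ j ∈ Finset.range k, Real.sqrt (N + j + 1)) * sumNorm N (ψ : FockSpace S)) := by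
          gcongr
          exact h1.norm_le.trans h2
      _ = _ := by
          rw [abs_mul, abs_of_nonneg hc, mul_pow]
          ring

theorem fieldComponent_sub {g h : ℝ → ℂ} {ψ χ : FockSpace S} (hψ : ψ ∈ finiteParticle S)
    (hχ : χ ∈ finiteParticle S) (n : ℕ) :
    fieldComponent S g h (ψ - χ) n = fieldComponent S g h ψ n - fieldComponent S g h χ n := by
  have := map_sub (creationAnnihilation S g h).toFun ⟨ψ, hψ⟩ ⟨χ, hχ⟩
  exact congrFun (congrArg (fun u : FockSpace S => (u : ∀ n, particleSpace S n)) this) n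

theorem dense_domain_creationAnnihilation (hω : IsIndicatrix ω) (g h : ℝ → ℂ) :
    Dense ((creationAnnihilation S g h).domain : Set (FockSpace S)) :=
  (dense_Hωf hω).mono fun _ hψ => hψ.1

theorem creationAnnihilation_le_adjoint (hω : IsIndicatrix ω) {g h : ℝ → ℂ}
    (hgh : ∀ θ, h θ = (starRingEnd ℂ) (g θ)) :
    creationAnnihilation S g h ≤ (creationAnnihilation S g h).adjoint := by
  refine LinearPMap.IsFormalAdjoint.le_adjoint (dense_domain_creationAnnihilation hω g h) ?_
  intro ψ χ
  obtain ⟨M, hM⟩ := ψ.2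
  obtain ⟨N, hN⟩ := χ.2
  exact inner_fieldComponent hgh (hM.mono (le_max_left M N)) (hN.mono (le_max_right M N))
    (fun n => rfl) (fun n => rfl)

theorem isClosable_creationAnnihilation (hω : IsIndicatrix ω) {g h : ℝ → ℂ}
    (hgh : ∀ θ, h θ = (starRingEnd ℂ) (g θ)) :
    (creationAnnihilation S g h).IsClosable :=
  LinearPMap.isClosable_iff_exists_closed_extension.2
    ⟨_, LinearPMap.adjoint_isClosed (dense_domain_creationAnnihilation hω g h),
      creationAnnihilation_le_adjoint hω hgh⟩

/-- `ℋ^{ω,f}` is a core for the closure of `z†(g) + z(ḡ)`. -/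
theorem graph_closure_eq (hω : IsIndicatrix ω) {g h : ℝ → ℂ}
    (hgh : ∀ θ, h θ = (starRingEnd ℂ) (g θ)) {Φ : Module.End ℂ (Hωf S ω)}
    (hΦ : IsFieldEnd g h Φ) :
    (creationAnnihilation S g h).closure.graph = (endGraph Φ).topologicalClosure := by
  rw [← (isClosable_creationAnnihilation hω hgh).graph_closure_eq_closure_graph]
  refine le_antisymm (Submodule.topologicalClosure_minimal _ ?_
    (Submodule.isClosed_topologicalClosure _)) (Submodule.topologicalClosure_mono ?_)
  · rintro ⟨ψ, η⟩ hη
    obtain ⟨hψ, hη⟩ := mem_graph_creationAnnihilation.1 hη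
    obtain ⟨N, hN⟩ := hψ
    -- On at most N particles the field is bounded with constant c, so approximating ψ by cutoffs
    -- with the same particle bound also approximates its image. The tolerance ε/(c+1) serves both
    -- coordinates of the graph and allows c = 0.
    set c := (‖toL2 g‖ + ‖toL2 fun θ => (starRingEnd ℂ) (h θ)‖) * Real.sqrt (N + 1)
    have hc : 0 ≤ c := by positivity
    change (ψ, η) ∈ closure (endGraph Φ : Set (FockSpace S × FockSpace S))
    rw [Metric.mem_closure_iff]
    intro ε hε
    obtain ⟨χ, hχ, hχN, hd⟩ := exists_approx hω ψ N (ε := ε / (c + 1)) (by positivity)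
    have hsub : AtMost N (ψ - χ) := fun n hn => by
      change ψ n - χ n = 0
      rw [hN n hn, hχN n hn, sub_zero]
    have hs0 := sumNorm_nonneg N (ψ - χ)
    have hd' : (c + 1) * sumNorm N (ψ - χ) < ε := by
      rw [lt_div_iff₀ (by positivity)] at hd
      linarith
    have hdiff : ∀ n, (η - (Φ ⟨χ, hχ⟩ : FockSpace S)) n = fieldComponent S g h (ψ - χ) n := by
      intro n
      change η n - (Φ ⟨χ, hχ⟩ : FockSpace S) n = _
      rw [hη, hΦ, fieldComponent_sub ⟨N, hN⟩ hχ.1]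
    have hη' : AtMost (N + 1) (η - (Φ ⟨χ, hχ⟩ : FockSpace S)) := fun n hn => by
      rw [hdiff, hsub.fieldComponent g h n hn]
    have hbound : ‖η - (Φ ⟨χ, hχ⟩ : FockSpace S)‖ ≤ c * sumNorm N (ψ - χ) := by
      refine hη'.norm_le.trans ?_
      have e : sumNorm (N + 1) (η - (Φ ⟨χ, hχ⟩ : FockSpace S))
          = ∑ n ∈ Finset.range (N + 2), ‖fieldComponent S g h (ψ - χ) n‖ :=
        Finset.sum_congr rfl fun n _ => by rw [hdiff]
      rw [e]
      exact sum_norm_fieldComponent_le hsub g h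
    refine ⟨_, (mem_endGraph Φ _).2 ⟨⟨χ, hχ⟩, rfl⟩, ?_⟩
    rw [Prod.dist_eq, max_lt_iff, dist_eq_norm, dist_eq_norm]
    constructor
    · have := hsub.norm_le
      change ‖ψ - χ‖ < ε
      nlinarith
    · change ‖η - (Φ ⟨χ, hχ⟩ : FockSpace S)‖ < ε
      nlinarith
  · intro p hp
    obtain ⟨ψ, rfl⟩ := (mem_endGraph Φ p).1 hp
    exact isFieldEnd_iff.1 hΦ ψ

theorem isExpI_creationAnnihilation_iff (hω : IsIndicatrix ω) {g h : ℝ → ℂ}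
    (hgh : ∀ θ, h θ = (starRingEnd ℂ) (g θ)) {Φ : Module.End ℂ (Hωf S ω)}
    (hΦ : IsFieldEnd g h Φ) (B : FockSpace S →L[ℂ] FockSpace S) :
    IsExpI (creationAnnihilation S g h).closure B ↔ IsExp Φ B :=
  (hΦ.isEntireSymmetric hgh).isExpI_iff (dense_Hωf hω) (graph_closure_eq hω hgh hΦ) B

end FieldEnd

/-! ### Test functions and their Fourier transforms on the mass shell -/

section TestFunctions

variable {m : ℝ} {ω : ℝ → ℝ}

/-- `exp(ω(cosh θ)) F(θ)` is bounded and square integrable. -/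
def IsRapid (ω : ℝ → ℝ) (F : ℝ → ℂ) : Prop :=
  (∃ C : ℝ, ∀ θ, ‖(Real.exp (ω (Real.cosh θ)) : ℂ) * F θ‖ ≤ C) ∧ WeightedL2 ω F

theorem IsRapid.add {F G : ℝ → ℂ} (hF : IsRapid ω F) (hG : IsRapid ω G) :
    IsRapid ω (F + G) := by
  obtain ⟨⟨C, hC⟩, hF⟩ := hF
  obtain ⟨⟨C', hC'⟩, hG⟩ := hG
  refine ⟨⟨C + C', fun θ => ?_⟩, (MemLp.add hF hG).ae_eq (Eventually.of_forall fun θ => ?_)⟩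
  · rw [Pi.add_apply, mul_add]
    exact (norm_add_le _ _).trans (add_le_add (hC θ) (hC' θ))
  · simp only [Pi.add_apply, mul_add]

theorem IsRapid.smul {F : ℝ → ℂ} (hF : IsRapid ω F) (c : ℂ) : IsRapid ω (c • F) := by
  obtain ⟨⟨C, hC⟩, hF⟩ := hF
  refine ⟨⟨‖c‖ * C, fun θ => ?_⟩, (MemLp.const_smul hF c).ae_eq (Eventually.of_forall fun θ => ?_)⟩
  · rw [Pi.smul_apply, mul_smul_comm, norm_smul]
    exact mul_le_mul_of_nonneg_left (hC θ) (norm_nonneg _)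
  · simp only [Pi.smul_apply, smul_eq_mul]
    ring

theorem IsRapid.conj {F : ℝ → ℂ} (hF : IsRapid ω F) :
    IsRapid ω fun θ => (starRingEnd ℂ) (F θ) := by
  obtain ⟨⟨C, hC⟩, hF⟩ := hF
  refine ⟨⟨C, fun θ => ?_⟩, hF.conj⟩
  rw [norm_mul, RCLike.norm_conj, ← norm_mul]
  exact hC θ

theorem IsRapid.mul {F u : ℝ → ℂ} (hF : IsRapid ω F) (hu : Continuous u) (h1 : ∀ θ, ‖u θ‖ = 1) :
    IsRapid ω fun θ => u θ * F θ := by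
  obtain ⟨⟨C, hC⟩, hF⟩ := hF
  have e : ∀ θ, (Real.exp (ω (Real.cosh θ)) : ℂ) * (u θ * F θ)
      = u θ * ((Real.exp (ω (Real.cosh θ)) : ℂ) * F θ) := fun θ => by ring
  refine ⟨⟨C, fun θ => ?_⟩, ?_⟩
  · rw [e, norm_mul, h1, one_mul]
    exact hC θ
  · unfold WeightedL2
    simp only [e]
    refine hF.of_le (hu.aestronglyMeasurable.mul hF.1) (Eventually.of_forall fun θ => ?_)
    rw [norm_mul, h1, one_mul]

theorem isTestFunction_iff {O : Set Spacetime} {f : Spacetime → ℂ} :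
    IsTestFunction m ω O f ↔ ContDiff ℝ ((⊤ : ℕ∞) : WithTop ℕ∞) f ∧ HasCompactSupport f ∧
      tsupport f ⊆ O ∧ IsRapid ω (fourierPlus m f) ∧ IsRapid ω (fourierMinus m f) := by
  simp only [IsTestFunction, Set.mem_insert_iff, Set.mem_singleton_iff, forall_eq_or_imp,
    forall_eq]
  rfl

theorem continuous_momentumDot (m θ : ℝ) : Continuous fun x : Spacetime => momentumDot m θ x := by
  unfold momentumDot; fun_prop

theorem fourierPlus_smul (f : Spacetime → ℂ) (c : ℂ) :
    fourierPlus m (fun x => c * f x) = c • fourierPlus m f := by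
  funext θ
  simp only [fourierPlus, Pi.smul_apply, smul_eq_mul, mul_assoc, integral_const_mul]
  ring

theorem fourierMinus_smul (f : Spacetime → ℂ) (c : ℂ) :
    fourierMinus m (fun x => c * f x) = c • fourierMinus m f := by
  funext θ
  simp only [fourierMinus, Pi.smul_apply, smul_eq_mul, mul_assoc, integral_const_mul]
  ring

theorem integrable_mul_exp {f : Spacetime → ℂ} (hf : Continuous f) (hc : HasCompactSupport f)
    {u : Spacetime → ℂ} (hu : Continuous u) : Integrable fun x => f x * u x :=
  (hf.mul hu).integrable_of_hasCompactSupport hc.mul_right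

theorem fourierPlus_add {f g : Spacetime → ℂ} (hf : Continuous f) (hfc : HasCompactSupport f)
    (hg : Continuous g) (hgc : HasCompactSupport g) :
    fourierPlus m (fun x => f x + g x) = fourierPlus m f + fourierPlus m g := by
  funext θ
  have hu : Continuous fun x : Spacetime => exp (I * (momentumDot m θ x : ℝ)) := by
    have := continuous_momentumDot m θ
    fun_prop
  simp only [fourierPlus, Pi.add_apply, add_mul]
  rw [integral_add (integrable_mul_exp hf hfc hu) (integrable_mul_exp hg hgc hu), mul_add]

theorem fourierMinus_add {f g : Spacetime → ℂ} (hf : Continuous f) (hfc : HasCompactSupport f)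
    (hg : Continuous g) (hgc : HasCompactSupport g) :
    fourierMinus m (fun x => f x + g x) = fourierMinus m f + fourierMinus m g := by
  funext θ
  have hu : Continuous fun x : Spacetime => exp (-I * (momentumDot m θ x : ℝ)) := by
    have := continuous_momentumDot m θ
    fun_prop
  simp only [fourierMinus, Pi.add_apply, add_mul]
  rw [integral_add (integrable_mul_exp hf hfc hu) (integrable_mul_exp hg hgc hu), mul_add]

theorem fourierMinus_conj (f : Spacetime → ℂ) :
    fourierMinus m (fun x => (starRingEnd ℂ) (f x))
      = fun θ => (starRingEnd ℂ) (fourierPlus m f θ) := by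
  funext θ
  simp only [fourierMinus, fourierPlus]
  rw [map_mul, conj_ofReal, ← integral_conj]
  congr 2
  funext x
  rw [map_mul, ← exp_conj, map_mul, conj_I, conj_ofReal]

theorem fourierPlus_conj (f : Spacetime → ℂ) :
    fourierPlus m (fun x => (starRingEnd ℂ) (f x))
      = fun θ => (starRingEnd ℂ) (fourierMinus m f θ) := by
  funext θ
  simp only [fourierMinus, fourierPlus]
  rw [map_mul, conj_ofReal, ← integral_conj]
  congr 2
  funext x
  rw [map_mul, ← exp_conj, map_mul, map_neg, conj_I, conj_ofReal, neg_neg]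

/-- Reality of f is what makes φ(f) = z†(f⁺) + z(f⁻) symmetric, through f⁻ being the conjugate of
f⁺. -/
theorem fourierMinus_of_real {f : Spacetime → ℂ} (hf : ∀ x, (f x).im = 0) (θ : ℝ) :
    fourierMinus m f θ = (starRingEnd ℂ) (fourierPlus m f θ) := by
  have : (fun x => (starRingEnd ℂ) (f x)) = f := funext fun x => conj_eq_iff_im.2 (hf x)
  rw [← congrFun (fourierMinus_conj (m := m) f) θ, this]

theorem IsRealTestFunction.smul {O : Set Spacetime} {f : Spacetime → ℂ}
    (hf : IsRealTestFunction m ω O f) (t : ℝ) :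
    IsRealTestFunction m ω O fun x => (t : ℂ) * f x := by
  obtain ⟨hf, him⟩ := hf
  rw [isTestFunction_iff] at hf
  obtain ⟨h1, h2, h3, h4, h5⟩ := hf
  refine ⟨isTestFunction_iff.2 ⟨contDiff_const.mul h1, h2.mul_left,
    (closure_mono (Function.support_mul_subset_right _ _)).trans h3, ?_, ?_⟩, fun x => ?_⟩
  · rw [fourierPlus_smul]; exact h4.smul _
  · rw [fourierMinus_smul]; exact h5.smul _
  · simp [him x]

/-- Conjugating f exchanges f⁺ and f⁻ up to conjugation, and the decay condition is imposed on both.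
-/
theorem IsTestFunction.linearCombination {O : Set Spacetime} {f : Spacetime → ℂ}
    (hf : IsTestFunction m ω O f) (c d : ℂ) :
    IsTestFunction m ω O fun x => c * f x + d * (starRingEnd ℂ) (f x) := by
  rw [isTestFunction_iff] at hf ⊢
  obtain ⟨h1, h2, h3, h4, h5⟩ := hf
  have hconj : ContDiff ℝ ((⊤ : ℕ∞) : WithTop ℕ∞) fun x => (starRingEnd ℂ) (f x) :=
    conjCLE.contDiff.comp h1
  have hcc : HasCompactSupport fun x => (starRingEnd ℂ) (f x) := h2.comp_left (map_zero _)
  have hc1 : Continuous fun x => c * f x := continuous_const.mul h1.continuous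
  have hc2 : Continuous fun x => d * (starRingEnd ℂ) (f x) :=
    continuous_const.mul hconj.continuous
  have hs1 : HasCompactSupport fun x => c * f x := h2.mul_left
  have hs2 : HasCompactSupport fun x => d * (starRingEnd ℂ) (f x) := hcc.mul_left
  refine ⟨(contDiff_const.mul h1).add (contDiff_const.mul hconj), hs1.add hs2,
    (closure_mono fun x hx => ?_).trans h3, ?_, ?_⟩
  · rw [Function.mem_support] at hx ⊢
    intro h0
    exact hx (by simp [h0])
  · rw [fourierPlus_add hc1 hs1 hc2 hs2, fourierPlus_smul, fourierPlus_smul, fourierPlus_conj]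
    exact (h4.smul _).add (h5.conj.smul _)
  · rw [fourierMinus_add hc1 hs1 hc2 hs2, fourierMinus_smul, fourierMinus_smul, fourierMinus_conj]
    exact (h5.smul _).add (h4.conj.smul _)

/-- Test functions are complex combinations of real-valued test functions. -/
theorem IsTestFunction.exists_real {O : Set Spacetime} {f : Spacetime → ℂ}
    (hf : IsTestFunction m ω O f) : ∃ f₁ f₂, IsRealTestFunction m ω O f₁ ∧
      IsRealTestFunction m ω O f₂ ∧ fourierPlus m f = fourierPlus m f₁ + I • fourierPlus m f₂ ∧
      fourierMinus m f = fourierMinus m f₁ + I • fourierMinus m f₂ := by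
  -- The two combinations are the real and imaginary parts of f.
  have h1 := hf.linearCombination (1 / 2) (1 / 2)
  have h2 := hf.linearCombination (-I / 2) (I / 2)
  set f₁ : Spacetime → ℂ := fun x => 1 / 2 * f x + 1 / 2 * (starRingEnd ℂ) (f x)
  set f₂ : Spacetime → ℂ := fun x => -I / 2 * f x + I / 2 * (starRingEnd ℂ) (f x)
  have e : f = fun x => f₁ x + I * f₂ x := by
    funext x
    simp only [f₁, f₂]
    linear_combination (-(f x) / 2 + (starRingEnd ℂ) (f x) / 2) * (-I_mul_I)
  have r1 : ∀ x, (f₁ x).im = 0 := fun x => by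
    rw [← conj_eq_iff_im]
    simp only [f₁, map_add, map_mul, map_div₀, map_one, map_ofNat, conj_conj]
    ring
  have r2 : ∀ x, (f₂ x).im = 0 := fun x => by
    rw [← conj_eq_iff_im]
    simp only [f₂, map_add, map_mul, map_div₀, map_neg, map_ofNat, conj_conj, conj_I]
    ring
  have hs : HasCompactSupport fun x => I * f₂ x := h2.2.1.mul_left
  have hc : Continuous fun x => I * f₂ x := continuous_const.mul h2.1.continuous
  refine ⟨f₁, f₂, ⟨h1, r1⟩, ⟨h2, r2⟩, ?_, ?_⟩
  · conv_lhs => rw [e]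
    rw [fourierPlus_add h1.1.continuous h1.2.1 hc hs, fourierPlus_smul]
  · conv_lhs => rw [e]
    rw [fourierMinus_add h1.1.continuous h1.2.1 hc hs, fourierMinus_smul]

theorem momentumDot_add (m θ : ℝ) (x y : Spacetime) :
    momentumDot m θ (x + y) = momentumDot m θ x + momentumDot m θ y := by
  simp only [momentumDot, Prod.fst_add, Prod.snd_add]
  ring

/-- The phase `exp(i p(θ)·x)` of one particle. -/
def onePhase (m : ℝ) (x : Spacetime) (θ : ℝ) : ℂ := exp (I * (momentumDot m θ x : ℝ))

theorem norm_onePhase (m : ℝ) (x : Spacetime) (θ : ℝ) : ‖onePhase m x θ‖ = 1 := by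
  rw [onePhase, mul_comm]
  exact norm_exp_ofReal_mul_I _

theorem continuous_onePhase (m : ℝ) (x : Spacetime) : Continuous (onePhase m x) := by
  unfold onePhase momentumDot
  have := Real.continuous_cosh
  have := Real.continuous_sinh
  fun_prop

theorem conj_onePhase (m : ℝ) (x : Spacetime) (θ : ℝ) :
    (starRingEnd ℂ) (onePhase m x θ) = exp (-I * (momentumDot m θ x : ℝ)) := by
  rw [onePhase, ← exp_conj, map_mul, conj_I, conj_ofReal]

theorem fourierPlus_translate (f : Spacetime → ℂ) (x : Spacetime) :
    fourierPlus m (fun y => f (y - x)) = fun θ => onePhase m x θ * fourierPlus m f θ := by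
  funext θ
  simp only [fourierPlus, onePhase]
  rw [← integral_add_right_eq_self _ x]
  simp only [add_sub_cancel_right, momentumDot_add, ofReal_add, mul_add, exp_add]
  have : (fun y : Spacetime => f y * (exp (I * (momentumDot m θ y : ℝ))
      * exp (I * (momentumDot m θ x : ℝ)))) = fun y => exp (I * (momentumDot m θ x : ℝ))
      * (f y * exp (I * (momentumDot m θ y : ℝ))) := by
    funext y; ring
  rw [this, integral_const_mul]
  ring

theorem fourierMinus_translate (f : Spacetime → ℂ) (x : Spacetime) :
    fourierMinus m (fun y => f (y - x))
      = fun θ => (starRingEnd ℂ) (onePhase m x θ) * fourierMinus m f θ := by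
  funext θ
  rw [conj_onePhase]
  simp only [fourierMinus]
  rw [← integral_add_right_eq_self _ x]
  simp only [add_sub_cancel_right, momentumDot_add, ofReal_add, mul_add, exp_add]
  have : (fun y : Spacetime => f y * (exp (-I * (momentumDot m θ y : ℝ))
      * exp (-I * (momentumDot m θ x : ℝ)))) = fun y => exp (-I * (momentumDot m θ x : ℝ))
      * (f y * exp (-I * (momentumDot m θ y : ℝ))) := by
    funext y; ring
  rw [this, integral_const_mul]
  ring

theorem IsRealTestFunction.translate {a : Spacetime} {f : Spacetime → ℂ}
    (hf : IsRealTestFunction m ω (leftWedge a) f) (x : Spacetime) :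
    IsRealTestFunction m ω (leftWedge (a + x)) fun y => f (y - x) := by
  obtain ⟨hf, him⟩ := hf
  rw [isTestFunction_iff] at hf
  obtain ⟨h1, h2, h3, h4, h5⟩ := hf
  refine ⟨isTestFunction_iff.2 ⟨h1.comp (contDiff_id.sub contDiff_const),
    h2.comp_homeomorph (Homeomorph.subRight x), fun y hy => ?_, ?_, ?_⟩, fun y => him _⟩
  · have hy' : y - x ∈ tsupport f :=
      (tsupport_comp_subset_preimage f (continuous_id.sub continuous_const)) hy
    have := h3 hy'
    simp only [leftWedge, Set.mem_ofPred_eq, Prod.fst_sub, Prod.snd_sub, Prod.fst_add,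
      Prod.snd_add] at this ⊢
    rw [show y.1 - (a.1 + x.1) = y.1 - x.1 - a.1 by ring,
      show a.2 + x.2 - y.2 = a.2 - (y.2 - x.2) by ring]
    exact this
  · rw [fourierPlus_translate]
    exact h4.mul (continuous_onePhase m x) (norm_onePhase m x)
  · rw [fourierMinus_translate]
    exact h5.mul (continuous_conj.comp (continuous_onePhase m x))
      fun θ => by rw [RCLike.norm_conj, norm_onePhase]

end TestFunctions

/-! ### Families of fields, their exponentials, and locality in right wedges -/

section Families

variable {S : ScatteringFunction} {m : ℝ} {ω : ℝ → ℝ}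

/-- The restrictions to `ℋ^{ω,f}` of the fields `φ(f)`, `f ∈ 𝒟^ω_ℝ(O)`. -/
def fieldFamily (S : ScatteringFunction) (m : ℝ) (ω : ℝ → ℝ) (O : Set Spacetime) :
    Set (Module.End ℂ (Hωf S ω)) :=
  {Φ | ∃ f, IsRealTestFunction m ω O f ∧ IsFieldEnd (fourierPlus m f) (fourierMinus m f) Φ}

theorem isEntireSymmetric_of_mem_fieldFamily {O : Set Spacetime} {Φ : Module.End ℂ (Hωf S ω)}
    (hΦ : Φ ∈ fieldFamily S m ω O) : IsEntireSymmetric Φ := by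
  obtain ⟨f, hf, hΦ⟩ := hΦ
  exact hΦ.isEntireSymmetric (fourierMinus_of_real hf.2)

theorem IsRealTestFunction.weightedL2 {O : Set Spacetime} {f : Spacetime → ℂ}
    (hf : IsRealTestFunction m ω O f) :
    WeightedL2 ω (fourierPlus m f) ∧ WeightedL2 ω (fourierMinus m f) := by
  have := isTestFunction_iff.1 hf.1
  exact ⟨this.2.2.2.1.2, this.2.2.2.2.2⟩

theorem fieldComponent_smul {g h : ℝ → ℂ} (hg : MemLp g 2 volume) (hh : MemLp h 2 volume) (c : ℂ)
    (ψ : FockSpace S) (n : ℕ) :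
    fieldComponent S (c • g) (c • h) ψ n = c • fieldComponent S g h ψ n := by
  obtain _ | n := n
  · simp only [fieldComponent, annihilationN_smul S hh]
    rfl
  · simp only [fieldComponent, annihilationN_smul S hh, creationN_smul S hg]
    exact (smul_add c _ _).symm

theorem fieldComponent_add {g h g' h' : ℝ → ℂ} (hg : MemLp g 2 volume) (hh : MemLp h 2 volume)
    (hg' : MemLp g' 2 volume) (hh' : MemLp h' 2 volume) (ψ : FockSpace S) (n : ℕ) :
    fieldComponent S (g + g') (h + h') ψ n
      = fieldComponent S g h ψ n + fieldComponent S g' h' ψ n := by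
  obtain _ | n := n
  · simp only [fieldComponent, annihilationN_add S hh hh']
    rfl
  · simp only [fieldComponent, annihilationN_add S hh hh', creationN_add S hg hg']
    exact add_add_add_comm _ _ _ _

/-- Real scaling puts the whole group exp(itΦ) into the set of exponentials, and t = -1 makes this
set closed under adjoints. -/
theorem smul_mem_fieldFamily (hω : IsIndicatrix ω) {O : Set Spacetime}
    {Φ : Module.End ℂ (Hωf S ω)} (hΦ : Φ ∈ fieldFamily S m ω O) (t : ℝ) :
    (t : ℂ) • Φ ∈ fieldFamily S m ω O := by
  obtain ⟨f, hf, hΦ⟩ := hΦ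
  refine ⟨_, hf.smul t, fun ψ n => ?_⟩
  rw [fourierPlus_smul, fourierMinus_smul, fieldComponent_smul (hf.weightedL2.1.memLp hω)
    (hf.weightedL2.2.memLp hω), ← hΦ]
  rfl

theorem expSet_fieldFamily (hω : IsIndicatrix ω) (O : Set Spacetime) :
    {B | ∃ f, IsRealTestFunction m ω O f ∧ IsExpI (field S m f).closure B}
      = expSet (fieldFamily S m ω O) := by
  ext B
  constructor
  · rintro ⟨f, hf, hB⟩
    obtain ⟨Φ, hΦ⟩ := exists_isFieldEnd (S := S) hω hf.weightedL2.1 (fourierMinus m f)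
    exact ⟨Φ, ⟨f, hf, hΦ⟩,
      (isExpI_creationAnnihilation_iff hω (fourierMinus_of_real hf.2) hΦ B).1 hB⟩
  · rintro ⟨Φ, ⟨f, hf, hΦ⟩, hB⟩
    exact ⟨f, hf, (isExpI_creationAnnihilation_iff hω (fourierMinus_of_real hf.2) hΦ B).2 hB⟩

/-- Complex test functions reduce to real ones: φ(f) = Φ₁ + iΦ₂ on ℋ^{ω,f}, where φ(f)* acts as Φ₁ -
iΦ₂. Antilinearity of A in its first argument turns -i back into i. -/
theorem isLocalRight_iff (hω : IsIndicatrix ω) (x : Spacetime) (A : QForm S ω) :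
    IsLocalRight m x A ↔
      ∀ Φ ∈ fieldFamily S m ω (leftWedge x), ∀ ψ χ, A (Φ ψ) χ = A ψ (Φ χ) := by
  constructor
  · rintro h Φ ⟨f, hf, hΦ⟩ ψ χ
    have hg := isFieldEnd_iff.1 hΦ
    refine h f hf.1 ψ (Φ ψ) χ (Φ χ) ?_ (hg χ)
    exact LinearPMap.le_graph_of_le
      (creationAnnihilation_le_adjoint hω (fourierMinus_of_real hf.2)) (hg ψ)
  · intro h f hf ψ ψ' χ χ' hψ hχ
    obtain ⟨f₁, f₂, h₁, h₂, eplus, eminus⟩ := hf.exists_real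
    obtain ⟨Φ₁, hΦ₁⟩ := exists_isFieldEnd (S := S) hω h₁.weightedL2.1 (fourierMinus m f₁)
    obtain ⟨Φ₂, hΦ₂⟩ := exists_isFieldEnd (S := S) hω h₂.weightedL2.1 (fourierMinus m f₂)
    have p₁ := h₁.weightedL2.1.memLp hω
    have q₁ := h₁.weightedL2.2.memLp hω
    have p₂ := h₂.weightedL2.1.memLp hω
    have q₂ := h₂.weightedL2.2.memLp hω
    have hΦ : IsFieldEnd (fourierPlus m f) (fourierMinus m f) (Φ₁ + I • Φ₂) := by
      intro ψ n
      rw [eplus, eminus, fieldComponent_add p₁ q₁ (p₂.const_smul I) (q₂.const_smul I),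
        fieldComponent_smul p₂ q₂, ← hΦ₁, ← hΦ₂]
      rfl
    have hg := isFieldEnd_iff.1 hΦ
    have eχ : χ' = Φ₁ χ + I • Φ₂ χ :=
      Subtype.ext (LinearPMap.mem_graph_snd_inj _ hχ (hg χ) rfl)
    have s₁ := (isEntireSymmetric_of_mem_fieldFamily ⟨f₁, h₁, hΦ₁⟩).symm
    have s₂ := (isEntireSymmetric_of_mem_fieldFamily ⟨f₂, h₂, hΦ₂⟩).symm
    -- The adjoint is identified by testing against the dense subspace ℋ^{ω,f}, on which Φ₁ and Φ₂
    -- are symmetric.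
    have eψ : ψ' = Φ₁ ψ - I • Φ₂ ψ := by
      refine Subtype.ext ((dense_Hωf hω).eq_of_inner_left ℂ fun η hη => ?_)
      have hψd := LinearPMap.mem_domain_of_mem_graph hψ
      have e1 : (ψ' : FockSpace S) = (field S m f).adjoint ⟨ψ, hψd⟩ :=
        LinearPMap.mem_graph_snd_inj _ hψ (LinearPMap.mem_graph _ ⟨(ψ : FockSpace S), hψd⟩) rfl
      have e2 := inner_adjoint_of_graph (dense_domain_creationAnnihilation hω _ _) hψd
        (hg ⟨η, hη⟩)
      rw [e1]
      refine e2.trans ?_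
      rw [LinearMap.add_apply, LinearMap.smul_apply, Submodule.coe_add, Submodule.coe_smul,
        Submodule.coe_sub, Submodule.coe_smul, inner_add_right, inner_sub_left, inner_smul_left,
        inner_smul_right, conj_I, ← s₁, ← s₂]
      ring
    rw [eχ, eψ, map_add, map_smul, map_sub, LinearMap.map_smulₛₗ, LinearMap.sub_apply,
      LinearMap.smul_apply, h Φ₁ ⟨f₁, h₁, hΦ₁⟩, h Φ₂ ⟨f₂, h₂, hΦ₂⟩, conj_I, smul_eq_mul,
      smul_eq_mul]
    ring

theorem conj_image_centralizer {M : Type*} [Monoid M] {u v : M} (huv : u * v = 1)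
    (hvu : v * u = 1) {E E' : Set M} (h : ∀ c ∈ E, u * c * v ∈ E') (h' : ∀ c ∈ E', v * c * u ∈ E) :
    (fun b => u * b * v) '' E.centralizer = E'.centralizer := by
  ext a
  constructor
  · rintro ⟨b, hb, rfl⟩ c hc
    have h1 := hb _ (h' c hc)
    calc c * (u * b * v) = u * v * c * u * b * v := by rw [huv, one_mul]; simp only [mul_assoc]
      _ = u * (v * c * u * b) * v := by simp only [mul_assoc]
      _ = u * (b * (v * c * u)) * v := by rw [h1]
      _ = u * b * v * c * (u * v) := by simp only [mul_assoc]
      _ = _ := by rw [huv, mul_one]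
  · intro ha
    refine ⟨v * a * u, fun c hc => ?_, ?_⟩
    · have h1 := ha _ (h c hc)
      calc c * (v * a * u) = v * u * c * v * a * u := by rw [hvu, one_mul]; simp only [mul_assoc]
        _ = v * (u * c * v * a) * u := by simp only [mul_assoc]
        _ = v * (a * (u * c * v)) * u := by rw [h1]
        _ = v * a * u * c * (v * u) := by simp only [mul_assoc]
        _ = _ := by rw [hvu, mul_one]
    · calc u * (v * a * u) * v = u * v * a * (u * v) := by simp only [mul_assoc]
        _ = a := by rw [huv, one_mul, mul_one]

end Families

/-! ### Translation covariance -/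

section Translations

variable {S : ScatteringFunction} {m : ℝ} {ω : ℝ → ℝ}

/-- The phase `exp(i p·x)` as a multiplier. -/
def phaseMultiplier (m : ℝ) (x : Spacetime) (n : ℕ) : Multiplier n where
  toFun := phase m x
  measurable := (continuous_phase m x n).measurable
  norm_le θ := (norm_phase m x θ).le

theorem phaseMultiplier_comp (m : ℝ) (x : Spacetime) {n : ℕ} (θ : Fin n → ℝ)
    (e : Equiv.Perm (Fin n)) :
    (phaseMultiplier m x n).toFun (θ ∘ e) = (phaseMultiplier m x n).toFun θ := by
  change phase m x (θ ∘ e) = phase m x θ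
  unfold phase
  simp only [Function.comp_apply]
  rw [Equiv.sum_comp e fun k => momentumDot m (θ k) x]

theorem coe_translationN (x : Spacetime) (n : ℕ) (ψ : particleSpace S n) :
    ((translationN S m x n ψ : particleSpace S n) : L2 n)
      = mulOp (phaseMultiplier m x n) (ψ : L2 n) := rfl

theorem translation_apply (x : Spacetime) (ψ : FockSpace S) (n : ℕ) :
    translation S m x ψ n = translationN S m x n (ψ n) := rfl

theorem phase_neg_mul (m : ℝ) (x : Spacetime) {n : ℕ} (θ : Fin n → ℝ) :
    phase m (-x) θ * phase m x θ = 1 := by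
  have e : ∑ k, momentumDot m (θ k) (-x) = -∑ k, momentumDot m (θ k) x := by
    rw [← Finset.sum_neg_distrib]
    refine Finset.sum_congr rfl fun k _ => ?_
    simp only [momentumDot, Prod.fst_neg, Prod.snd_neg]
    ring
  rw [phase, phase, e, ← exp_add]
  simp

theorem translationN_neg_apply (x : Spacetime) (n : ℕ) (ψ : particleSpace S n) :
    translationN S m (-x) n (translationN S m x n ψ) = ψ := by
  apply Subtype.ext
  rw [coe_translationN, coe_translationN]
  refine Lp.ext ?_
  filter_upwards [coeFn_mulOp (phaseMultiplier m (-x) n)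
    (mulOp (phaseMultiplier m x n) (ψ : L2 n)),
    coeFn_mulOp (phaseMultiplier m x n) (ψ : L2 n)] with θ h1 h2
  rw [h1, h2, ← mul_assoc]
  change phase m (-x) θ * phase m x θ * _ = _
  rw [phase_neg_mul, one_mul]

theorem translation_neg_mul (x : Spacetime) :
    translation S m (-x) * translation S m x = 1 := by
  refine ContinuousLinearMap.ext fun ψ => ?_
  ext1; funext n
  exact translationN_neg_apply x n (ψ n)

theorem translation_mul_neg (x : Spacetime) :
    translation S m x * translation S m (-x) = 1 := by
  have := translation_neg_mul (S := S) (m := m) (-x)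
  rwa [neg_neg] at this

theorem adjoint_translation (x : Spacetime) :
    ContinuousLinearMap.adjoint (translation S m x) = translation S m (-x) := by
  symm
  rw [ContinuousLinearMap.eq_adjoint_iff]
  intro ψ χ
  have h := (fockMap (translationN S m x)).inner_map_map (translation S m (-x) ψ) χ
  have e : fockMap (translationN S m x) (translation S m (-x) ψ) = ψ :=
    DFunLike.congr_fun (translation_mul_neg (S := S) (m := m) x) ψ
  rw [e] at h
  exact h.symm

theorem translation_mem (hω : IsIndicatrix ω) (x : Spacetime) {ψ : FockSpace S}
    (hψ : ψ ∈ Hωf S ω) : translation S m x ψ ∈ Hωf S ω := by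
  rw [mem_Hωf_iff] at hψ ⊢
  obtain ⟨⟨N, hN⟩, h⟩ := hψ
  refine ⟨⟨N, fun n hn => ?_⟩, fun n => ?_⟩
  · rw [translation_apply, hN n hn, map_zero]
  · rw [translation_apply, coe_translationN]
    have h1 := h n
    rw [hasWeight_iff hω] at h1 ⊢
    obtain ⟨ξ, hξ⟩ := h1
    refine ⟨mulOp (phaseMultiplier m x n) ξ, ?_⟩
    rw [hξ]
    refine Lp.ext ?_
    filter_upwards [coeFn_mulOp (phaseMultiplier m x n) (mulOp (weight hω n) ξ),
      coeFn_mulOp (weight hω n) ξ, coeFn_mulOp (weight hω n) (mulOp (phaseMultiplier m x n) ξ),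
      coeFn_mulOp (phaseMultiplier m x n) ξ] with θ h1 h2 h3 h4
    rw [h1, h2, h3, h4]
    ring

/-- The total phase is a product of one-particle phases, and being permutation-invariant it commutes
with the projection onto S-symmetric functions. -/
theorem creationN_translation {g : ℝ → ℂ} (hg : MemLp g 2 volume) (x : Spacetime) (n : ℕ)
    (ψ : particleSpace S n) :
    creationN S (fun θ => onePhase m x θ * g θ) n (translationN S m x n ψ)
      = translationN S m x (n + 1) (creationN S g n ψ) := by
  apply Subtype.ext
  rw [coe_translationN, coe_creationN, coe_creationN, map_smul,
    ← starProjection_mulOp S _ (phaseMultiplier_comp m x)]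
  congr 2
  have hg' : MemLp (fun θ => onePhase m x θ * g θ) 2 volume := by
    refine hg.of_le ((continuous_onePhase m x).aestronglyMeasurable.mul hg.1)
      (Eventually.of_forall fun θ => ?_)
    rw [norm_mul, norm_onePhase, one_mul]
  refine Lp.ext ?_
  filter_upwards [coeFn_tensorLeft (toL2 fun θ => onePhase m x θ * g θ) n
      (translationN S m x n ψ : particleSpace S n),
    coeFn_mulOp (phaseMultiplier m x (n + 1)) (tensorLeft (toL2 g) n ψ),
    coeFn_tensorLeft (toL2 g) n (ψ : L2 n),
    (quasiMeasurePreserving_head n).ae (coeFn_toL2 hg'),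
    (quasiMeasurePreserving_head n).ae (coeFn_toL2 hg),
    (quasiMeasurePreserving_tail n).ae (coeFn_mulOp (phaseMultiplier m x n) (ψ : L2 n))]
    with θ h1 h2 h3 h4 h5 h6
  rw [h1, h2, h3, h4, h5, coe_translationN, h6]
  have e : phase m x θ = onePhase m x (θ 0) * phase m x (Fin.tail θ) := by
    rw [phase, phase, onePhase, ← exp_add, ← mul_add, ← ofReal_add, Fin.sum_univ_succ]
    rfl
  change _ * (phase m x (Fin.tail θ) * _) = phase m x θ * _
  rw [e]
  ring

theorem annihilationN_translation {g : ℝ → ℂ} (hg : MemLp g 2 volume) (x : Spacetime) (n : ℕ)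
    (ψ : particleSpace S (n + 1)) :
    annihilationN S (fun θ => (starRingEnd ℂ) (onePhase m x θ) * g θ) n
      (translationN S m x (n + 1) ψ) = translationN S m x n (annihilationN S g n ψ) := by
  have e : (fun θ => (starRingEnd ℂ) ((starRingEnd ℂ) (onePhase m x θ) * g θ))
      = fun θ => onePhase m x θ * (starRingEnd ℂ) (g θ) := by
    funext θ
    rw [map_mul, conj_conj]
  have hg' : MemLp (fun θ => (starRingEnd ℂ) (g θ)) 2 volume := hg.star
  refine ext_inner_left ℂ fun χ => ?_
  have hχ : χ = translationN S m x n (translationN S m (-x) n χ) := by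
    have := translationN_neg_apply (m := m) (-x) n χ
    rw [neg_neg] at this
    exact this.symm
  rw [annihilationN, e, ContinuousLinearMap.adjoint_inner_right, hχ, creationN_translation hg',
    LinearIsometry.inner_map_map, LinearIsometry.inner_map_map, annihilationN,
    ContinuousLinearMap.adjoint_inner_right]

theorem fieldComponent_translation {g h : ℝ → ℂ} (hg : MemLp g 2 volume) (hh : MemLp h 2 volume)
    (x : Spacetime) (ψ : FockSpace S) (n : ℕ) :
    fieldComponent S (fun θ => onePhase m x θ * g θ)
      (fun θ => (starRingEnd ℂ) (onePhase m x θ) * h θ) (translation S m x ψ) n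
      = translationN S m x n (fieldComponent S g h ψ n) := by
  obtain _ | n := n
  · exact annihilationN_translation hh x 0 (ψ 1)
  · change creationN S _ n (translationN S m x n (ψ n))
      + annihilationN S _ (n + 1) (translationN S m x (n + 2) (ψ (n + 2))) = _
    rw [creationN_translation hg, annihilationN_translation hh]
    exact (map_add (translationN S m x (n + 1)) _ _).symm

/-- U(x) intertwines φ(f) with φ(f(· - x)) on ℋ^{ω,f}, hence also their powers and exponential
series; the support moves from W'_a to W'_{a+x}. -/
theorem translation_conj_mem_expSet (hω : IsIndicatrix ω) {a x : Spacetime}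
    {B : FockSpace S →L[ℂ] FockSpace S} (hB : B ∈ expSet (fieldFamily S m ω (leftWedge a))) :
    translation S m x * B * translation S m (-x)
      ∈ expSet (fieldFamily S m ω (leftWedge (a + x))) := by
  obtain ⟨Φ, ⟨f, hf, hΦ⟩, hB⟩ := hB
  have hf' := hf.translate x
  obtain ⟨Ψ, hΨ⟩ := exists_isFieldEnd (S := S) hω hf'.weightedL2.1
    (fourierMinus m fun y => f (y - x))
  refine ⟨Ψ, ⟨_, hf', hΨ⟩, fun ψ => ?_⟩
  have hint : ∀ χ : Hωf S ω, Ψ ⟨translation S m x χ, translation_mem hω x χ.2⟩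
      = ⟨translation S m x (Φ χ), translation_mem hω x (Φ χ).2⟩ := by
    intro χ
    apply Subtype.ext
    ext1; funext n
    rw [hΨ, fourierPlus_translate, fourierMinus_translate, fieldComponent_translation
      (hf.weightedL2.1.memLp hω) (hf.weightedL2.2.memLp hω), translation_apply, hΦ]
  have hpow : ∀ (k : ℕ) (χ : Hωf S ω), (Ψ ^ k) ⟨translation S m x χ, translation_mem hω x χ.2⟩
      = ⟨translation S m x ((Φ ^ k) χ), translation_mem hω x ((Φ ^ k) χ).2⟩ := by
    intro k
    induction k with
    | zero => intro χ; simp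
    | succ k ih =>
      intro χ
      have e1 : ∀ (T : Module.End ℂ (Hωf S ω)) (η), (T ^ (k + 1)) η = (T ^ k) (T η) := by
        intro T η; rw [pow_succ]; rfl
      rw [e1, hint, ih]
      simp only [e1]
  let χ : Hωf S ω := ⟨translation S m (-x) ψ, translation_mem hω (-x) ψ.2⟩
  have hψ : ψ = ⟨translation S m x χ, translation_mem hω x χ.2⟩ :=
    Subtype.ext (DFunLike.congr_fun (translation_mul_neg (S := S) (m := m) x)
      (ψ : FockSpace S)).symm
  have hs := (hB χ).mapL (translation S m x)
  change HasSum _ (translation S m x (B χ))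
  convert hs using 1
  funext k
  rw [hψ, expTerm, hpow, expTerm, map_smul]

theorem rightWedgeAlgebra_eq (hω : IsIndicatrix ω) (x : Spacetime) :
    rightWedgeAlgebra S m ω x = (expSet (fieldFamily S m ω (leftWedge x))).centralizer := by
  have h := conj_image_centralizer (translation_mul_neg (S := S) (m := m) x)
    (translation_neg_mul x) (E := expSet (fieldFamily S m ω (leftWedge 0)))
    (E' := expSet (fieldFamily S m ω (leftWedge x)))
    (fun c hc => by
      have := translation_conj_mem_expSet hω (x := x) hc
      rwa [zero_add] at this)
    (fun c hc => by
      have := translation_conj_mem_expSet hω (x := -x) hc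
      rwa [add_neg_cancel, neg_neg] at this)
  rw [← h, rightWedgeAlgebra, wedgeAlgebra, expSet_fieldFamily hω, adjoint_translation]
  rfl

end Translations

/-! ### The antiunitary reflection and left wedges -/

section Reflection

variable {S : ScatteringFunction} {m : ℝ} {ω : ℝ → ℝ}

theorem reflectionN_reflectionN (n : ℕ) (ψ : particleSpace S n) :
    reflectionN S n (reflectionN S n ψ) = ψ := by
  apply Subtype.ext
  refine Lp.ext ?_
  have h1 : ∀ χ : particleSpace S n, ((reflectionN S n χ : particleSpace S n) : L2 n)
      =ᵐ[volume] fun θ => (starRingEnd ℂ) ((χ : L2 n) (θ ∘ Fin.revPerm)) :=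
    fun χ => (memLp_reflect (χ : L2 n)).coeFn_toLp
  filter_upwards [h1 (reflectionN S n ψ),
    (measurePreserving_comp (n := n) Fin.revPerm).quasiMeasurePreserving.ae (h1 ψ)] with θ h2 h3
  rw [h2, h3, conj_conj]
  congr 1
  funext k
  simp

theorem reflection_reflection (ψ : FockSpace S) : reflection S (reflection S ψ) = ψ := by
  ext1; funext n
  exact reflectionN_reflectionN n (ψ n)

theorem inner_reflection_self (ψ : FockSpace S) :
    ⟪reflection S ψ, reflection S ψ⟫_ℂ = ⟪ψ, ψ⟫_ℂ := by
  rw [inner_self_eq_norm_sq_to_K, inner_self_eq_norm_sq_to_K]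
  congr 2
  exact (fockMap (reflectionN S)).norm_map ψ

/-- Polarization of the norm identity: ψ + χ gives the sum with the exchanged product, ψ + iχ the
difference, with a sign from antilinearity. -/
theorem inner_reflection (ψ χ : FockSpace S) :
    ⟪reflection S ψ, reflection S χ⟫_ℂ = ⟪χ, ψ⟫_ℂ := by
  have h1 := inner_reflection_self (ψ + χ)
  have h2 := inner_reflection_self (ψ + I • χ)
  simp only [map_add, ContinuousLinearMap.map_smulₛₗ, inner_add_left, inner_add_right,
    inner_smul_left, inner_smul_right, inner_reflection_self, conj_I, map_neg] at h1 h2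
  have h1' : ⟪reflection S ψ, reflection S χ⟫_ℂ + ⟪reflection S χ, reflection S ψ⟫_ℂ
      = ⟪ψ, χ⟫_ℂ + ⟪χ, ψ⟫_ℂ := by linear_combination h1
  have h2' : ⟪reflection S ψ, reflection S χ⟫_ℂ - ⟪reflection S χ, reflection S ψ⟫_ℂ
      = -(⟪ψ, χ⟫_ℂ - ⟪χ, ψ⟫_ℂ) := by
    refine mul_left_cancel₀ I_ne_zero ?_
    linear_combination -h2
  linear_combination (h1' + h2') / 2

theorem norm_reflection (ψ : FockSpace S) : ‖reflection S ψ‖ = ‖ψ‖ :=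
  (fockMap (reflectionN S)).norm_map ψ

theorem reflectionω_reflectionω (ψ : Hωf S ω) : reflectionω S ω (reflectionω S ω ψ) = ψ :=
  Subtype.ext (reflection_reflection (ψ : FockSpace S))

/-- The operator `U(j) Φ U(j)`. -/
def reflectEnd (Φ : Module.End ℂ (Hωf S ω)) : Module.End ℂ (Hωf S ω) :=
  (reflectionω S ω).comp (Φ.comp (reflectionω S ω))

theorem reflectEnd_apply (Φ : Module.End ℂ (Hωf S ω)) (ψ : Hωf S ω) :
    reflectEnd Φ ψ = reflectionω S ω (Φ (reflectionω S ω ψ)) := rfl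

theorem reflectEnd_reflectEnd (Φ : Module.End ℂ (Hωf S ω)) : reflectEnd (reflectEnd Φ) = Φ := by
  refine LinearMap.ext fun ψ => ?_
  rw [reflectEnd_apply, reflectEnd_apply, reflectionω_reflectionω, reflectionω_reflectionω]

theorem reflectEnd_pow (Φ : Module.End ℂ (Hωf S ω)) (k : ℕ) (ψ : Hωf S ω) :
    (reflectEnd Φ ^ k) ψ = reflectionω S ω ((Φ ^ k) (reflectionω S ω ψ)) := by
  induction k generalizing ψ with
  | zero => simp [reflectionω_reflectionω]
  | succ k ih =>
    have e1 : ∀ (T : Module.End ℂ (Hωf S ω)) (η), (T ^ (k + 1)) η = (T ^ k) (T η) := by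
      intro T η; rw [pow_succ]; rfl
    rw [e1, e1, ih, reflectEnd_apply, reflectionω_reflectionω]

theorem reflectEnd_smul (Φ : Module.End ℂ (Hωf S ω)) (t : ℝ) :
    reflectEnd ((t : ℂ) • Φ) = (t : ℂ) • reflectEnd Φ := by
  refine LinearMap.ext fun ψ => ?_
  rw [reflectEnd_apply, LinearMap.smul_apply, LinearMap.map_smulₛₗ, conj_ofReal,
    LinearMap.smul_apply, reflectEnd_apply]

theorem IsEntireSymmetric.reflectEnd {Φ : Module.End ℂ (Hωf S ω)} (h : IsEntireSymmetric Φ) :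
    IsEntireSymmetric (reflectEnd Φ) where
  symm ψ χ := by
    obtain ⟨ψ, rfl⟩ : ∃ η, reflectionω S ω η = ψ := ⟨_, reflectionω_reflectionω ψ⟩
    obtain ⟨χ, rfl⟩ : ∃ η, reflectionω S ω η = χ := ⟨_, reflectionω_reflectionω χ⟩
    rw [reflectEnd_apply, reflectEnd_apply, reflectionω_reflectionω, reflectionω_reflectionω]
    have h1 := inner_reflection (Φ ψ : FockSpace S) (χ : FockSpace S)
    have h2 := inner_reflection (ψ : FockSpace S) (Φ χ : FockSpace S)
    exact h1.trans ((h.symm χ ψ).symm.trans h2.symm)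
  summable t ψ := by
    have := h.summable t (reflectionω S ω ψ)
    refine this.congr fun k => ?_
    rw [reflectEnd_pow]
    congr 1
    exact (norm_reflection _).symm

/-- The operator `U(j) B U(j)`. -/
def reflectOp (B : FockSpace S →L[ℂ] FockSpace S) : FockSpace S →L[ℂ] FockSpace S :=
  (reflection S).comp (B.comp (reflection S))

theorem reflectOp_apply (B : FockSpace S →L[ℂ] FockSpace S) (ψ : FockSpace S) :
    reflectOp B ψ = reflection S (B (reflection S ψ)) := rfl

theorem reflectOp_reflectOp (B : FockSpace S →L[ℂ] FockSpace S) : reflectOp (reflectOp B) = B := by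
  refine ContinuousLinearMap.ext fun ψ => ?_
  rw [reflectOp_apply, reflectOp_apply, reflection_reflection, reflection_reflection]

theorem reflectOp_mul (B C : FockSpace S →L[ℂ] FockSpace S) :
    reflectOp (B * C) = reflectOp B * reflectOp C := by
  refine ContinuousLinearMap.ext fun ψ => ?_
  change _ = reflectOp B (reflectOp C ψ)
  rw [reflectOp_apply, reflectOp_apply, reflectOp_apply, reflection_reflection]
  rfl

/-- An antilinear conjugation turns i into -i, so exp(iΦ) goes to exp(-iU(j)ΦU(j)). The sign is
absorbed by the stability of the family under real multiples. -/
theorem IsExp.reflectOp {Φ : Module.End ℂ (Hωf S ω)} {B : FockSpace S →L[ℂ] FockSpace S}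
    (hB : IsExp Φ B) : IsExp (((-1 : ℝ) : ℂ) • reflectEnd Φ) (reflectOp B) := by
  intro ψ
  have h1 := (hB (reflectionω S ω ψ)).map (reflection S).toLinearMap.toAddMonoidHom
    (reflection S).continuous
  convert h1 using 1
  swap; · rfl
  funext k
  change _ = reflection S (expTerm Φ 1 (reflectionω S ω ψ) k)
  rw [expTerm_smul, expTerm, expTerm, reflectEnd_pow, ContinuousLinearMap.map_smulₛₗ]
  refine congrArg₂ (· • ·) ?_ rfl
  simp

/-- The restrictions to `ℋ^{ω,f}` of the reflected fields `U(j) φ(f) U(j)`, `f ∈ 𝒟^ω_ℝ(O)`. -/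
def reflectedFamily (S : ScatteringFunction) (m : ℝ) (ω : ℝ → ℝ) (O : Set Spacetime) :
    Set (Module.End ℂ (Hωf S ω)) := reflectEnd '' fieldFamily S m ω O

theorem reflectOp_image_expSet (hω : IsIndicatrix ω) (O : Set Spacetime) :
    reflectOp '' expSet (fieldFamily S m ω O) = expSet (reflectedFamily S m ω O) := by
  ext B
  constructor
  · rintro ⟨B, ⟨Φ, hΦ, hB⟩, rfl⟩
    refine ⟨_, ⟨_, smul_mem_fieldFamily hω hΦ (-1), rfl⟩, ?_⟩
    rw [reflectEnd_smul]
    exact hB.reflectOp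
  · rintro ⟨_, ⟨Φ, hΦ, rfl⟩, hB⟩
    refine ⟨reflectOp B, ⟨_, smul_mem_fieldFamily hω hΦ (-1), ?_⟩, reflectOp_reflectOp B⟩
    have := hB.reflectOp
    rwa [reflectEnd_reflectEnd] at this

theorem leftWedgeAlgebra_eq (hω : IsIndicatrix ω) (y : Spacetime) :
    leftWedgeAlgebra S m ω y = (expSet (reflectedFamily S m ω (leftWedge (-y)))).centralizer := by
  rw [leftWedgeAlgebra, rightWedgeAlgebra_eq hω, ← reflectOp_image_expSet hω]
  change reflectOp '' _ = _
  ext A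
  constructor
  · rintro ⟨A, hA, rfl⟩ _ ⟨C, hC, rfl⟩
    rw [← reflectOp_mul, ← reflectOp_mul, hA C hC]
  · intro hA
    refine ⟨reflectOp A, fun C hC => ?_, reflectOp_reflectOp A⟩
    have h1 := congrArg reflectOp (hA _ ⟨C, hC, rfl⟩)
    simpa only [reflectOp_mul, reflectOp_reflectOp] using h1

/-- Passing to the adjoint form and reflecting each conjugate the value; together they only exchange
the arguments and apply U(j) to both. So locality in W'_y is commutation with the reflected fields
U(j)φ(f)U(j), f supported in W'_{-y}. -/
theorem isLocalLeft_iff (hω : IsIndicatrix ω) (y : Spacetime) (A : QForm S ω) :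
    IsLocalLeft m y A ↔
      ∀ Φ ∈ reflectedFamily S m ω (leftWedge (-y)), ∀ ψ χ, A (Φ ψ) χ = A ψ (Φ χ) := by
  have e : ∀ ψ χ, A.adj.reflect ψ χ = A (reflectionω S ω χ) (reflectionω S ω ψ) :=
    fun ψ χ => conj_conj _
  rw [IsLocalLeft, isLocalRight_iff hω]
  constructor
  · rintro h _ ⟨Φ, hΦ, rfl⟩ ψ χ
    have := h Φ hΦ (reflectionω S ω χ) (reflectionω S ω ψ)
    rw [e, e, reflectionω_reflectionω, reflectionω_reflectionω] at this
    exact this.symm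
  · intro h Φ hΦ ψ χ
    have := h _ ⟨Φ, hΦ, rfl⟩ (reflectionω S ω χ) (reflectionω S ω ψ)
    rw [reflectEnd_apply, reflectEnd_apply, reflectionω_reflectionω, reflectionω_reflectionω]
      at this
    rw [e, e]
    exact this.symm

end Reflection

/-! ### The criteria for all regions, and bounded operators -/

section Regions

variable {S : ScatteringFunction} {m : ℝ} {ω : ℝ → ℝ}

/-- The fields whose exponentials generate the commutant of the local algebra of a region. -/
def regionFamily (S : ScatteringFunction) (m : ℝ) (ω : ℝ → ℝ) :
    Region → Set (Module.End ℂ (Hωf S ω))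
  | .right x => fieldFamily S m ω (leftWedge x)
  | .left y => reflectedFamily S m ω (leftWedge (-y))
  | .doubleCone x y => fieldFamily S m ω (leftWedge x) ∪ reflectedFamily S m ω (leftWedge (-y))

theorem expSet_union {H : Type*} [NormedAddCommGroup H] [InnerProductSpace ℂ H]
    {D : Submodule ℂ H} (𝓕 𝓖 : Set (Module.End ℂ D)) :
    expSet (𝓕 ∪ 𝓖) = expSet 𝓕 ∪ expSet 𝓖 := by
  ext B
  constructor
  · rintro ⟨Φ, hΦ | hΦ, hB⟩
    exacts [Or.inl ⟨Φ, hΦ, hB⟩, Or.inr ⟨Φ, hΦ, hB⟩]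
  · rintro (⟨Φ, hΦ, hB⟩ | ⟨Φ, hΦ, hB⟩)
    exacts [⟨Φ, Or.inl hΦ, hB⟩, ⟨Φ, Or.inr hΦ, hB⟩]

theorem isEntireSymmetric_of_mem_regionFamily (R : Region) :
    ∀ Φ ∈ regionFamily S m ω R, IsEntireSymmetric Φ := by
  have h : ∀ O, ∀ Φ ∈ reflectedFamily S m ω O, IsEntireSymmetric Φ := by
    rintro O _ ⟨Φ, hΦ, rfl⟩
    exact (isEntireSymmetric_of_mem_fieldFamily hΦ).reflectEnd
  cases R with
  | right x => exact fun Φ hΦ => isEntireSymmetric_of_mem_fieldFamily hΦ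
  | left y => exact h _
  | doubleCone x y =>
    rintro Φ (hΦ | hΦ)
    exacts [isEntireSymmetric_of_mem_fieldFamily hΦ, h _ Φ hΦ]

theorem smul_mem_regionFamily (hω : IsIndicatrix ω) (R : Region) :
    ∀ Φ ∈ regionFamily S m ω R, ∀ t : ℝ, (t : ℂ) • Φ ∈ regionFamily S m ω R := by
  have h : ∀ O, ∀ Φ ∈ reflectedFamily S m ω O, ∀ t : ℝ,
      (t : ℂ) • Φ ∈ reflectedFamily S m ω O := by
    rintro O _ ⟨Φ, hΦ, rfl⟩ t
    exact ⟨_, smul_mem_fieldFamily hω hΦ t, reflectEnd_smul Φ t⟩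
  cases R with
  | right x => exact fun Φ hΦ t => smul_mem_fieldFamily hω hΦ t
  | left y => exact h _
  | doubleCone x y =>
    rintro Φ (hΦ | hΦ) t
    exacts [Or.inl (smul_mem_fieldFamily hω hΦ t), Or.inr (h _ Φ hΦ t)]

theorem localAlgebra_eq (hω : IsIndicatrix ω) (R : Region) :
    localAlgebra S m ω R = (expSet (regionFamily S m ω R)).centralizer := by
  cases R with
  | right x => exact rightWedgeAlgebra_eq hω x
  | left y => exact leftWedgeAlgebra_eq hω y
  | doubleCone x y =>
    simp only [localAlgebra, regionFamily]
    rw [expSet_union, Set.centralizer_union, rightWedgeAlgebra_eq hω, leftWedgeAlgebra_eq hω]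

theorem isOmegaLocal_iff (hω : IsIndicatrix ω) (R : Region) (A : QForm S ω) :
    IsOmegaLocal m A R ↔ ∀ Φ ∈ regionFamily S m ω R, ∀ ψ χ, A (Φ ψ) χ = A ψ (Φ χ) := by
  cases R with
  | right x => exact isLocalRight_iff hω x A
  | left y => exact isLocalLeft_iff hω y A
  | doubleCone x y =>
    simp only [IsOmegaLocal, regionFamily]
    rw [isLocalRight_iff hω, isLocalLeft_iff hω]
    exact ⟨fun h Φ hΦ => hΦ.elim (h.1 Φ) (h.2 Φ),
      fun h => ⟨fun Φ hΦ => h Φ (Or.inl hΦ), fun Φ hΦ => h Φ (Or.inr hΦ)⟩⟩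

theorem IsRealTestFunction.mono {O O' : Set Spacetime} (hO : O ⊆ O') {f : Spacetime → ℂ}
    (hf : IsRealTestFunction m ω O f) : IsRealTestFunction m ω O' f :=
  ⟨⟨hf.1.1, hf.1.2.1, hf.1.2.2.1.trans hO, hf.1.2.2.2⟩, hf.2⟩

theorem expSet_subset_domain (hω : IsIndicatrix ω) (R : Region)
    {T : FockSpace S →ₗ.[ℂ] FockSpace S} (h : WeylDomainCondition m ω T R) :
    ∀ B ∈ expSet (regionFamily S m ω R), ∀ χ : Hωf S ω, B χ ∈ T.domain := by
  have hr : ∀ O, WeylDomain m ω T → ∀ B ∈ expSet (fieldFamily S m ω O), ∀ χ : Hωf S ω,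
      B χ ∈ T.domain := by
    intro O h B hB χ
    rw [← expSet_fieldFamily hω] at hB
    obtain ⟨f, hf, hB⟩ := hB
    exact h f (hf.mono (Set.subset_univ _)) B hB χ χ.2
  have hl : ∀ O, WeylDomainReflected m ω T → ∀ B ∈ expSet (reflectedFamily S m ω O),
      ∀ χ : Hωf S ω, B χ ∈ T.domain := by
    intro O h B hB χ
    rw [← reflectOp_image_expSet hω, ← expSet_fieldFamily hω] at hB
    obtain ⟨B, ⟨f, hf, hB⟩, rfl⟩ := hB
    exact h f (hf.mono (Set.subset_univ _)) B hB χ χ.2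
  cases R with
  | right x => exact hr _ h
  | left y => exact hl _ h
  | doubleCone x y =>
    intro B hB
    simp only [regionFamily] at hB
    rw [expSet_union] at hB
    exact hB.elim (hr _ h.1 B) (hl _ h.2 B)

theorem IsOmegaClosure.isOmegaLocal (hω : IsIndicatrix ω) {R : Region} {A : QForm S ω}
    {T : FockSpace S →ₗ.[ℂ] FockSpace S} (h : IsOmegaClosure A T)
    (hT : IsAffiliated T (localAlgebra S m ω R)) : IsOmegaLocal m A R := by
  rw [isOmegaLocal_iff hω]
  rw [localAlgebra_eq hω] at hT
  exact fun Φ hΦ ψ χ => form_comm_of_isAffiliated (dense_Hωf hω)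
    (isEntireSymmetric_of_mem_regionFamily R) (smul_mem_regionFamily hω R) h.core.le_domain
    h.le_adjoint h.eq_form hT hΦ ψ χ

theorem IsOmegaClosure.isAffiliated (hω : IsIndicatrix ω) {R : Region} {A : QForm S ω}
    {T : FockSpace S →ₗ.[ℂ] FockSpace S} (h : IsOmegaClosure A T)
    (hdom : ∀ B ∈ expSet (regionFamily S m ω R), ∀ χ : Hωf S ω, B χ ∈ T.domain)
    (hA : IsOmegaLocal m A R) : IsAffiliated T (localAlgebra S m ω R) := by
  rw [isOmegaLocal_iff hω] at hA
  rw [localAlgebra_eq hω]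
  exact isAffiliated_of_form_comm (dense_Hωf hω) (isEntireSymmetric_of_mem_regionFamily R)
    (smul_mem_regionFamily hω R) h.closed h.core h.le_adjoint h.eq_form hdom hA

theorem mem_graph_toPMap_top {H : Type*} [NormedAddCommGroup H] [InnerProductSpace ℂ H]
    (A : H →L[ℂ] H) (ψ η : H) : (ψ, η) ∈ (A.toLinearMap.toPMap ⊤).graph ↔ η = A ψ := by
  rw [LinearPMap.mem_graph_iff]
  constructor
  · rintro ⟨y, rfl, rfl⟩
    rfl
  · rintro rfl
    exact ⟨⟨ψ, trivial⟩, rfl, rfl⟩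

/-- Makes (a) an instance of the unbounded case: by continuity of A any dense subspace is a core,
and the adjoint is everywhere defined. -/
theorem isOmegaClosure_ofBounded (hω : IsIndicatrix ω) (A : FockSpace S →L[ℂ] FockSpace S) :
    IsOmegaClosure (ofBounded ω A) (A.toLinearMap.toPMap ⊤) := by
  have hclosed : (A.toLinearMap.toPMap ⊤).IsClosed := by
    have e : ((A.toLinearMap.toPMap ⊤).graph : Set (FockSpace S × FockSpace S))
        = {p | p.2 = A p.1} := by
      ext ⟨ψ, η⟩
      exact mem_graph_toPMap_top A ψ η
    rw [LinearPMap.IsClosed, e]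
    exact isClosed_eq continuous_snd (A.continuous.comp continuous_fst)
  refine ⟨hclosed, ⟨fun _ _ => trivial, ?_⟩, ?_, ?_⟩
  · have hle : (A.toLinearMap.toPMap ⊤).domRestrict (Hωf S ω) ≤ A.toLinearMap.toPMap ⊤ :=
      LinearPMap.domRestrict_le
    have hcl := hclosed.isClosable.leIsClosable hle
    refine LinearPMap.eq_of_eq_graph ?_
    rw [← hcl.graph_closure_eq_closure_graph]
    refine le_antisymm (Submodule.topologicalClosure_minimal _ (LinearPMap.le_graph_of_le hle)
      hclosed) ?_
    rintro ⟨ψ, η⟩ hη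
    rw [mem_graph_toPMap_top] at hη
    subst hη
    refine (dense_Hωf (S := S) hω).denseRange_val.induction_on (p := fun ψ : FockSpace S =>
      (ψ, A ψ) ∈ ((A.toLinearMap.toPMap ⊤).domRestrict (Hωf S ω)).graph.topologicalClosure) ψ
      ((Submodule.isClosed_topologicalClosure _).preimage (by fun_prop)) fun χ =>
      Submodule.le_topologicalClosure _ ?_
    rw [LinearPMap.mem_graph_iff]
    refine ⟨⟨(χ : FockSpace S), ?_⟩, rfl, ?_⟩
    · exact ⟨χ.2, trivial⟩
    · exact LinearPMap.domRestrict_apply (f := A.toLinearMap.toPMap ⊤)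
        (y := ⟨(χ : FockSpace S), trivial⟩) rfl
  · intro ψ _
    exact LinearPMap.mem_adjoint_domain_of_exists _ ⟨ContinuousLinearMap.adjoint A ψ,
      fun χ => ContinuousLinearMap.adjoint_inner_left A _ _⟩
  · intro ψ χ η hη
    rw [mem_graph_toPMap_top] at hη
    rw [hη]
    rfl

/-- Since ω ≥ 0, the weight is at least 1; this is why every bounded operator belongs to 𝒬^ω. -/
theorem norm_le_omegaNorm (hω : IsIndicatrix ω) (ψ : Hωf S ω) :
    ‖(ψ : FockSpace S)‖ ≤ omegaNorm ω (ψ : FockSpace S) := by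
  obtain ⟨⟨N, hN⟩, hmem⟩ := ψ.2
  have hle : ∀ n, ‖(ψ : FockSpace S) n‖ ^ 2
      ≤ ∫ θ, ‖weighted ω (ψ : FockSpace S) n θ‖ ^ 2 := by
    intro n
    have e : ‖(ψ : FockSpace S) n‖ ^ 2 = ∫ θ, ‖waveFun (ψ : FockSpace S) n θ‖ ^ 2 :=
      L2_norm_sq (((ψ : FockSpace S) n : particleSpace S n) : L2 n)
    rw [e]
    refine integral_mono
      ((memLp_two_iff_integrable_sq_norm (Lp.aestronglyMeasurable _)).1 (Lp.memLp _))
      ((memLp_two_iff_integrable_sq_norm (hmem n).1).1 (hmem n)) fun θ => ?_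
    simp only [weighted, norm_mul, mul_pow, norm_real]
    refine le_mul_of_one_le_left (sq_nonneg _) (one_le_pow₀ ?_)
    rw [Real.norm_of_nonneg (Real.exp_pos _).le]
    exact Real.one_le_exp (hω.nonneg _ (energy_nonneg θ))
  have hsupp : ∀ n ∉ Finset.range (N + 1),
      ∫ θ, ‖weighted ω (ψ : FockSpace S) n θ‖ ^ 2 = 0 := by
    intro n hn
    have h0 : (ψ : FockSpace S) n = 0 := hN n (by simpa using hn)
    rw [← integral_zero (Fin n → ℝ) ℝ]
    refine integral_congr_ae ?_
    filter_upwards [Lp.coeFn_zero ℂ 2 (volume : Measure (Fin n → ℝ))] with θ h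
    have h' : waveFun (ψ : FockSpace S) n θ = 0 := by
      unfold waveFun
      rw [h0]
      exact h
    simp [weighted, h']
  have h1 : ‖(ψ : FockSpace S)‖ ^ 2 = ∑ n ∈ Finset.range (N + 1), ‖(ψ : FockSpace S) n‖ ^ 2 := by
    have h2 := inner_eq_sum (ψ := (ψ : FockSpace S)) hN
    rw [inner_self_eq_norm_sq_to_K] at h2
    simp only [inner_self_eq_norm_sq_to_K] at h2
    exact_mod_cast h2
  refine Real.le_sqrt_of_sq_le ?_
  rw [h1, tsum_eq_sum hsupp]
  exact Finset.sum_le_sum fun n _ => hle n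

theorem isQOmega_ofBounded (hω : IsIndicatrix ω) (A : FockSpace S →L[ℂ] FockSpace S) :
    IsQOmega (ofBounded ω A) := by
  intro N
  refine ⟨‖A‖, fun ψ χ _ _ => ?_⟩
  have h : ‖ofBounded ω A ψ χ‖ ≤ ‖A‖ * (‖(ψ : FockSpace S)‖ * ‖(χ : FockSpace S)‖) := by
    refine (norm_inner_le_norm (𝕜 := ℂ) (ψ : FockSpace S) (A χ)).trans ?_
    calc ‖(ψ : FockSpace S)‖ * ‖A χ‖ ≤ ‖(ψ : FockSpace S)‖ * (‖A‖ * ‖(χ : FockSpace S)‖) := by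
          gcongr
          exact A.le_opNorm _
      _ = _ := by ring
  refine ⟨h.trans ?_, h.trans ?_⟩
  · gcongr
    exact norm_le_omegaNorm hω χ
  · gcongr
    exact norm_le_omegaNorm hω ψ

/-- For an everywhere defined operator the graph condition is plain commutation with E'', that is,
membership in E''' = E'. -/
theorem isAffiliated_toPMap_iff {H : Type*} [NormedAddCommGroup H] [InnerProductSpace ℂ H]
    [CompleteSpace H] (A : H →L[ℂ] H) (hA : (A.toLinearMap.toPMap ⊤).IsClosed)
    (E : Set (H →L[ℂ] H)) :
    IsAffiliated (A.toLinearMap.toPMap ⊤) E.centralizer ↔ A ∈ E.centralizer := by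
  rw [← Set.centralizer_centralizer_centralizer E]
  constructor
  · rintro ⟨-, -, h⟩ B hB
    rw [Set.centralizer_centralizer_centralizer] at h
    refine ContinuousLinearMap.ext fun ψ => ?_
    exact (mem_graph_toPMap_top A _ _).1 (h B hB ψ (A ψ) ((mem_graph_toPMap_top A _ _).2 rfl))
  · intro h
    refine ⟨hA, dense_univ, fun B hB ψ η hη => ?_⟩
    rw [Set.centralizer_centralizer_centralizer] at hB
    rw [mem_graph_toPMap_top] at hη ⊢
    rw [hη]
    exact DFunLike.congr_fun (h B hB) ψ

theorem isOmegaLocal_ofBounded_iff (hω : IsIndicatrix ω) (R : Region)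
    (A : FockSpace S →L[ℂ] FockSpace S) :
    IsOmegaLocal m (ofBounded ω A) R ↔ A ∈ localAlgebra S m ω R := by
  have h := isOmegaClosure_ofBounded hω A
  have e := isAffiliated_toPMap_iff A h.closed (expSet (regionFamily S m ω R))
  rw [← localAlgebra_eq hω] at e
  rw [← e]
  exact ⟨fun hA => h.isAffiliated hω (fun _ _ _ => trivial) hA, fun hA => h.isOmegaLocal hω hA⟩

end Regions

/-! ### Totality of product vectors -/

section TensorDense

theorem exists_pos_L2 (α : Type) [MeasureSpace α] [SigmaFinite (volume : Measure α)] :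
    ∃ w : Lp ℂ 2 (volume : Measure α), ∀ᵐ x, w x ≠ 0 := by
  obtain ⟨g, hg0, hgm, hg⟩ := exists_pos_lintegral_lt_of_sigmaFinite
    (volume : Measure α) one_ne_zero
  have hm : Measurable fun x => ((Real.sqrt (g x) : ℝ) : ℂ) :=
    continuous_ofReal.measurable.comp (hgm.coe_nnreal_real.sqrt)
  have hL : MemLp (fun x => ((Real.sqrt (g x) : ℝ) : ℂ)) 2 volume := by
    rw [memLp_two_iff_integrable_sq_norm hm.aestronglyMeasurable]
    have e : (fun x => ‖((Real.sqrt (g x) : ℝ) : ℂ)‖ ^ 2) = fun x => ((g x : NNReal) : ℝ) := by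
      funext x
      rw [norm_real, Real.norm_of_nonneg (Real.sqrt_nonneg _), Real.sq_sqrt (NNReal.coe_nonneg _)]
    rw [e]
    refine ⟨hgm.coe_nnreal_real.aestronglyMeasurable, ?_⟩
    rw [hasFiniteIntegral_iff_ofNNReal]
    exact hg.trans ENNReal.one_lt_top
  refine ⟨hL.toLp _, ?_⟩
  filter_upwards [hL.coeFn_toLp] with x hx
  rw [hx]
  exact_mod_cast (Real.sqrt_pos.2 (hg0 x)).ne'

/-- A square integrable function orthogonal to all `f ⊗ u` vanishes. -/
theorem eq_zero_of_inner_tensorLeft {n : ℕ} {χ : L2 (n + 1)}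
    (h : ∀ f u, ⟪tensorLeft f n u, χ⟫_ℂ = 0) : χ = 0 := by
  obtain ⟨w, hw⟩ := exists_pos_L2 ℝ
  obtain ⟨v, hv⟩ := exists_pos_L2 (Fin n → ℝ)
  -- With w and v nonzero almost everywhere, χ = 0 follows once the integrable function G vanishes
  -- a.e., and for this its integrals over all measurable sets suffice.
  set G : (Fin (n + 1) → ℝ) → ℂ := fun θ => ⟪tensorLeft w n v θ, χ θ⟫_ℂ
  have hG : Integrable G := L2.integrable_inner (tensorLeft w n v) χ
  set e := MeasurableEquiv.piFinSuccAbove (fun _ : Fin (n + 1) => ℝ) 0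
  have he : ∀ θ, e θ = (θ 0, Fin.tail θ) := fun θ => rfl
  have key : ∀ E : Set (ℝ × (Fin n → ℝ)), MeasurableSet E → ∫ θ in e ⁻¹' E, G θ = 0 := by
    have total : ∫ θ, G θ = 0 := by rw [← h w v, L2.inner_def]
    -- Rectangles form a generating π-system. Over A × B the integral is the inner product of χ with
    -- (1_A w) ⊗ (1_B v), which is zero by assumption.
    refine MeasurableSpace.induction_on_inter (C := fun E _ => ∫ θ in e ⁻¹' E, G θ = 0)
      generateFrom_prod.symm isPiSystem_prod ?_ ?_ ?_ ?_
    · simp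
    · rintro _ ⟨A, hA, B, hB, rfl⟩
      rw [Set.mem_ofPred_eq] at hA hB
      have hA' : MemLp (A.indicator w) 2 volume := (Lp.memLp w).indicator hA
      have hB' : MemLp (B.indicator v) 2 volume := (Lp.memLp v).indicator hB
      rw [← h (hA'.toLp _) (hB'.toLp _), L2.inner_def, ← integral_indicator
        (e.measurable (hA.prod hB))]
      refine integral_congr_ae ?_
      filter_upwards [coeFn_tensorLeft w n v, coeFn_tensorLeft (hA'.toLp _) n (hB'.toLp _),
        (quasiMeasurePreserving_head n).ae hA'.coeFn_toLp,
        (quasiMeasurePreserving_tail n).ae hB'.coeFn_toLp] with θ h1 h2 h3 h4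
      rw [h2, h3, h4]
      by_cases hA0 : θ 0 ∈ A
      · by_cases hB0 : Fin.tail θ ∈ B
        · rw [Set.indicator_of_mem (show θ ∈ e ⁻¹' A ×ˢ B from ⟨hA0, hB0⟩),
            Set.indicator_of_mem hA0, Set.indicator_of_mem hB0]
          simp only [G, h1]
        · rw [Set.indicator_of_notMem (fun hθ : θ ∈ e ⁻¹' A ×ˢ B => hB0 hθ.2),
            Set.indicator_of_notMem hB0, mul_zero, inner_zero_left]
      · rw [Set.indicator_of_notMem (fun hθ : θ ∈ e ⁻¹' A ×ˢ B => hA0 hθ.1),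
          Set.indicator_of_notMem hA0, zero_mul, inner_zero_left]
    · intro E hE hE0
      have := integral_add_compl (e.measurable hE) hG
      rw [hE0, zero_add, total] at this
      exact this
    · intro E hd hE hE0
      rw [Set.preimage_iUnion, integral_iUnion (fun i => e.measurable (hE i))
        (fun i j hij => (hd hij).preimage _) hG.integrableOn]
      simp [hE0]
  have hG0 : G =ᵐ[volume] 0 := by
    refine hG.ae_eq_zero_of_forall_setIntegral_eq_zero fun s hs _ => ?_
    have := key (e.symm ⁻¹' s) (e.symm.measurable hs)
    rwa [← Set.preimage_comp, e.symm_comp_self, Set.preimage_id] at this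
  refine Lp.ext ?_
  filter_upwards [hG0, coeFn_tensorLeft w n v, (quasiMeasurePreserving_head n).ae hw,
    (quasiMeasurePreserving_tail n).ae hv, Lp.coeFn_zero ℂ 2 (volume : Measure (Fin (n + 1) → ℝ))]
    with θ h1 h2 h3 h4 h5
  rw [h5, Pi.zero_apply]
  simp only [G, h2, Pi.zero_apply, RCLike.inner_apply, map_mul, mul_eq_zero, map_eq_zero] at h1
  tauto

theorem eqOn_tensorLeft {n : ℕ} {E : Type*} [NormedAddCommGroup E] [NormedSpace ℂ E]
    {A B : L2 (n + 1) →L[ℂ] E} (h : ∀ f u, A (tensorLeft f n u) = B (tensorLeft f n u)) :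
    A = B := by
  set K : Submodule ℂ (L2 (n + 1)) := Submodule.span ℂ {χ | ∃ f u, χ = tensorLeft f n u}
  have hK : K.topologicalClosure = ⊤ := by
    rw [Submodule.topologicalClosure_eq_top_iff, Submodule.eq_bot_iff]
    intro χ hχ
    refine eq_zero_of_inner_tensorLeft fun f u => ?_
    exact (Submodule.mem_orthogonal _ _).1 hχ _ (Submodule.subset_span ⟨f, u, rfl⟩)
  refine ContinuousLinearMap.ext_on (Submodule.dense_iff_topologicalClosure_eq_top.2 hK) ?_
  rintro _ ⟨f, u, rfl⟩
  exact h f u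

end TensorDense

/-! ### Permutations of variables and their interplay with tensoring -/

section Permutations

/-- The permutation of variables `ψ(θ) ↦ ψ(θ ∘ e)`. -/
def permOp {n : ℕ} (e : Equiv.Perm (Fin n)) : L2 n →ₗᵢ[ℂ] L2 n :=
  Lp.compMeasurePreservingₗᵢ ℂ (fun θ => θ ∘ e) (measurePreserving_comp e)

theorem coeFn_permOp {n : ℕ} (e : Equiv.Perm (Fin n)) (ψ : L2 n) :
    permOp e ψ =ᵐ[volume] fun θ => ψ (θ ∘ e) :=
  Lp.coeFn_compMeasurePreserving ψ (measurePreserving_comp e)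

theorem permOp_mul {n : ℕ} (e f : Equiv.Perm (Fin n)) (ψ : L2 n) :
    permOp (e * f) ψ = permOp e (permOp f ψ) := by
  refine Lp.ext ?_
  filter_upwards [coeFn_permOp (e * f) ψ, coeFn_permOp e (permOp f ψ),
    (measurePreserving_comp e).quasiMeasurePreserving.ae (coeFn_permOp f ψ)] with θ h1 h2 h3
  rw [h1, h2, h3]
  rfl

theorem permOp_one {n : ℕ} (ψ : L2 n) : permOp 1 ψ = ψ := by
  refine Lp.ext ?_
  filter_upwards [coeFn_permOp 1 ψ] with θ h1
  rw [h1]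
  rfl

theorem inner_permOp_left {n : ℕ} (e : Equiv.Perm (Fin n)) (ψ χ : L2 n) :
    ⟪permOp e ψ, χ⟫_ℂ = ⟪ψ, permOp e⁻¹ χ⟫_ℂ := by
  rw [← (permOp e).inner_map_map ψ, ← permOp_mul, mul_inv_cancel, permOp_one]

/-- `decomposeFin.symm (0, e)` fixes 0 and acts as e on the remaining positions, so it leaves the
factor g alone. -/
theorem permOp_tensorLeft {n : ℕ} (e : Equiv.Perm (Fin n)) (g : Lp ℂ 2 (volume : Measure ℝ))
    (ψ : L2 n) : permOp (Equiv.Perm.decomposeFin.symm (0, e)) (tensorLeft g n ψ)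
      = tensorLeft g n (permOp e ψ) := by
  refine Lp.ext ?_
  filter_upwards [coeFn_permOp (Equiv.Perm.decomposeFin.symm (0, e)) (tensorLeft g n ψ),
    (measurePreserving_comp (Equiv.Perm.decomposeFin.symm (0, e))).quasiMeasurePreserving.ae
      (coeFn_tensorLeft g n ψ), coeFn_tensorLeft g n (permOp e ψ),
    (quasiMeasurePreserving_tail n).ae (coeFn_permOp e ψ)] with θ h1 h2 h3 h4
  rw [h1, h2, h3, h4]
  congr 2

theorem permOp_swap_tensorLeft {n : ℕ} (f g : Lp ℂ 2 (volume : Measure ℝ)) (u : L2 n) :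
    permOp (Equiv.swap 0 1) (tensorLeft f (n + 1) (tensorLeft g n u))
      = tensorLeft g (n + 1) (tensorLeft f n u) := by
  refine Lp.ext ?_
  have a : ∀ f g : Lp ℂ 2 (volume : Measure ℝ), tensorLeft f (n + 1) (tensorLeft g n u)
      =ᵐ[volume] fun θ => f (θ 0) * (g (θ 1) * u (Fin.tail (Fin.tail θ))) := by
    intro f g
    filter_upwards [coeFn_tensorLeft f (n + 1) (tensorLeft g n u),
      (quasiMeasurePreserving_tail (n + 1)).ae (coeFn_tensorLeft g n u)] with θ h1 h2
    rw [h1, h2]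
    rfl
  filter_upwards [coeFn_permOp (Equiv.swap 0 1) (tensorLeft f (n + 1) (tensorLeft g n u)), a g f,
    (measurePreserving_comp (Equiv.swap 0 1)).quasiMeasurePreserving.ae (a f g)] with θ h1 h2 h3
  rw [h1, h2, h3]
  have e : Fin.tail (Fin.tail (θ ∘ Equiv.swap (0 : Fin (n + 2)) 1)) = Fin.tail (Fin.tail θ) := by
    funext k
    simp only [Fin.tail, Function.comp_apply]
    rw [Equiv.swap_apply_of_ne_of_ne (Fin.succ_ne_zero _)
      (by rw [← Fin.succ_zero_eq_one]; exact fun h => Fin.succ_ne_zero _ (Fin.succ_injective _ h))]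
  rw [e]
  simp only [Function.comp_apply, Equiv.swap_apply_left, Equiv.swap_apply_right]
  ring

theorem adjoint_tensorLeft_tensorLeft {n : ℕ} (k g : Lp ℂ 2 (volume : Measure ℝ)) (ψ : L2 n) :
    ContinuousLinearMap.adjoint (tensorLeft k n) (tensorLeft g n ψ) = ⟪k, g⟫_ℂ • ψ := by
  refine ext_inner_left ℂ fun χ => ?_
  rw [ContinuousLinearMap.adjoint_inner_right, inner_smul_right, L2.inner_def, L2.inner_def,
    L2.inner_def, ← integral_prod_mul]
  have h := (measurePreserving_head_tail n).integral_comp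
    (MeasurableEquiv.piFinSuccAbove (fun _ : Fin (n + 1) => ℝ) 0).measurableEmbedding
    (fun z : ℝ × (Fin n → ℝ) => ⟪k z.1, g z.1⟫_ℂ * ⟪χ z.2, ψ z.2⟫_ℂ)
  refine Eq.trans ?_ h
  refine integral_congr_ae ?_
  filter_upwards [coeFn_tensorLeft k n χ, coeFn_tensorLeft g n ψ] with θ h1 h2
  rw [h1, h2]
  simp only [RCLike.inner_apply, map_mul]
  ring

/-- `T_k† (0 1) T_g = T_g T_k†` for the operators `T_f ψ = f ⊗ ψ`. -/
theorem adjoint_tensorLeft_permOp_swap {n : ℕ} (k g : Lp ℂ 2 (volume : Measure ℝ))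
    (ψ : L2 (n + 1)) :
    ContinuousLinearMap.adjoint (tensorLeft k (n + 1))
        (permOp (Equiv.swap 0 1) (tensorLeft g (n + 1) ψ))
      = tensorLeft g n (ContinuousLinearMap.adjoint (tensorLeft k n) ψ) := by
  have h : (ContinuousLinearMap.adjoint (tensorLeft k (n + 1))).comp
      ((permOp (Equiv.swap 0 1)).toContinuousLinearMap.comp (tensorLeft g (n + 1)))
      = (tensorLeft g n).comp (ContinuousLinearMap.adjoint (tensorLeft k n)) := by
    -- On a product vector f ⊗ u both sides equal ⟨k, f⟩ g ⊗ u.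
    refine eqOn_tensorLeft fun f u => ?_
    change ContinuousLinearMap.adjoint (tensorLeft k (n + 1))
        (permOp (Equiv.swap 0 1) (tensorLeft g (n + 1) (tensorLeft f n u)))
      = tensorLeft g n (ContinuousLinearMap.adjoint (tensorLeft k n) (tensorLeft f n u))
    rw [permOp_swap_tensorLeft, adjoint_tensorLeft_tensorLeft, adjoint_tensorLeft_tensorLeft,
      map_smul]
  exact congrArg (fun A : L2 (n + 1) →L[ℂ] L2 (n + 1) => A ψ) h

end Permutations

/-! ### S = -1: the canonical anticommutation relations -/

section Fermions

/-- The sign of a permutation, as a complex number. -/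
def permSign {n : ℕ} (e : Equiv.Perm (Fin n)) : ℂ := ((Equiv.Perm.sign e : ℤ) : ℂ)

theorem permSign_mul {n : ℕ} (e f : Equiv.Perm (Fin n)) :
    permSign (e * f) = permSign e * permSign f := by simp [permSign]

theorem permSign_mul_self {n : ℕ} (e : Equiv.Perm (Fin n)) : permSign e * permSign e = 1 := by
  rcases Int.units_eq_one_or (Equiv.Perm.sign e) with h | h <;> simp [permSign, h]

theorem permSign_inv {n : ℕ} (e : Equiv.Perm (Fin n)) : permSign e⁻¹ = permSign e := by
  simp [permSign]

theorem conj_permSign {n : ℕ} (e : Equiv.Perm (Fin n)) :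
    (starRingEnd ℂ) (permSign e) = permSign e := by simp [permSign]

variable {S : ScatteringFunction}

/-- The definition only constrains neighbouring transpositions; they generate the symmetric group,
so for S = -1 the particle space consists of the antisymmetric functions. -/
theorem mem_particleSpace_iff (hS : S.toFun = fun _ => -1) {n : ℕ} {ψ : L2 n} :
    ψ ∈ particleSpace S n ↔ ∀ e, permOp e ψ = permSign e • ψ := by
  have hadj : ∀ i j : Fin n, (ψ =ᵐ[volume] fun θ =>
      S.toFun ((θ j - θ i : ℝ) : ℂ) * ψ (θ ∘ Equiv.swap i j)) ↔
        permOp (Equiv.swap i j) ψ = -ψ := by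
    intro i j
    rw [Lp.ext_iff]
    constructor
    · intro h
      filter_upwards [h, coeFn_permOp (Equiv.swap i j) ψ, Lp.coeFn_neg ψ] with θ h1 h2 h3
      rw [h2, h3, Pi.neg_apply, h1, hS]
      ring
    · intro h
      filter_upwards [h, coeFn_permOp (Equiv.swap i j) ψ, Lp.coeFn_neg ψ] with θ h1 h2 h3
      rw [← h2, h1, h3, hS, Pi.neg_apply]
      ring
  constructor
  · intro hψ e
    obtain _ | n := n
    · rw [Subsingleton.elim e 1, permOp_one]
      simp [permSign]
    have he : e ∈ Submonoid.closure
        (Set.range fun i : Fin n => Equiv.swap i.castSucc i.succ) := by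
      rw [Equiv.Perm.mclosure_swap_castSucc_succ]; trivial
    induction he using Submonoid.closure_induction with
    | mem e he =>
      obtain ⟨i, rfl⟩ := he
      rw [(hadj _ _).1 (hψ i.castSucc i.succ (by simp))]
      simp [permSign, Equiv.Perm.sign_swap (Fin.castSucc_lt_succ (i := i)).ne]
    | one => rw [permOp_one]; simp [permSign]
    | mul e f _ _ h1 h2 => rw [permOp_mul, h2, map_smul, h1, permSign_mul, smul_smul, mul_comm]
  · intro h i j hij
    rw [hadj, h]
    have : i ≠ j := fun h => by rw [h] at hij; omega
    simp [permSign, Equiv.Perm.sign_swap this]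

/-- For `S = -1`, the projection onto the symmetric functions is the antisymmetrization. -/
theorem starProjection_eq_sum (hS : S.toFun = fun _ => -1) {n : ℕ} (ψ : L2 n) :
    ((n.factorial : ℕ) : ℂ) • (particleSpace S n).starProjection ψ
      = ∑ e : Equiv.Perm (Fin n), permSign e • permOp e ψ := by
  set A := ∑ e : Equiv.Perm (Fin n), permSign e • permOp e ψ with hA
  have hn : ((n.factorial : ℕ) : ℂ) ≠ 0 := Nat.cast_ne_zero.2 n.factorial_ne_zero
  have hmem : A ∈ particleSpace S n := by
    rw [mem_particleSpace_iff hS]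
    intro f
    rw [hA, map_sum, Finset.smul_sum]
    refine Fintype.sum_equiv (Equiv.mulLeft f) _ _ fun e => ?_
    rw [Equiv.coe_mulLeft, map_smul, permOp_mul, permSign_mul, smul_smul, ← mul_assoc,
      permSign_mul_self, one_mul]
  have hproj : (particleSpace S n).starProjection ψ = ((n.factorial : ℕ) : ℂ)⁻¹ • A := by
    refine Submodule.eq_starProjection_of_mem_orthogonal (Submodule.smul_mem _ _ hmem) ?_
    rw [Submodule.mem_orthogonal]
    intro χ hχ
    rw [mem_particleSpace_iff hS] at hχ
    have h1 : ∀ e : Equiv.Perm (Fin n), ⟪χ, permSign e • permOp e ψ⟫_ℂ = ⟪χ, ψ⟫_ℂ := by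
      intro e
      have h2 := inner_permOp_left e⁻¹ χ ψ
      rw [inv_inv, hχ, inner_smul_left, conj_permSign, permSign_inv] at h2
      rw [inner_smul_right, ← h2, ← mul_assoc, permSign_mul_self, one_mul]
    rw [inner_sub_right, inner_smul_right, hA, inner_sum, Finset.sum_congr rfl fun e _ => h1 e,
      Finset.sum_const, Finset.card_univ, Fintype.card_perm, Fintype.card_fin, nsmul_eq_mul,
      ← mul_assoc, inv_mul_cancel₀ hn, one_mul, sub_self]
  rw [hproj, smul_smul, mul_inv_cancel₀ hn, one_smul]

theorem decomposeFin_symm_eq {n : ℕ} (p : Fin (n + 1)) (e : Equiv.Perm (Fin n)) :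
    Equiv.Perm.decomposeFin.symm (p, e)
      = Equiv.swap 0 p * Equiv.Perm.decomposeFin.symm (0, e) := by
  ext k
  refine Fin.cases ?_ (fun k => ?_) k
  · simp
  · simp

/-- Coset decomposition of the symmetric group on n + 1 letters by the stabilizer of 0: since ψ is
antisymmetric, each coset contributes n! equal terms, and the transpositions (0 p) represent the
cosets. -/
theorem starProjection_tensorLeft (hS : S.toFun = fun _ => -1) {n : ℕ}
    (g : Lp ℂ 2 (volume : Measure ℝ)) {ψ : L2 n} (hψ : ψ ∈ particleSpace S n) :
    ((n : ℂ) + 1) • (particleSpace S (n + 1)).starProjection (tensorLeft g n ψ)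
      = tensorLeft g n ψ - ∑ p : Fin n, permOp (Equiv.swap 0 p.succ) (tensorLeft g n ψ) := by
  have hn : ((n.factorial : ℕ) : ℂ) ≠ 0 := Nat.cast_ne_zero.2 n.factorial_ne_zero
  have h0 := starProjection_eq_sum hS (tensorLeft g n ψ)
  have hterm : ∀ (p : Fin (n + 1)) (e : Equiv.Perm (Fin n)),
      permSign (Equiv.Perm.decomposeFin.symm (p, e))
          • permOp (Equiv.Perm.decomposeFin.symm (p, e)) (tensorLeft g n ψ)
        = (if p = 0 then (1 : ℂ) else -1) • permOp (Equiv.swap 0 p) (tensorLeft g n ψ) := by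
    intro p e
    have hs : permSign (Equiv.Perm.decomposeFin.symm (p, e))
        = (if p = 0 then (1 : ℂ) else -1) * permSign e := by
      rw [permSign, Equiv.Perm.decomposeFin.symm_sign]
      split_ifs <;> simp [permSign]
    rw [hs, decomposeFin_symm_eq, permOp_mul, permOp_tensorLeft,
      (mem_particleSpace_iff hS).1 hψ e, map_smul, map_smul, smul_smul, mul_assoc,
      permSign_mul_self, mul_one]
  rw [← Equiv.sum_comp Equiv.Perm.decomposeFin.symm, Fintype.sum_prod_type,
    Finset.sum_congr rfl fun p _ => Finset.sum_congr rfl fun e _ => hterm p e] at h0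
  simp only [Finset.sum_const, Finset.card_univ, Fintype.card_perm, Fintype.card_fin] at h0
  rw [← Finset.smul_sum, Fin.sum_univ_succ] at h0
  simp only [if_true, Fin.succ_ne_zero, if_false, Equiv.swap_self, neg_smul, one_smul] at h0
  rw [Nat.factorial_succ, Nat.cast_mul, mul_comm, mul_smul, ← Nat.cast_smul_eq_nsmul ℂ] at h0
  have h1 := smul_right_injective _ hn h0
  push_cast at h1
  rw [h1, Finset.sum_neg_distrib, ← sub_eq_add_neg]
  exact congrArg₂ _ (permOp_one _) rfl

/-- Contracting the first variable of an antisymmetric function leaves it antisymmetric in the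
others, because a permutation fixing 0 has the sign of its restriction. -/
theorem adjoint_tensorLeft_mem (hS : S.toFun = fun _ => -1) {n : ℕ}
    (k : Lp ℂ 2 (volume : Measure ℝ)) {ψ : L2 (n + 1)} (hψ : ψ ∈ particleSpace S (n + 1)) :
    ContinuousLinearMap.adjoint (tensorLeft k n) ψ ∈ particleSpace S n := by
  rw [mem_particleSpace_iff hS] at hψ ⊢
  intro e
  refine ext_inner_left ℂ fun χ => ?_
  have h1 := inner_permOp_left e⁻¹ χ (ContinuousLinearMap.adjoint (tensorLeft k n) ψ)
  rw [inv_inv] at h1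
  have he : Equiv.Perm.decomposeFin.symm ((0 : Fin (n + 1)), e⁻¹)
      = (Equiv.Perm.decomposeFin.symm (0, e))⁻¹ := by
    rw [eq_inv_iff_mul_eq_one]
    ext k
    refine Fin.cases ?_ (fun k => ?_) k <;> simp
  rw [← h1, ContinuousLinearMap.adjoint_inner_right, ← permOp_tensorLeft, he, inner_permOp_left,
    inv_inv, hψ, inner_smul_right, inner_smul_right, ContinuousLinearMap.adjoint_inner_right]
  congr 1
  rw [permSign, Equiv.Perm.decomposeFin.symm_sign]
  simp [permSign]

/-- The value does not depend on p: (0 p+1) is conjugate to (0 1) by a permutation s fixing 0. On k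
⊗ χ and g ⊗ ψ, s produces the same sign twice, which cancels. -/
theorem inner_permOp_swap_tensorLeft (hS : S.toFun = fun _ => -1) {n : ℕ}
    (k g : Lp ℂ 2 (volume : Measure ℝ)) {ψ χ : L2 (n + 1)} (hψ : ψ ∈ particleSpace S (n + 1))
    (hχ : χ ∈ particleSpace S (n + 1)) (p : Fin (n + 1)) :
    ⟪tensorLeft k (n + 1) χ, permOp (Equiv.swap 0 p.succ) (tensorLeft g (n + 1) ψ)⟫_ℂ
      = ⟪χ, tensorLeft g n (ContinuousLinearMap.adjoint (tensorLeft k n) ψ)⟫_ℂ := by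
  rw [mem_particleSpace_iff hS] at hψ hχ
  set s : Equiv.Perm (Fin (n + 2)) :=
    Equiv.Perm.decomposeFin.symm ((0 : Fin (n + 2)), Equiv.swap 0 p) with hs
  have hs' : s = Equiv.swap 1 p.succ := by
    ext k
    refine Fin.cases ?_ (fun k => ?_) k
    · rw [hs, Equiv.Perm.decomposeFin_symm_apply_zero, Equiv.swap_apply_of_ne_of_ne]
      · exact Fin.zero_ne_one
      · exact (Fin.succ_ne_zero _).symm
    · rw [hs, Equiv.Perm.decomposeFin_symm_apply_succ, Equiv.swap_self, Equiv.refl_apply,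
        ← Fin.succ_zero_eq_one, (Fin.succ_injective _).map_swap]
  have hconj : Equiv.swap 0 p.succ = s * (Equiv.swap 0 1 * s) := by
    have h1 := Equiv.mul_swap_eq_swap_mul s 0 1
    have h2 : s 0 = 0 := by rw [hs, Equiv.Perm.decomposeFin_symm_apply_zero]
    have h3 : s 1 = p.succ := by rw [hs', Equiv.swap_apply_left]
    rw [h2, h3] at h1
    rw [← mul_assoc, h1, mul_assoc, hs', Equiv.swap_mul_self, mul_one]
  have hsinv : s⁻¹ = s := by rw [hs', Equiv.swap_inv]
  have h1 := inner_permOp_left s⁻¹ (tensorLeft k (n + 1) χ)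
    (permOp (Equiv.swap 0 1) (permOp s (tensorLeft g (n + 1) ψ)))
  rw [inv_inv, hsinv] at h1
  rw [hconj, permOp_mul, permOp_mul, ← h1, hs, permOp_tensorLeft, permOp_tensorLeft, hψ, hχ,
    map_smul, map_smul, map_smul, inner_smul_left, inner_smul_right, conj_permSign, ← mul_assoc,
    permSign_mul_self, one_mul, ← ContinuousLinearMap.adjoint_inner_right,
    adjoint_tensorLeft_permOp_swap]

theorem sqrt_mul_sqrt_succ (n : ℕ) (z : ℂ) :
    ((Real.sqrt (n + 1) : ℝ) : ℂ) * (((Real.sqrt (n + 1) : ℝ) : ℂ) * z) = ((n : ℂ) + 1) * z := by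
  rw [← mul_assoc, ← ofReal_mul, Real.mul_self_sqrt (by positivity)]
  push_cast
  ring

theorem inner_annihilationN_creationN (h g : ℝ → ℂ) (n : ℕ) (χ ψ : particleSpace S n) :
    ⟪χ, annihilationN S h n (creationN S g n ψ)⟫_ℂ
      = ⟪tensorLeft (toL2 fun θ => (starRingEnd ℂ) (h θ)) n (χ : L2 n),
        ((n : ℂ) + 1) • (particleSpace S (n + 1)).starProjection (tensorLeft (toL2 g) n ψ)⟫_ℂ := by
  rw [annihilationN, ContinuousLinearMap.adjoint_inner_right]
  change ⟪((creationN S _ n χ : particleSpace S (n + 1)) : L2 (n + 1)),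
    ((creationN S g n ψ : particleSpace S (n + 1)) : L2 (n + 1))⟫_ℂ = _
  rw [coe_creationN, coe_creationN, inner_smul_left, inner_smul_right, conj_ofReal,
    sqrt_mul_sqrt_succ, inner_smul_right, Submodule.inner_starProjection_left_eq_right,
    Submodule.starProjection_eq_self_iff.2 (Submodule.starProjection_apply_mem _ _)]

theorem coe_annihilationN_of_fermi (hS : S.toFun = fun _ => -1) (h : ℝ → ℂ) (n : ℕ)
    (ψ : particleSpace S (n + 1)) :
    ((annihilationN S h n ψ : particleSpace S n) : L2 n)
      = ((Real.sqrt (n + 1) : ℝ) : ℂ) • ContinuousLinearMap.adjoint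
        (tensorLeft (toL2 fun θ => (starRingEnd ℂ) (h θ)) n) ψ := by
  rw [coe_annihilationN, Submodule.starProjection_eq_self_iff.2 (adjoint_tensorLeft_mem hS _ ψ.2)]

theorem inner_creationN_annihilationN (hS : S.toFun = fun _ => -1) (h g : ℝ → ℂ) (n : ℕ)
    (χ ψ : particleSpace S (n + 1)) :
    ⟪χ, creationN S g n (annihilationN S h n ψ)⟫_ℂ
      = ((n : ℂ) + 1) * ⟪(χ : L2 (n + 1)), tensorLeft (toL2 g) n (ContinuousLinearMap.adjoint
        (tensorLeft (toL2 fun θ => (starRingEnd ℂ) (h θ)) n) ψ)⟫_ℂ := by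
  change ⟪(χ : L2 (n + 1)), ((creationN S g n _ : particleSpace S (n + 1)) : L2 (n + 1))⟫_ℂ = _
  rw [coe_creationN, coe_annihilationN_of_fermi hS, inner_smul_right,
    ← Submodule.inner_starProjection_left_eq_right, Submodule.starProjection_eq_self_iff.2 χ.2,
    map_smul, inner_smul_right, sqrt_mul_sqrt_succ]

/-- The canonical anticommutation relation `z(h) z†(g) + z†(g) z(h) = ⟨h̄, g⟩`. -/
theorem anticommutator (hS : S.toFun = fun _ => -1) (h g : ℝ → ℂ) (n : ℕ)
    (ψ : particleSpace S (n + 1)) :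
    creationN S g n (annihilationN S h n ψ) + annihilationN S h (n + 1) (creationN S g (n + 1) ψ)
      = ⟪toL2 fun θ => (starRingEnd ℂ) (h θ), toL2 g⟫_ℂ • ψ := by
  refine ext_inner_left ℂ fun χ => ?_
  -- With factor n + 2 the projection of g ⊗ ψ yields ⟨h̄, g⟩ψ minus n + 1 equal exchange terms.
  -- Those cancel against the (n + 1)-fold term of z†(g)z(h).
  rw [inner_add_right, inner_creationN_annihilationN hS, inner_annihilationN_creationN,
    starProjection_tensorLeft hS _ ψ.2, inner_sub_right, inner_sum,
    Finset.sum_congr rfl fun p _ => inner_permOp_swap_tensorLeft hS _ _ ψ.2 χ.2 p,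
    ← ContinuousLinearMap.adjoint_inner_right, adjoint_tensorLeft_tensorLeft, Finset.sum_const,
    Finset.card_univ, Fintype.card_fin, nsmul_eq_mul, inner_smul_right]
  refine Eq.trans ?_ (inner_smul_right (𝕜 := ℂ) (χ : L2 (n + 1)) (ψ : L2 (n + 1)) _).symm
  push_cast
  ring

theorem annihilationN_creationN_zero (hS : S.toFun = fun _ => -1) (h g : ℝ → ℂ)
    (ψ : particleSpace S 0) : annihilationN S h 0 (creationN S g 0 ψ)
      = ⟪toL2 fun θ => (starRingEnd ℂ) (h θ), toL2 g⟫_ℂ • ψ := by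
  refine ext_inner_left ℂ fun χ => ?_
  rw [inner_annihilationN_creationN, starProjection_tensorLeft hS _ ψ.2, Finset.univ_eq_empty,
    Finset.sum_empty, sub_zero, ← ContinuousLinearMap.adjoint_inner_right,
    adjoint_tensorLeft_tensorLeft]
  rfl

/-- The Pauli principle: k ⊗ k ⊗ χ is invariant under exchange of the first two variables, ψ is odd,
so their inner product vanishes. -/
theorem annihilationN_annihilationN (hS : S.toFun = fun _ => -1) (h : ℝ → ℂ) (n : ℕ)
    (ψ : particleSpace S (n + 2)) : annihilationN S h n (annihilationN S h (n + 1) ψ) = 0 := by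
  refine Subtype.ext (ext_inner_left ℂ fun χ => ?_)
  rw [coe_annihilationN_of_fermi hS, coe_annihilationN_of_fermi hS, map_smul, inner_smul_right,
    inner_smul_right, ContinuousLinearMap.adjoint_inner_right,
    ContinuousLinearMap.adjoint_inner_right]
  set k := toL2 fun θ => (starRingEnd ℂ) (h θ)
  have h1 := (permOp (Equiv.swap (0 : Fin (n + 2)) 1)).inner_map_map
    (tensorLeft k (n + 1) (tensorLeft k n χ)) ψ
  rw [permOp_swap_tensorLeft, (mem_particleSpace_iff hS).1 ψ.2, inner_smul_right] at h1
  have h2 : permSign (Equiv.swap (0 : Fin (n + 2)) 1) = -1 := by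
    simp [permSign, Equiv.Perm.sign_swap (Fin.zero_ne_one (n := n))]
  rw [h2] at h1
  have h3 : ⟪tensorLeft k (n + 1) (tensorLeft k n χ), (ψ : L2 (n + 2))⟫_ℂ = 0 := by
    linear_combination (-1 / 2 : ℂ) * h1
  rw [h3, mul_zero, mul_zero]
  exact (inner_zero_right _).symm

theorem creationN_creationN (hS : S.toFun = fun _ => -1) (g : ℝ → ℂ) (n : ℕ)
    (ψ : particleSpace S n) : creationN S g (n + 1) (creationN S g n ψ) = 0 := by
  have e : ∀ n, creationN S g n = ContinuousLinearMap.adjoint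
      (annihilationN S (fun θ => (starRingEnd ℂ) (g θ)) n) := by
    intro n
    rw [annihilationN, ContinuousLinearMap.adjoint_adjoint]
    simp only [conj_conj]
  refine ext_inner_left ℂ fun χ => ?_
  rw [e, e, ContinuousLinearMap.adjoint_inner_right, ContinuousLinearMap.adjoint_inner_right,
    annihilationN_annihilationN hS, inner_zero_left, inner_zero_right]

/-- For `S = -1`, the square of the field is a multiple of the identity. -/
theorem IsFieldEnd.sq_eq (hS : S.toFun = fun _ => -1) {ω : ℝ → ℝ} {g h : ℝ → ℂ}
    {Φ : Module.End ℂ (Hωf S ω)} (hΦ : IsFieldEnd g h Φ) (ψ : Hωf S ω) :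
    Φ (Φ ψ) = ⟪toL2 fun θ => (starRingEnd ℂ) (h θ), toL2 g⟫_ℂ • ψ := by
  refine Subtype.ext ?_
  ext1
  funext n
  set c := ⟪toL2 fun θ => (starRingEnd ℂ) (h θ), toL2 g⟫_ℂ
  change _ = c • (ψ : FockSpace S) n
  rw [hΦ]
  -- In φ² only z†z + zz† survives. Components 0 and 1 are separate because fewer than two creations
  -- can reach them.
  match n with
  | 0 =>
    change annihilationN S h 0 ((Φ ψ : FockSpace S) 1) = _
    rw [hΦ]
    change annihilationN S h 0 (creationN S g 0 _ + annihilationN S h 1 _) = _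
    rw [map_add, annihilationN_annihilationN hS, annihilationN_creationN_zero hS, add_zero]
  | 1 =>
    change creationN S g 0 ((Φ ψ : FockSpace S) 0)
      + annihilationN S h 1 ((Φ ψ : FockSpace S) 2) = _
    rw [hΦ, hΦ]
    change creationN S g 0 (annihilationN S h 0 _)
      + annihilationN S h 1 (creationN S g 1 _ + annihilationN S h 2 _) = _
    rw [map_add, annihilationN_annihilationN hS, add_zero, anticommutator hS]
  | n + 2 =>
    change creationN S g (n + 1) ((Φ ψ : FockSpace S) (n + 1))
      + annihilationN S h (n + 2) ((Φ ψ : FockSpace S) (n + 3)) = _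
    rw [hΦ, hΦ]
    change creationN S g (n + 1) (creationN S g n _ + annihilationN S h (n + 1) _)
      + annihilationN S h (n + 2) (creationN S g (n + 2) _ + annihilationN S h (n + 3) _) = _
    rw [map_add, map_add, annihilationN_annihilationN hS, add_zero, creationN_creationN hS,
      zero_add, anticommutator hS]

end Fermions

/-! ### S = -1: exponentials of fields preserve ℋ^{ω,f} -/

section FermiExponentials

/-- If `Φ² = c`, then `exp(iΦ)` leaves the domain invariant. -/
theorem IsExp.apply_mem_of_sq {H : Type*} [NormedAddCommGroup H] [InnerProductSpace ℂ H]
    {D : Submodule ℂ H} {Φ : Module.End ℂ D} {B : H →L[ℂ] H} (hB : IsExp Φ B) {c : ℂ}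
    (hc : ∀ ψ, Φ (Φ ψ) = c • ψ) (ψ : D) : B ψ ∈ D := by
  -- All powers Φᵏψ stay in this finite-dimensional, hence closed, subspace of D, and so does the
  -- limit of the exponential series.
  set V : Submodule ℂ H := Submodule.span ℂ {(ψ : H), (Φ ψ : H)}
  have hV : FiniteDimensional ℂ V := FiniteDimensional.span_of_finite ℂ (Set.toFinite _)
  have hVD : V ≤ D := Submodule.span_le.2 (by
    rintro _ (rfl | rfl)
    exacts [ψ.2, (Φ ψ).2])
  have hmem : ∀ k, ((Φ ^ k) ψ : H) ∈ V ∧ ((Φ ^ (k + 1)) ψ : H) ∈ V := by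
    intro k
    induction k with
    | zero =>
      refine ⟨Submodule.subset_span (Or.inl rfl), Submodule.subset_span (Or.inr ?_)⟩
      rw [zero_add, pow_one]
      rfl
    | succ k ih =>
      refine ⟨ih.2, ?_⟩
      have e : (Φ ^ (k + 1 + 1)) ψ = c • (Φ ^ k) ψ := by
        rw [← hc, pow_succ', pow_succ']
        rfl
      rw [e]
      exact V.smul_mem c ih.1
  exact hVD ((Submodule.closed_of_finiteDimensional V).mem_of_tendsto (hB ψ)
    (Eventually.of_forall fun s => V.sum_mem fun k _ => V.smul_mem _ (hmem k).1))

variable {S : ScatteringFunction} {m : ℝ} {ω : ℝ → ℝ}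

theorem exists_sq_eq_of_mem_regionFamily (hS : S.toFun = fun _ => -1) (R : Region) :
    ∀ Φ ∈ regionFamily S m ω R, ∃ c : ℂ, ∀ ψ, Φ (Φ ψ) = c • ψ := by
  have hr : ∀ O, ∀ Φ ∈ fieldFamily S m ω O, ∃ c : ℂ, ∀ ψ, Φ (Φ ψ) = c • ψ := by
    rintro O Φ ⟨f, -, hΦ⟩
    exact ⟨_, hΦ.sq_eq hS⟩
  have hl : ∀ O, ∀ Φ ∈ reflectedFamily S m ω O, ∃ c : ℂ, ∀ ψ, Φ (Φ ψ) = c • ψ := by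
    rintro O _ ⟨Φ, hΦ, rfl⟩
    obtain ⟨c, hc⟩ := hr O Φ hΦ
    refine ⟨(starRingEnd ℂ) c, fun ψ => ?_⟩
    rw [reflectEnd_apply, reflectEnd_apply, reflectionω_reflectionω, hc, LinearMap.map_smulₛₗ,
      reflectionω_reflectionω]
  cases R with
  | right x => exact hr _
  | left y => exact hl _
  | doubleCone x y =>
    rintro Φ (hΦ | hΦ)
    exacts [hr _ Φ hΦ, hl _ Φ hΦ]

/-- The domain condition of (b) is automatic here: exp(iΦ) maps ℋ^{ω,f} into itself, and this core
lies in dom T. -/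
theorem IsOmegaClosure.isAffiliated_of_fermi (hS : S.toFun = fun _ => -1) (hω : IsIndicatrix ω)
    {R : Region} {A : QForm S ω} {T : FockSpace S →ₗ.[ℂ] FockSpace S} (h : IsOmegaClosure A T)
    (hA : IsOmegaLocal m A R) : IsAffiliated T (localAlgebra S m ω R) := by
  refine h.isAffiliated hω ?_ hA
  rintro B ⟨Φ, hΦ, hB⟩ χ
  obtain ⟨c, hc⟩ := exists_sq_eq_of_mem_regionFamily hS R Φ hΦ
  exact h.core.le_domain (hB.apply_mem_of_sq hc χ)

end FermiExponentials

end IntegrableQFT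

end

theorem proposition3p4 (S : IntegrableQFT.ScatteringFunction) (m : ℝ) (hm : 0 < m) (ω : ℝ → ℝ)
    (hω : IntegrableQFT.IsIndicatrix ω) (R : IntegrableQFT.Region) :
    -- (a)
    (∀ A : IntegrableQFT.FockSpace S →L[ℂ] IntegrableQFT.FockSpace S,
      IntegrableQFT.IsQOmega (IntegrableQFT.ofBounded ω A) ∧
      (IntegrableQFT.IsOmegaLocal m (IntegrableQFT.ofBounded ω A) R ↔
        A ∈ IntegrableQFT.localAlgebra S m ω R)) ∧
    -- (b)
    (∀ (A : IntegrableQFT.QForm S ω)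
      (T : IntegrableQFT.FockSpace S →ₗ.[ℂ] IntegrableQFT.FockSpace S),
      IntegrableQFT.IsQOmega A → IntegrableQFT.IsOmegaClosure A T →
      (IntegrableQFT.WeylDomainCondition m ω T R →
        (IntegrableQFT.IsOmegaLocal m A R ↔
          IntegrableQFT.IsAffiliated T (IntegrableQFT.localAlgebra S m ω R))) ∧
      (IntegrableQFT.IsAffiliated T (IntegrableQFT.localAlgebra S m ω R) →
        IntegrableQFT.IsOmegaLocal m A R)) ∧
    -- (c)
    ((S.toFun = fun _ => -1) →
      ∀ (A : IntegrableQFT.QForm S ω)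
        (T : IntegrableQFT.FockSpace S →ₗ.[ℂ] IntegrableQFT.FockSpace S),
        IntegrableQFT.IsQOmega A → IntegrableQFT.IsOmegaClosure A T →
        (IntegrableQFT.IsOmegaLocal m A R ↔
          IntegrableQFT.IsAffiliated T (IntegrableQFT.localAlgebra S m ω R))) := by
  open IntegrableQFT in
  refine ⟨fun A => ⟨isQOmega_ofBounded hω A, isOmegaLocal_ofBounded_iff hω R A⟩,
    fun A T _ hT => ⟨fun hW => ⟨hT.isAffiliated hω (expSet_subset_domain hω R hW),
      hT.isOmegaLocal hω⟩, hT.isOmegaLocal hω⟩,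
    fun hS A T _ hT => ⟨hT.isAffiliated_of_fermi hS hω, hT.isOmegaLocal hω⟩⟩
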